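/- A graph is finite and simple. A graph $G$ with vertex set $V$ is *unit-distance* if there is an injection $\varphi\colon V\to\mathbb R^2$ with $|\varphi(v)-\varphi(w)|=1$ for all adjacent $v,w$ (non-adjacent vertices may also be at distance $1$); otherwise $G$ is *forbidden*. A forbidden graph is *minimal* if each of its proper subgraphs is unit-distance. A graph is *biconnected* if it is connected and has no cut vertex. Let $F(n,m,i)$ be the following graphs with vertex set $\{0,\dots,n-1\}$ and $m$ edges, where $ab$ denotes the edge $\{a,b\}$. - $F(4,6,1)$: 01, 02, 03, 12, 13, 23 - $F(5,6,1)$: 01, 02, 04, 13, 23, 34 - $F(6,9,1)$: 01, 03, 05, 12, 13, 14, 24, 25, 34 - $F(7,10,1)$: 01, 02, 03, 12, 14, 16, 25, 35, 36, 45 - $F(7,11,1)$: 01, 03, 06, 12, 13, 14, 24, 25, 34, 45, 56 - $F(7,11,2)$: 02, 03, 05, 12, 13, 16, 23, 34, 45, 46, 56 - $F(8,12,1)$: 01, 02, 03, 12, 14, 25, 35, 36, 37, 45, 56, 57 - $F(8,12,2)$: 01, 02, 03, 12, 14, 25, 35, 37, 45, 46, 57, 67 - $F(8,12,3)$: 01,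 02, 07, 13, 16, 23, 24, 35, 45, 46, 57, 67 - $F(8,13,1)$: 01, 02, 04, 12, 13, 16, 23, 24, 25, 36, 45, 57, 67 - $F(8,13,2)$: 01, 03, 07, 12, 13, 14, 24, 25, 26, 34, 45, 56, 67 - $F(8,13,3)$: 01, 02, 04, 12, 13, 23, 24, 25, 26, 27, 37, 45, 56 - $F(8,13,4)$: 01, 02, 04, 12, 13, 17, 23, 24, 25, 26, 45, 56, 67 - $F(8,13,5)$: 01, 02, 04, 07, 12, 13, 24, 25, 26, 36, 37, 45, 56 - $F(8,13,6)$: 01, 02, 04, 12, 13, 24, 25, 26, 36, 37, 45, 47, 56 - $F(8,13,7)$: 01, 02, 04, 05, 12, 13, 23, 26, 37, 45, 46, 57, 67 - $F(8,13,8)$: 01, 02, 04, 12, 13, 23, 24, 37, 45, 46, 56, 57, 67 - $F(8,13,9)$: 01, 02, 03, 12, 16, 17, 25, 27, 34, 35, 45, 46, 67 - $F(8,13,10)$: 01, 02, 07, 12, 13, 23, 24, 35, 45, 46, 56, 57, 67 Let $\mathcal F_8=\{F(8,12,i):1\le i\le 3\}\cup\{F(8,13,i):1\le i\le 10\}$ and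 $\mathcal F_{\le 8}=\{F(4,6,1),F(5,6,1),F(6,9,1),F(7,10,1),F(7,11,1),F(7,11,2)\}\cup\mathcal F_8$. A graph is *$\mathcal F_{\le 8}$-free* if it has no subgraph isomorphic to an element of $\mathcal F_{\le 8}$. Let $G_{27}$ be the graph on the points $p_0,\dots,p_{26}$ of $\mathbb R^2$ given by - $p_{0}=(0,\ 0)$ - $p_{1}=(-1/2,\ \sqrt{3}/2)$ - $p_{2}=(1/2,\ \sqrt{3}/2)$ - $p_{3}=(1,\ 0)$ - $p_{4}=(1/2,\ -\sqrt{3}/2)$ - $p_{5}=(-1/2,\ -\sqrt{3}/2)$ - $p_{6}=(-1,\ 0)$ - $p_{7}=(\sqrt{33}/12 + 1/12,\ -\sqrt{11}/12 + \sqrt{3}/12)$ - $p_{8}=(\sqrt{33}/12 + 11/12,\ \sqrt{11}/12 + \sqrt{3}/12)$ - $p_{9}=(\sqrt{33}/6 + 1/2,\ -\sqrt{3}/3)$ - $p_{10}=(\sqrt{33}/6,\ \sqrt{3}/6)$ - $p_{11}=(3/2,\ \sqrt{3}/2)$ - $p_{12}=(\sqrt{33}/12 + 1/4,\ \sqrt{11}/4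 - 5\sqrt{3}/12)$ - $p_{13}=(\sqrt{33}/6 + 1,\ \sqrt{3}/6)$ - $p_{14}=(\sqrt{33}/12 - 5/12,\ -\sqrt{11}/12 - 5\sqrt{3}/12)$ - $p_{15}=(2,\ 0)$ - $p_{16}=(5/6,\ \sqrt{11}/6)$ - $p_{17}=(11/6,\ \sqrt{11}/6)$ - $p_{18}=(-\sqrt{385}/60 + 17/12,\ -7\sqrt{35}/60 + \sqrt{11}/12)$ - $p_{19}=(\sqrt{385}/60 + 17/12,\ 7\sqrt{35}/60 + \sqrt{11}/12)$ - $p_{20}=(5/2,\ \sqrt{3}/2)$ - $p_{21}=(\sqrt{33}/12 + 13/12,\ -\sqrt{11}/12 + \sqrt{3}/12)$ - $p_{22}=(\sqrt{33}/12 + 5/12,\ \sqrt{11}/12 - 5\sqrt{3}/12)$ - $p_{23}=(3/2,\ -\sqrt{3}/2)$ - $p_{24}=(12/7,\ \sqrt{3}/7)$ - $p_{25}=(11/14,\ 5\sqrt{3}/14)$ - $p_{26}=(4/3,\ \sqrt{11}/6 + \sqrt{3}/2)$ with the 57 edges $p_ap_b$ for the following pairs $a$–$b$: 0–1, 0–2,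 0–3, 0–4, 0–5, 0–6, 0–10, 0–14, 0–16, 0–22, 0–25, 1–2, 1–6, 2–3, 2–7, 2–8, 2–11, 2–26, 3–4, 3–11, 3–13, 3–15, 3–17, 3–23, 4–5, 4–9, 4–12, 4–23, 5–6, 7–8, 7–9, 7–14, 7–21, 8–9, 8–22, 8–26, 9–10, 9–12, 9–13, 10–13, 11–15, 11–20, 11–21, 14–22, 15–18, 15–19, 15–20, 15–23, 16–17, 16–18, 16–19, 16–21, 16–22, 16–26, 17–26, 20–24, 24–25. **Theorem.** 1. A graph on exactly $8$ vertices is a minimal forbidden graph if and only if it is isomorphic to an element of $\mathcal F_8$. The $13$ graphs in $\mathcal F_8$ are pairwise non-isomorphic, and none of them is unit-distance. 2. Up to isomorphism there are exactly $7123$ biconnected graphs on $8$ vertices, and exactly $366$ of them are $\mathcal F_{\le 8}$-free. 3. The points $p_0,\dots,p_{26}$ are distinct and every edge of $G_{27}$ has length $1$, so $G_{27}$ is unit-distance. Every biconnected $\mathcal F_{\le 8}$-free graph on $8$ vertices is isomorphic to a (not necessarily induced) subgraph of $G_{27}$. -/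

import Mathlib

/-- The Euclidean plane `ℝ²`. -/
abbrev Plane : Type := EuclideanSpace ℝ (Fin 2)

/-- A graph is unit-distance if its vertices can be mapped injectively to the plane so that adjacent
vertices are at distance exactly 1 (non-adjacent vertices may be at distance 1 as well). -/
def IsUnitDistance {V : Type*} (G : SimpleGraph V) : Prop :=
  Nonempty (G.UnitDistEmbedding Plane)

/-- A graph is forbidden if it is not unit-distance. -/
def IsForbidden {V : Type*} (G : SimpleGraph V) : Prop := ¬ IsUnitDistance G

/-- A forbidden graph is minimal if each of its proper subgraphs is unit-distance. -/
def IsMinimalForbidden {V : Type*} (G : SimpleGraph V) : Prop :=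
  IsForbidden G ∧ ∀ H : G.Subgraph, H ≠ ⊤ → IsUnitDistance H.coe

/-- A graph is biconnected if it is connected and has no cut vertex. -/
def IsBiconnected {V : Type*} (G : SimpleGraph V) : Prop :=
  G.Connected ∧ ∀ v : V, (G.induce ({v}ᶜ : Set V)).Preconnected

/-- Being isomorphic, as an equivalence relation on the graphs with vertex set `{0, …, n - 1}`. -/
def isoSetoid (n : ℕ) : Setoid (SimpleGraph (Fin n)) where
  r G H := Nonempty (G ≃g H)
  iseqv := ⟨fun _ => ⟨SimpleGraph.Iso.refl⟩, fun ⟨e⟩ => ⟨e.symm⟩, fun ⟨e⟩ ⟨f⟩ => ⟨e.trans f⟩⟩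

/-- The number of isomorphism classes of graphs on `n` vertices that satisfy `P`. -/
noncomputable def numIsoClasses (n : ℕ) (P : SimpleGraph (Fin n) → Prop) : ℕ :=
  (Quotient.mk (isoSetoid n) '' {G | P G}).ncard

/-- The graph with vertex set `{0, …, n - 1}` and the listed edges. -/
def graphOfEdges (n : ℕ) (l : List (Fin n × Fin n)) : SimpleGraph (Fin n) :=
  SimpleGraph.fromRel fun a b => (a, b) ∈ l

/-- The graph `F(4,6,1)`: 4 vertices, 6 edges. -/
def F_4_6_1 : SimpleGraph (Fin 4) := graphOfEdges 4
  [(0, 1), (0, 2), (0, 3), (1, 2), (1, 3), (2, 3)]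

/-- The graph `F(5,6,1)`: 5 vertices, 6 edges. -/
def F_5_6_1 : SimpleGraph (Fin 5) := graphOfEdges 5
  [(0, 1), (0, 2), (0, 4), (1, 3), (2, 3), (3, 4)]

/-- The graph `F(6,9,1)`: 6 vertices, 9 edges. -/
def F_6_9_1 : SimpleGraph (Fin 6) := graphOfEdges 6
  [(0, 1), (0, 3), (0, 5), (1, 2), (1, 3), (1, 4), (2, 4), (2, 5), (3, 4)]

/-- The graph `F(7,10,1)`: 7 vertices, 10 edges. -/
def F_7_10_1 : SimpleGraph (Fin 7) := graphOfEdges 7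
  [(0, 1), (0, 2), (0, 3), (1, 2), (1, 4), (1, 6), (2, 5), (3, 5), (3, 6), (4, 5)]

/-- The graph `F(7,11,1)`: 7 vertices, 11 edges. -/
def F_7_11_1 : SimpleGraph (Fin 7) := graphOfEdges 7
  [(0, 1), (0, 3), (0, 6), (1, 2), (1, 3), (1, 4), (2, 4), (2, 5), (3, 4), (4, 5), (5, 6)]

/-- The graph `F(7,11,2)`: 7 vertices, 11 edges. -/
def F_7_11_2 : SimpleGraph (Fin 7) := graphOfEdges 7
  [(0, 2), (0, 3), (0, 5), (1, 2), (1, 3), (1, 6), (2, 3), (3, 4), (4, 5), (4, 6), (5, 6)]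

/-- The graph `F(8,12,1)`: 8 vertices, 12 edges. -/
def F_8_12_1 : SimpleGraph (Fin 8) := graphOfEdges 8
  [(0, 1), (0, 2), (0, 3), (1, 2), (1, 4), (2, 5), (3, 5), (3, 6), (3, 7), (4, 5), (5, 6),
   (5, 7)]

/-- The graph `F(8,12,2)`: 8 vertices, 12 edges. -/
def F_8_12_2 : SimpleGraph (Fin 8) := graphOfEdges 8
  [(0, 1), (0, 2), (0, 3), (1, 2), (1, 4), (2, 5), (3, 5), (3, 7), (4, 5), (4, 6), (5, 7),
   (6, 7)]

/-- The graph `F(8,12,3)`: 8 vertices, 12 edges. -/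
def F_8_12_3 : SimpleGraph (Fin 8) := graphOfEdges 8
  [(0, 1), (0, 2), (0, 7), (1, 3), (1, 6), (2, 3), (2, 4), (3, 5), (4, 5), (4, 6), (5, 7),
   (6, 7)]

/-- The graph `F(8,13,1)`: 8 vertices, 13 edges. -/
def F_8_13_1 : SimpleGraph (Fin 8) := graphOfEdges 8
  [(0, 1), (0, 2), (0, 4), (1, 2), (1, 3), (1, 6), (2, 3), (2, 4), (2, 5), (3, 6), (4, 5),
   (5, 7), (6, 7)]

/-- The graph `F(8,13,2)`: 8 vertices, 13 edges. -/
def F_8_13_2 : SimpleGraph (Fin 8) := graphOfEdges 8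
  [(0, 1), (0, 3), (0, 7), (1, 2), (1, 3), (1, 4), (2, 4), (2, 5), (2, 6), (3, 4), (4, 5),
   (5, 6), (6, 7)]

/-- The graph `F(8,13,3)`: 8 vertices, 13 edges. -/
def F_8_13_3 : SimpleGraph (Fin 8) := graphOfEdges 8
  [(0, 1), (0, 2), (0, 4), (1, 2), (1, 3), (2, 3), (2, 4), (2, 5), (2, 6), (2, 7), (3, 7),
   (4, 5), (5, 6)]

/-- The graph `F(8,13,4)`: 8 vertices, 13 edges. -/
def F_8_13_4 : SimpleGraph (Fin 8) := graphOfEdges 8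
  [(0, 1), (0, 2), (0, 4), (1, 2), (1, 3), (1, 7), (2, 3), (2, 4), (2, 5), (2, 6), (4, 5),
   (5, 6), (6, 7)]

/-- The graph `F(8,13,5)`: 8 vertices, 13 edges. -/
def F_8_13_5 : SimpleGraph (Fin 8) := graphOfEdges 8
  [(0, 1), (0, 2), (0, 4), (0, 7), (1, 2), (1, 3), (2, 4), (2, 5), (2, 6), (3, 6), (3, 7),
   (4, 5), (5, 6)]

/-- The graph `F(8,13,6)`: 8 vertices, 13 edges. -/
def F_8_13_6 : SimpleGraph (Fin 8) := graphOfEdges 8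
  [(0, 1), (0, 2), (0, 4), (1, 2), (1, 3), (2, 4), (2, 5), (2, 6), (3, 6), (3, 7), (4, 5),
   (4, 7), (5, 6)]

/-- The graph `F(8,13,7)`: 8 vertices, 13 edges. -/
def F_8_13_7 : SimpleGraph (Fin 8) := graphOfEdges 8
  [(0, 1), (0, 2), (0, 4), (0, 5), (1, 2), (1, 3), (2, 3), (2, 6), (3, 7), (4, 5), (4, 6),
   (5, 7), (6, 7)]

/-- The graph `F(8,13,8)`: 8 vertices, 13 edges. -/
def F_8_13_8 : SimpleGraph (Fin 8) := graphOfEdges 8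
  [(0, 1), (0, 2), (0, 4), (1, 2), (1, 3), (2, 3), (2, 4), (3, 7), (4, 5), (4, 6), (5, 6),
   (5, 7), (6, 7)]

/-- The graph `F(8,13,9)`: 8 vertices, 13 edges. -/
def F_8_13_9 : SimpleGraph (Fin 8) := graphOfEdges 8
  [(0, 1), (0, 2), (0, 3), (1, 2), (1, 6), (1, 7), (2, 5), (2, 7), (3, 4), (3, 5), (4, 5),
   (4, 6), (6, 7)]

/-- The graph `F(8,13,10)`: 8 vertices, 13 edges. -/
def F_8_13_10 : SimpleGraph (Fin 8) := graphOfEdges 8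
  [(0, 1), (0, 2), (0, 7), (1, 2), (1, 3), (2, 3), (2, 4), (3, 5), (4, 5), (4, 6), (5, 6),
   (5, 7), (6, 7)]

/-- The list `𝓕₈` of 13 graphs on 8 vertices: `F(8,12,1)`–`F(8,12,3)`, `F(8,13,1)`–`F(8,13,10)`. -/
def minForbidden8 : Fin 13 → SimpleGraph (Fin 8) :=
  ![F_8_12_1, F_8_12_2, F_8_12_3,
    F_8_13_1, F_8_13_2, F_8_13_3, F_8_13_4, F_8_13_5, F_8_13_6,
    F_8_13_7, F_8_13_8, F_8_13_9, F_8_13_10]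

/-- `G` contains no subgraph isomorphic to one of the six graphs on at most 7 vertices or one of the
13 graphs on 8 vertices listed above. -/
def IsFLe8Free {V : Type*} (G : SimpleGraph V) : Prop :=
  F_4_6_1.Free G ∧ F_5_6_1.Free G ∧ F_6_9_1.Free G ∧
  F_7_10_1.Free G ∧ F_7_11_1.Free G ∧ F_7_11_2.Free G ∧
  ∀ i, (minForbidden8 i).Free G

/-- The 27 points of the plane that are the vertices of `G₂₇`. -/
noncomputable def g27Point : Fin 27 → Plane :=
  ![!₂[0, 0],
    !₂[-1 / 2, √3 / 2],
    !₂[1 / 2, √3 / 2],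
    !₂[1, 0],
    !₂[1 / 2, -√3 / 2],
    !₂[-1 / 2, -√3 / 2],
    !₂[-1, 0],
    !₂[√33 / 12 + 1 / 12, -√11 / 12 + √3 / 12],
    !₂[√33 / 12 + 11 / 12, √11 / 12 + √3 / 12],
    !₂[√33 / 6 + 1 / 2, -√3 / 3],
    !₂[√33 / 6, √3 / 6],
    !₂[3 / 2, √3 / 2],
    !₂[√33 / 12 + 1 / 4, √11 / 4 - 5 * √3 / 12],
    !₂[√33 / 6 + 1, √3 / 6],
    !₂[√33 / 12 - 5 / 12, -√11 / 12 - 5 * √3 / 12],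
    !₂[2, 0],
    !₂[5 / 6, √11 / 6],
    !₂[11 / 6, √11 / 6],
    !₂[-√385 / 60 + 17 / 12, -7 * √35 / 60 + √11 / 12],
    !₂[√385 / 60 + 17 / 12, 7 * √35 / 60 + √11 / 12],
    !₂[5 / 2, √3 / 2],
    !₂[√33 / 12 + 13 / 12, -√11 / 12 + √3 / 12],
    !₂[√33 / 12 + 5 / 12, √11 / 12 - 5 * √3 / 12],
    !₂[3 / 2, -√3 / 2],
    !₂[12 / 7, √3 / 7],
    !₂[11 / 14, 5 * √3 / 14],
    !₂[4 / 3, √11 / 6 + √3 / 2]]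

/-- The graph `G₂₇`; its vertex `i` is drawn at the point `g27Point i`. -/
def G27 : SimpleGraph (Fin 27) := graphOfEdges 27
  [(0, 1), (0, 2), (0, 3), (0, 4), (0, 5), (0, 6), (0, 10), (0, 14), (0, 16), (0, 22), (0, 25),
   (1, 2), (1, 6), (2, 3), (2, 7), (2, 8), (2, 11), (2, 26), (3, 4), (3, 11), (3, 13), (3, 15),
   (3, 17), (3, 23), (4, 5), (4, 9), (4, 12), (4, 23), (5, 6), (7, 8), (7, 9), (7, 14),
   (7, 21), (8, 9), (8, 22), (8, 26), (9, 10), (9, 12), (9, 13), (10, 13), (11, 15), (11, 20),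
   (11, 21), (14, 22), (15, 18), (15, 19), (15, 20), (15, 23), (16, 17), (16, 18), (16, 19),
   (16, 21), (16, 22), (16, 26), (17, 26), (20, 24), (24, 25)]

/-! ### Unit-distance graphs in the complex plane -/

/-- The identification of the Euclidean plane with the complex plane. -/
noncomputable def planeEquivComplex : Plane ≃ₗᵢ[ℝ] ℂ := Complex.orthonormalBasisOneI.repr.symm

theorem isUnitDistance_iff_complex {V : Type*} {G : SimpleGraph V} :
    IsUnitDistance G ↔
      ∃ z : V → ℂ, Function.Injective z ∧ ∀ u v, G.Adj u v → ‖z u - z v‖ = 1 := by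
  constructor
  · rintro ⟨p, hp⟩
    refine ⟨fun v => planeEquivComplex (p v), planeEquivComplex.injective.comp p.injective, ?_⟩
    intro u v h
    rw [← dist_eq_norm, planeEquivComplex.dist_map, hp h]
  · rintro ⟨z, hz, h⟩
    refine ⟨⟨⟨fun v => planeEquivComplex.symm (z v),
      planeEquivComplex.symm.injective.comp hz⟩, ?_⟩⟩
    intro u v huv
    simp only [Function.Embedding.coeFn_mk]
    rw [planeEquivComplex.symm.dist_map, dist_eq_norm, h u v huv]

theorem IsUnitDistance.of_isContained {V W : Type*} {G : SimpleGraph V} {H : SimpleGraph W}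
    (h : H.IsContained G) (hG : IsUnitDistance G) : IsUnitDistance H :=
  ⟨hG.some.copy h.some⟩

theorem sq_re_add_sq_im_of_norm_eq_one {a b : ℂ} (h : ‖a - b‖ = 1) :
    (a.re - b.re) ^ 2 + (a.im - b.im) ^ 2 = 1 := by
  have := Complex.sq_norm (a - b)
  rw [h, Complex.normSq_apply] at this
  simp only [Complex.sub_re, Complex.sub_im] at this
  linarith

theorem sq_re_add_sq_im_of_norm_eq_one' {a : ℂ} (h : ‖a‖ = 1) : a.re ^ 2 + a.im ^ 2 = 1 := by
  simpa using sq_re_add_sq_im_of_norm_eq_one (a := a) (b := 0) (by simpa using h)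

theorem eq_zero_and_eq_zero_of_sq_add_sq {x y : ℝ} (h : x ^ 2 + y ^ 2 = 0) : x = 0 ∧ y = 0 := by
  have := (add_eq_zero_iff_of_nonneg (sq_nonneg x) (sq_nonneg y)).1 h
  simpa using this

/-- A quadrilateral with sides of length one is a rhombus. -/
theorem add_eq_add_of_unit_quadrilateral {a b c d : ℂ} (hab : a ≠ b) (hcd : c ≠ d)
    (hac : ‖a - c‖ = 1) (had : ‖a - d‖ = 1) (hbc : ‖b - c‖ = 1) (hbd : ‖b - d‖ = 1) :
    a + b = c + d := by
  have h1 := sq_re_add_sq_im_of_norm_eq_one hac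
  have h2 := sq_re_add_sq_im_of_norm_eq_one had
  have h3 := sq_re_add_sq_im_of_norm_eq_one hbc
  have h4 := sq_re_add_sq_im_of_norm_eq_one hbd
  have key : ((a.re + b.re - c.re - d.re) ^ 2 + (a.im + b.im - c.im - d.im) ^ 2) *
      (((a.re - b.re) ^ 2 + (a.im - b.im) ^ 2) * ((c.re - d.re) ^ 2 + (c.im - d.im) ^ 2)) = 0 := by
    set p := a.re - b.re with hp
    set q := a.im - b.im with hq
    set r := c.re - d.re with hr
    set t := c.im - d.im with ht
    set x := a.re + b.re - c.re - d.re with hx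
    set y := a.im + b.im - c.im - d.im with hy
    have e1 : p * x + q * y = 0 := by
      simp only [hp, hq, hx, hy]; linear_combination (h1 + h2 - h3 - h4) / 2
    have e2 : r * x + t * y = 0 := by
      simp only [hr, ht, hx, hy]; linear_combination (-h1 + h2 - h3 + h4) / 2
    have e3 : p * r + q * t = 0 := by
      simp only [hp, hq, hr, ht]; linear_combination (-h1 + h2 + h3 - h4) / 2
    have e4 : (x ^ 2 + y ^ 2) * (p * t - q * r) = 0 := by
      linear_combination (x * t - y * r) * e1 + (y * p - x * q) * e2
    linear_combination (p * t - q * r) * e4 + (x ^ 2 + y ^ 2) * (p * r + q * t) * e3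
  have hne : ∀ u v : ℂ, u ≠ v → (u.re - v.re) ^ 2 + (u.im - v.im) ^ 2 ≠ 0 := fun u v huv h0 =>
    huv (Complex.ext (sub_eq_zero.1 (eq_zero_and_eq_zero_of_sq_add_sq h0).1)
      (sub_eq_zero.1 (eq_zero_and_eq_zero_of_sq_add_sq h0).2))
  rcases mul_eq_zero.1 key with h | h
  · have h5 := eq_zero_and_eq_zero_of_sq_add_sq h
    apply Complex.ext <;> simp only [Complex.add_re, Complex.add_im] <;> linarith [h5.1, h5.2]
  · exact absurd h (mul_ne_zero (hne a b hab) (hne c d hcd))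

/-- If `u`, `v` span a unit equilateral triangle, then `u + 2 v` is not a sum of two unit vectors. -/
theorem not_add_unit_of_triangle {u v a b : ℂ} (hu : ‖u‖ = 1) (hv : ‖v‖ = 1) (huv : ‖u - v‖ = 1)
    (ha : ‖a‖ = 1) (hb : ‖b‖ = 1) (h : u + 2 * v = a + b) : False := by
  have h1 := sq_re_add_sq_im_of_norm_eq_one' hu
  have h2 := sq_re_add_sq_im_of_norm_eq_one' hv
  have h3 := sq_re_add_sq_im_of_norm_eq_one huv
  have h4 := sq_re_add_sq_im_of_norm_eq_one' ha
  have h5 := sq_re_add_sq_im_of_norm_eq_one' hb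
  have h6 := congrArg Complex.re h
  have h7 := congrArg Complex.im h
  simp at h6 h7
  have h8 : (a.re + b.re) ^ 2 + (a.im + b.im) ^ 2 = 7 := by
    rw [← h6, ← h7]; linear_combination 3 * h1 + 6 * h2 - 2 * h3
  nlinarith [sq_nonneg (a.re - b.re), sq_nonneg (a.im - b.im)]

/-- The long diagonal of a unit rhombus with a short diagonal of length one, compared with
the sides of a right triangle. -/
theorem norm_eq_one_of_right_triangle {w u a b : ℂ} (hu : ‖u‖ = 1) (hwu : ‖w + u‖ = 1)
    (ha : ‖a‖ = 1) (hb : ‖b‖ = 1) (hab : ‖a - b‖ = 1) (h : w - u = a + b) : ‖w‖ = 1 := by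
  have h1 := sq_re_add_sq_im_of_norm_eq_one' hu
  have h2 := sq_re_add_sq_im_of_norm_eq_one' hwu
  have h3 := sq_re_add_sq_im_of_norm_eq_one hab
  have h4 := sq_re_add_sq_im_of_norm_eq_one' ha
  have h5 := sq_re_add_sq_im_of_norm_eq_one' hb
  have h6 := congrArg Complex.re h
  have h7 := congrArg Complex.im h
  simp at h2 h6 h7
  have h8 : ‖w‖ ^ 2 = 1 := by
    rw [Complex.sq_norm, Complex.normSq_apply]
    have h9 : (w.re - u.re) ^ 2 + (w.im - u.im) ^ 2 = 3 := by
      rw [h6, h7]; linear_combination 2 * h4 + 2 * h5 - h3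
    linear_combination h2 / 2 + h9 / 2 - h1
  exact (pow_eq_one_iff_of_nonneg (norm_nonneg w) two_ne_zero).1 h8

theorem eq_neg_of_norm_add_two_mul {w u : ℂ} (hw : ‖w‖ = 1) (hu : ‖u‖ = 1)
    (h : ‖w + 2 * u‖ = 1) : w = -u := by
  have h1 := sq_re_add_sq_im_of_norm_eq_one' hu
  have h2 := sq_re_add_sq_im_of_norm_eq_one' hw
  have h3 := sq_re_add_sq_im_of_norm_eq_one' h
  simp at h3
  have h4 : (w.re + u.re) ^ 2 + (w.im + u.im) ^ 2 = 0 := by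
    linear_combination h3 / 2 + h2 / 2 - h1
  have h5 := eq_zero_and_eq_zero_of_sq_add_sq h4
  apply Complex.ext <;> simp <;> linarith [h5.1, h5.2]

/-! ### The listed graphs are forbidden -/

theorem graphOfEdges_adj {n : ℕ} {l : List (Fin n × Fin n)} {a b : Fin n} :
    (graphOfEdges n l).Adj a b ↔ a ≠ b ∧ ((a, b) ∈ l ∨ (b, a) ∈ l) := Iff.rfl

instance {n : ℕ} (l : List (Fin n × Fin n)) : DecidableRel (graphOfEdges n l).Adj := fun a b =>
  decidable_of_iff (a ≠ b ∧ ((a, b) ∈ l ∨ (b, a) ∈ l)) graphOfEdges_adj.symm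

/-- An injective drawing in which each edge has length one; `rhombus` and `edge` are what the
proofs below use of it. -/
structure UnitDrawing (n : ℕ) (l : List (Fin n × Fin n)) where
  z : Fin n → ℂ
  inj : Function.Injective z
  edge : ∀ a b, (graphOfEdges n l).Adj a b → ‖z a - z b‖ = 1

namespace UnitDrawing

variable {n : ℕ} {l : List (Fin n × Fin n)} (D : UnitDrawing n l)

theorem ne (a b : Fin n) (h : a ≠ b) : D.z a ≠ D.z b := D.inj.ne h

theorem rhombus (a b c d : Fin n) (h : a ≠ b ∧ c ≠ d ∧ (graphOfEdges n l).Adj a c ∧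
    (graphOfEdges n l).Adj a d ∧ (graphOfEdges n l).Adj b c ∧ (graphOfEdges n l).Adj b d) :
    D.z a + D.z b = D.z c + D.z d :=
  add_eq_add_of_unit_quadrilateral (D.ne a b h.1) (D.ne c d h.2.1) (D.edge _ _ h.2.2.1)
    (D.edge _ _ h.2.2.2.1) (D.edge _ _ h.2.2.2.2.1) (D.edge _ _ h.2.2.2.2.2)

theorem not_far (a b x c d e : Fin n) (h : (graphOfEdges n l).Adj a x ∧
    (graphOfEdges n l).Adj x b ∧ (graphOfEdges n l).Adj c e ∧ (graphOfEdges n l).Adj d e ∧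
    (graphOfEdges n l).Adj c d) (hab : D.z a - D.z b = D.z c - D.z e + 2 * (D.z d - D.z e)) :
    False :=
  not_add_unit_of_triangle (D.edge _ _ h.2.2.1) (D.edge _ _ h.2.2.2.1)
    (by rw [sub_sub_sub_cancel_right]; exact D.edge _ _ h.2.2.2.2) (D.edge _ _ h.1)
    (D.edge _ _ h.2.1) (by rw [← hab]; ring)

end UnitDrawing

theorem isForbidden_graphOfEdges {n : ℕ} {l : List (Fin n × Fin n)}
    (h : UnitDrawing n l → False) : IsForbidden (graphOfEdges n l) := fun hu =>
  let ⟨z, hz, hd⟩ := isUnitDistance_iff_complex.1 hu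
  h ⟨z, hz, hd⟩

theorem isForbidden_F_4_6_1 : IsForbidden F_4_6_1 := isForbidden_graphOfEdges fun D => by
  have h1 := D.rhombus 0 1 2 3 (by decide)
  have h2 := D.rhombus 0 2 1 3 (by decide)
  exact D.ne 1 2 (by decide) (by grind)

theorem isForbidden_F_5_6_1 : IsForbidden F_5_6_1 := isForbidden_graphOfEdges fun D => by
  have h1 := D.rhombus 0 3 1 2 (by decide)
  have h2 := D.rhombus 0 3 1 4 (by decide)
  exact D.ne 2 4 (by decide) (by grind)

theorem isForbidden_F_6_9_1 : IsForbidden F_6_9_1 := isForbidden_graphOfEdges fun D => by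
  have h1 := D.rhombus 0 4 1 3 (by decide)
  have h2 := D.rhombus 1 4 2 3 (by decide)
  have h3 := D.rhombus 0 2 1 5 (by decide)
  exact D.ne 1 5 (by decide) (by grind)

theorem isForbidden_F_7_10_1 : IsForbidden F_7_10_1 := isForbidden_graphOfEdges fun D => by
  have h1 := D.rhombus 0 5 2 3 (by decide)
  have h2 := D.rhombus 0 6 1 3 (by decide)
  have h3 := D.rhombus 1 5 2 4 (by decide)
  exact D.ne 4 6 (by decide) (by grind)

theorem isForbidden_F_7_11_1 : IsForbidden F_7_11_1 := isForbidden_graphOfEdges fun D => by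
  have h1 := D.rhombus 0 4 1 3 (by decide)
  have h2 := D.rhombus 1 4 2 3 (by decide)
  have h3 := D.rhombus 1 5 2 4 (by decide)
  exact D.not_far 0 5 6 1 3 4 (by decide) (by grind)

theorem isForbidden_F_7_11_2 : IsForbidden F_7_11_2 := isForbidden_graphOfEdges fun D => by
  have h1 := D.rhombus 0 1 2 3 (by decide)
  have h2 := D.rhombus 0 4 3 5 (by decide)
  have h3 := D.rhombus 1 4 3 6 (by decide)
  have h4 : D.z 0 - D.z 1 = D.z 5 - D.z 6 := by grind
  have h5 := add_eq_add_of_unit_quadrilateral (D.ne 0 2 (by decide)) (D.ne 1 3 (by decide))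
    (by rw [h4]; exact D.edge 5 6 (by decide)) (D.edge 0 3 (by decide)) (D.edge 2 1 (by decide))
    (D.edge 2 3 (by decide))
  exact D.ne 1 2 (by decide) (by grind)

theorem isForbidden_F_8_12_1 : IsForbidden F_8_12_1 := isForbidden_graphOfEdges fun D => by
  have h1 := D.rhombus 0 5 2 3 (by decide)
  have h2 := D.rhombus 1 5 2 4 (by decide)
  have h3 := D.rhombus 3 5 6 7 (by decide)
  have h4 : D.z 3 - D.z 4 = D.z 0 - D.z 1 := by grind
  have h5 := add_eq_add_of_unit_quadrilateral (D.ne 3 5 (by decide)) (D.ne 4 6 (by decide))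
    (by rw [h4]; exact D.edge 0 1 (by decide)) (D.edge 3 6 (by decide)) (D.edge 5 4 (by decide))
    (D.edge 5 6 (by decide))
  exact D.ne 4 7 (by decide) (by grind)

theorem isForbidden_F_8_12_2 : IsForbidden F_8_12_2 := isForbidden_graphOfEdges fun D => by
  have h1 := D.rhombus 0 5 2 3 (by decide)
  have h2 := D.rhombus 1 5 2 4 (by decide)
  have h3 := D.rhombus 4 7 5 6 (by decide)
  have h4 : D.z 4 - D.z 3 = D.z 1 - D.z 0 := by grind
  have h5 := add_eq_add_of_unit_quadrilateral (D.ne 4 7 (by decide)) (D.ne 3 5 (by decide))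
    (by rw [h4]; exact D.edge 1 0 (by decide)) (D.edge 4 5 (by decide)) (D.edge 7 3 (by decide))
    (D.edge 7 5 (by decide))
  exact D.ne 3 6 (by decide) (by grind)

theorem isForbidden_F_8_12_3 : IsForbidden F_8_12_3 := isForbidden_graphOfEdges fun D => by
  have h1 := D.rhombus 0 3 1 2 (by decide)
  have h2 := D.rhombus 0 6 1 7 (by decide)
  have h3 := D.rhombus 2 5 3 4 (by decide)
  have h4 := D.rhombus 4 7 5 6 (by decide)
  exact D.ne 0 1 (by decide) (by grind)

theorem isForbidden_F_8_13_1 : IsForbidden F_8_13_1 := isForbidden_graphOfEdges fun D => by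
  have h1 := D.rhombus 0 2 1 4 (by decide)
  have h2 := D.rhombus 0 3 1 2 (by decide)
  have h3 := D.rhombus 0 5 2 4 (by decide)
  have h4 := D.rhombus 1 3 2 6 (by decide)
  exact D.not_far 5 6 7 0 2 1 (by decide) (by grind)

theorem isForbidden_F_8_13_2 : IsForbidden F_8_13_2 := isForbidden_graphOfEdges fun D => by
  have h1 := D.rhombus 0 4 1 3 (by decide)
  have h2 := D.rhombus 1 4 2 3 (by decide)
  have h3 := D.rhombus 1 5 2 4 (by decide)
  have h4 := D.rhombus 2 5 4 6 (by decide)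
  have h5 : (D.z 0 - D.z 7) + (D.z 7 - D.z 6) = 3 * (D.z 3 - D.z 4) := by grind
  have h6 := norm_add_le (D.z 0 - D.z 7) (D.z 7 - D.z 6)
  rw [h5, norm_mul, D.edge 0 7 (by decide), D.edge 7 6 (by decide), D.edge 3 4 (by decide)] at h6
  norm_num at h6

theorem isForbidden_F_8_13_3 : IsForbidden F_8_13_3 := isForbidden_graphOfEdges fun D => by
  have h1 := D.rhombus 0 2 1 4 (by decide)
  have h2 := D.rhombus 0 3 1 2 (by decide)
  have h3 := D.rhombus 0 5 2 4 (by decide)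
  have h4 := D.rhombus 1 7 2 3 (by decide)
  have h5 := D.rhombus 2 5 4 6 (by decide)
  exact D.ne 6 7 (by decide) (by grind)

theorem isForbidden_F_8_13_4 : IsForbidden F_8_13_4 := isForbidden_graphOfEdges fun D => by
  have h1 := D.rhombus 0 2 1 4 (by decide)
  have h2 := D.rhombus 0 3 1 2 (by decide)
  have h3 := D.rhombus 0 5 2 4 (by decide)
  have h4 := D.rhombus 1 6 2 7 (by decide)
  have h5 := D.rhombus 2 5 4 6 (by decide)
  exact D.ne 3 7 (by decide) (by grind)

theorem isForbidden_F_8_13_5 : IsForbidden F_8_13_5 := isForbidden_graphOfEdges fun D => by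
  have h1 := D.rhombus 0 2 1 4 (by decide)
  have h2 := D.rhombus 0 3 1 7 (by decide)
  have h3 := D.rhombus 0 5 2 4 (by decide)
  have h4 := D.rhombus 1 6 2 3 (by decide)
  have h5 := D.rhombus 2 5 4 6 (by decide)
  exact D.ne 2 7 (by decide) (by grind)

theorem isForbidden_F_8_13_6 : IsForbidden F_8_13_6 := isForbidden_graphOfEdges fun D => by
  have h1 := D.rhombus 0 2 1 4 (by decide)
  have h2 := D.rhombus 0 5 2 4 (by decide)
  have h3 := D.rhombus 1 6 2 3 (by decide)
  have h4 := D.rhombus 2 5 4 6 (by decide)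
  have h5 : D.z 3 - D.z 2 = D.z 2 - D.z 4 := by grind
  have h6 := add_eq_add_of_unit_quadrilateral (D.ne 3 4 (by decide)) (D.ne 2 7 (by decide))
    (by rw [h5]; exact D.edge 2 4 (by decide)) (D.edge 3 7 (by decide)) (D.edge 4 2 (by decide))
    (D.edge 4 7 (by decide))
  exact D.ne 2 7 (by decide) (by grind)

theorem isForbidden_F_8_13_7 : IsForbidden F_8_13_7 := isForbidden_graphOfEdges fun D => by
  have h1 := D.rhombus 0 3 1 2 (by decide)
  have h2 := D.rhombus 0 6 2 4 (by decide)
  have h3 := D.rhombus 2 7 3 6 (by decide)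
  have h4 := D.rhombus 4 7 5 6 (by decide)
  have h5 : D.z 6 - D.z 5 = D.z 2 - D.z 1 := by grind
  have h6 := add_eq_add_of_unit_quadrilateral (D.ne 0 6 (by decide)) (D.ne 2 5 (by decide))
    (D.edge 0 2 (by decide)) (D.edge 0 5 (by decide)) (D.edge 6 2 (by decide))
    (by rw [h5]; exact D.edge 2 1 (by decide))
  exact D.ne 4 5 (by decide) (by grind)

theorem isForbidden_F_8_13_8 : IsForbidden F_8_13_8 := isForbidden_graphOfEdges fun D => by
  have h1 := D.rhombus 0 2 1 4 (by decide)
  have h2 := D.rhombus 0 3 1 2 (by decide)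
  have h3 := D.rhombus 4 7 5 6 (by decide)
  have h4 : ‖D.z 7 - D.z 2‖ = 1 :=
    norm_eq_one_of_right_triangle (u := D.z 4 - D.z 2) (a := D.z 5 - D.z 4) (b := D.z 6 - D.z 4)
      (D.edge 4 2 (by decide))
      (by rw [show D.z 7 - D.z 2 + (D.z 4 - D.z 2) = D.z 7 - D.z 3 by grind]
          exact D.edge 7 3 (by decide))
      (D.edge 5 4 (by decide)) (D.edge 6 4 (by decide))
      (by rw [sub_sub_sub_cancel_right]; exact D.edge 5 6 (by decide)) (by grind)
  have h5 := add_eq_add_of_unit_quadrilateral (D.ne 4 7 (by decide)) (D.ne 5 2 (by decide))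
    (D.edge 4 5 (by decide)) (D.edge 4 2 (by decide)) (D.edge 7 5 (by decide)) h4
  exact D.ne 2 6 (by decide) (by grind)

theorem isForbidden_F_8_13_9 : IsForbidden F_8_13_9 := isForbidden_graphOfEdges fun D => by
  have h1 := D.rhombus 0 5 2 3 (by decide)
  have h2 := D.rhombus 0 7 1 2 (by decide)
  have h3 := D.rhombus 1 7 2 6 (by decide)
  by_cases hxy : D.z 4 - D.z 3 = D.z 1 - D.z 0
  · have h4 : D.z 1 - D.z 3 = D.z 6 - D.z 4 := by grind
    have h5 := add_eq_add_of_unit_quadrilateral (D.ne 0 1 (by decide)) (D.ne 2 3 (by decide))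
      (D.edge 0 2 (by decide)) (D.edge 0 3 (by decide)) (D.edge 1 2 (by decide))
      (by rw [h4]; exact D.edge 6 4 (by decide))
    exact D.ne 5 1 (by decide) (by grind)
  · have h4 := add_eq_add_of_unit_quadrilateral (a := 0) (b := D.z 2 - D.z 0)
      (sub_ne_zero.2 (D.ne 2 0 (by decide))).symm hxy
      (by rw [zero_sub, norm_neg]; exact D.edge 4 3 (by decide))
      (by rw [zero_sub, norm_neg]; exact D.edge 1 0 (by decide))
      (by rw [show D.z 2 - D.z 0 - (D.z 4 - D.z 3) = D.z 5 - D.z 4 by grind]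
          exact D.edge 5 4 (by decide))
      (by rw [sub_sub_sub_cancel_right]; exact D.edge 2 1 (by decide))
    exact not_add_unit_of_triangle (D.edge 1 2 (by decide)) (D.edge 1 0 (by decide))
      (by rw [sub_sub_sub_cancel_left]; exact D.edge 0 2 (by decide))
      (D.edge 6 4 (by decide)) (D.edge 3 0 (by decide)) (by grind)

theorem isForbidden_F_8_13_10 : IsForbidden F_8_13_10 := isForbidden_graphOfEdges fun D => by
  have h1 := D.rhombus 0 3 1 2 (by decide)
  have h2 := D.rhombus 2 5 3 4 (by decide)
  have h3 := D.rhombus 4 7 5 6 (by decide)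
  by_cases hxy : D.z 1 - D.z 2 = D.z 6 - D.z 4
  · have h4 := eq_neg_of_norm_add_two_mul (D.edge 4 2 (by decide)) (D.edge 3 2 (by decide))
      (by rw [show D.z 4 - D.z 2 + 2 * (D.z 3 - D.z 2) = D.z 7 - D.z 0 by grind]
          exact D.edge 7 0 (by decide))
    exact D.ne 2 5 (by decide) (by grind)
  · have h4 := add_eq_add_of_unit_quadrilateral (a := 0) (b := D.z 3 - D.z 2)
      (sub_ne_zero.2 (D.ne 3 2 (by decide))).symm hxy
      (by rw [zero_sub, norm_neg]; exact D.edge 1 2 (by decide))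
      (by rw [zero_sub, norm_neg]; exact D.edge 6 4 (by decide))
      (by rw [sub_sub_sub_cancel_right]; exact D.edge 3 1 (by decide))
      (by rw [show D.z 3 - D.z 2 - (D.z 6 - D.z 4) = D.z 5 - D.z 6 by grind]
          exact D.edge 5 6 (by decide))
    exact not_add_unit_of_triangle (u := D.z 3 - D.z 2) (v := D.z 3 - D.z 1)
      (D.edge 3 2 (by decide)) (D.edge 3 1 (by decide))
      (by rw [sub_sub_sub_cancel_left]; exact D.edge 1 2 (by decide))
      (D.edge 7 0 (by decide)) (D.edge 2 4 (by decide)) (by grind)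

theorem isForbidden_minForbidden8 (i : Fin 13) : IsForbidden (minForbidden8 i) := by
  fin_cases i
  exacts [isForbidden_F_8_12_1, isForbidden_F_8_12_2, isForbidden_F_8_12_3, isForbidden_F_8_13_1,
    isForbidden_F_8_13_2, isForbidden_F_8_13_3, isForbidden_F_8_13_4, isForbidden_F_8_13_5,
    isForbidden_F_8_13_6, isForbidden_F_8_13_7, isForbidden_F_8_13_8, isForbidden_F_8_13_9,
    isForbidden_F_8_13_10]

theorem IsUnitDistance.isFLe8Free {V : Type*} {G : SimpleGraph V} (h : IsUnitDistance G) :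
    IsFLe8Free G :=
  ⟨fun hc => isForbidden_F_4_6_1 (h.of_isContained hc),
    fun hc => isForbidden_F_5_6_1 (h.of_isContained hc),
    fun hc => isForbidden_F_6_9_1 (h.of_isContained hc),
    fun hc => isForbidden_F_7_10_1 (h.of_isContained hc),
    fun hc => isForbidden_F_7_11_1 (h.of_isContained hc),
    fun hc => isForbidden_F_7_11_2 (h.of_isContained hc),
    fun i hc => isForbidden_minForbidden8 i (h.of_isContained hc)⟩

/-! ### The drawing of `G₂₇` -/

/-- The integer part of `40 • g27Point i`. -/
def g27Floor : Fin 27 → ℤ × ℤ :=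
  ![(0, 0), (-20, 34), (20, 34), (40, 0), (20, -35), (-20, -35), (-40, 0), (22, -6),
    (55, 16), (58, -24), (38, 11), (60, 34), (29, 4), (78, 11), (2, -40), (80, 0),
    (33, 22), (73, 22), (43, -17), (69, 38), (100, 34), (62, -6), (35, -18), (60, -35),
    (68, 9), (31, 24), (53, 56)]

theorem sqrt_eq_mul_33 : √33 = √3 * √11 := by
  rw [← Real.sqrt_mul (by norm_num)]; norm_num

theorem sqrt_eq_mul_385 : √385 = √35 * √11 := by
  rw [← Real.sqrt_mul (by norm_num)]; norm_num

theorem floor_eq_of_bounds {x y : ℝ} {m n : ℤ} (h : (m ≤ 40 * x ∧ 40 * x < m + 1) ∧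
    n ≤ 40 * y ∧ 40 * y < n + 1) :
    ⌊40 * (!₂[x, y] : Plane) 0⌋ = (m, n).1 ∧ ⌊40 * (!₂[x, y] : Plane) 1⌋ = (m, n).2 :=
  ⟨Int.floor_eq_iff.2 h.1, Int.floor_eq_iff.2 h.2⟩

theorem forall_vecCons {α β : Type*} {n : ℕ} {P : α → β → Prop} {a : α} {b : β} {v : Fin n → α}
    {w : Fin n → β} (h : P a b) (hvw : ∀ i, P (v i) (w i)) (i : Fin (n + 1)) :
    P (Matrix.vecCons a v i) (Matrix.vecCons b w i) := by
  refine Fin.cases h hvw i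

theorem floor_g27Point :
    ∀ i, ⌊40 * g27Point i 0⌋ = (g27Floor i).1 ∧ ⌊40 * g27Point i 1⌋ = (g27Floor i).2 := by
  have a3 : (1.732 : ℝ) < √3 := Real.lt_sqrt_of_sq_lt (by norm_num)
  have b3 : √3 < (1.7321 : ℝ) := (Real.sqrt_lt' (by norm_num)).2 (by norm_num)
  have a11 : (3.3166 : ℝ) < √11 := Real.lt_sqrt_of_sq_lt (by norm_num)
  have b11 : √11 < (3.3167 : ℝ) := (Real.sqrt_lt' (by norm_num)).2 (by norm_num)
  have a33 : (5.7445 : ℝ) < √33 := Real.lt_sqrt_of_sq_lt (by norm_num)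
  have b33 : √33 < (5.7446 : ℝ) := (Real.sqrt_lt' (by norm_num)).2 (by norm_num)
  have a35 : (5.916 : ℝ) < √35 := Real.lt_sqrt_of_sq_lt (by norm_num)
  have b35 : √35 < (5.9161 : ℝ) := (Real.sqrt_lt' (by norm_num)).2 (by norm_num)
  have a385 : (19.6214 : ℝ) < √385 := Real.lt_sqrt_of_sq_lt (by norm_num)
  have b385 : √385 < (19.6215 : ℝ) := (Real.sqrt_lt' (by norm_num)).2 (by norm_num)
  unfold g27Point g27Floor
  let P : Plane → ℤ × ℤ → Prop := fun p e => ⌊40 * p 0⌋ = e.1 ∧ ⌊40 * p 1⌋ = e.2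
  repeat (refine forall_vecCons (P := P) (floor_eq_of_bounds ?_) ?_; rotate_left)
  · exact fun i => i.elim0
  all_goals
    refine ⟨⟨?_, ?_⟩, ?_, ?_⟩ <;> push_cast <;> linarith

theorem g27Floor_injective : Function.Injective g27Floor := by
  decide +kernel

theorem g27Point_injective : Function.Injective g27Point := fun i j h =>
  g27Floor_injective (Prod.ext
    ((floor_g27Point i).1.symm.trans ((congrArg (fun p : Plane => ⌊40 * p 0⌋) h).trans
      (floor_g27Point j).1))
    ((floor_g27Point i).2.symm.trans ((congrArg (fun p : Plane => ⌊40 * p 1⌋) h).trans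
      (floor_g27Point j).2)))

theorem dist_eq_one_of_sq {x y x' y' : ℝ} (h : (x - x') ^ 2 + (y - y') ^ 2 = 1) :
    dist (!₂[x, y] : Plane) !₂[x', y'] = 1 := by
  rw [EuclideanSpace.dist_eq, Fin.sum_univ_two, Real.dist_eq, Real.dist_eq, sq_abs, sq_abs]
  simpa using h

/-- The edges of `G₂₇`. -/
def g27Edges : List (Fin 27 × Fin 27) :=
  [(0, 1), (0, 2), (0, 3), (0, 4), (0, 5), (0, 6), (0, 10), (0, 14), (0, 16), (0, 22), (0, 25),
   (1, 2), (1, 6), (2, 3), (2, 7), (2, 8), (2, 11), (2, 26), (3, 4), (3, 11), (3, 13), (3, 15),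
   (3, 17), (3, 23), (4, 5), (4, 9), (4, 12), (4, 23), (5, 6), (7, 8), (7, 9), (7, 14), (7, 21),
   (8, 9), (8, 22), (8, 26), (9, 10), (9, 12), (9, 13), (10, 13), (11, 15), (11, 20), (11, 21),
   (14, 22), (15, 18), (15, 19), (15, 20), (15, 23), (16, 17), (16, 18), (16, 19), (16, 21),
   (16, 22), (16, 26), (17, 26), (20, 24), (24, 25)]

theorem G27_eq : G27 = graphOfEdges 27 g27Edges := rfl

theorem dist_g27Point_eq_one_of_mem :
    ∀ e ∈ g27Edges, dist (g27Point e.1) (g27Point e.2) = 1 := by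
  have h3 : √3 ^ 2 = 3 := Real.sq_sqrt (by norm_num)
  have h11 : √11 ^ 2 = 11 := Real.sq_sqrt (by norm_num)
  have h35 : √35 ^ 2 = 35 := Real.sq_sqrt (by norm_num)
  simp only [g27Edges, List.forall_mem_cons, g27Point, Matrix.cons_val]
  refine ⟨?_, ?_, ?_, ?_, ?_, ?_, ?_, ?_, ?_, ?_, ?_, ?_, ?_, ?_, ?_, ?_, ?_, ?_, ?_, ?_, ?_, ?_,
    ?_, ?_, ?_, ?_, ?_, ?_, ?_, ?_, ?_, ?_, ?_, ?_, ?_, ?_, ?_, ?_, ?_, ?_, ?_, ?_, ?_, ?_, ?_,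
    ?_, ?_, ?_, ?_, ?_, ?_, ?_, ?_, ?_, ?_, ?_, ?_, by simp⟩ <;>
    refine dist_eq_one_of_sq ?_ <;> try simp only [sqrt_eq_mul_33, sqrt_eq_mul_385]
  all_goals
    ring_nf
    try simp only [h3, h11, h35]
    try norm_num

theorem dist_g27Point_eq_one (a b : Fin 27) (h : G27.Adj a b) :
    dist (g27Point a) (g27Point b) = 1 := by
  rw [G27_eq, graphOfEdges_adj] at h
  rcases h.2 with h | h
  · exact dist_g27Point_eq_one_of_mem (a, b) h
  · rw [dist_comm]
    exact dist_g27Point_eq_one_of_mem (b, a) h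

theorem isUnitDistance_G27 : IsUnitDistance G27 :=
  ⟨⟨⟨g27Point, g27Point_injective⟩, fun h => dist_g27Point_eq_one _ _ h⟩⟩

/-! ### Minimal forbidden graphs are biconnected -/

theorem exists_drawing_on {V : Type*} {G : SimpleGraph V} (hG : IsMinimalForbidden G) {s : Set V}
    {v y : V} (hv : v ∈ s) (hy : y ∉ s) : ∃ f : V → ℂ, Set.InjOn f s ∧ f v = 0 ∧
      ∀ a ∈ s, ∀ b ∈ s, G.Adj a b → ‖f a - f b‖ = 1 := by
  classical
  let H : G.Subgraph := (⊤ : G.Subgraph).induce s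
  have hH : H ≠ ⊤ := fun h => hy (by
    have : y ∈ H.verts := by rw [h]; trivial
    exact this)
  obtain ⟨z, hz, hzd⟩ := isUnitDistance_iff_complex.1 (hG.2 H hH)
  refine ⟨fun w => (if h : w ∈ s then z ⟨w, h⟩ else 0) - z ⟨v, hv⟩, ?_, ?_, ?_⟩
  · intro a ha b hb hab
    simp only [ha, hb, dif_pos, sub_left_inj] at hab
    exact congrArg Subtype.val (hz hab)
  · simp [hv]
  · intro a ha b hb hab
    simp only [ha, hb, dif_pos, sub_sub_sub_cancel_right]
    exact hzd ⟨a, ha⟩ ⟨b, hb⟩ ⟨ha, hb, hab⟩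

theorem exists_norm_eq_one_notMem {s : Set ℂ} (hs : s.Finite) : ∃ c : ℂ, ‖c‖ = 1 ∧ c ∉ s := by
  have h : (Metric.sphere (0 : ℂ) 1).Infinite :=
    (isPreconnected_sphere (by rw [Complex.rank_real_complex]; norm_num) 0 1).infinite_of_nontrivial
      ⟨1, by simp, -1, by simp, by norm_num⟩
  obtain ⟨c, hc, hcs⟩ := h.exists_notMem_finite hs
  exact ⟨c, by simpa using hc, hcs⟩

theorem connected_of_preconnected_induce_compl {V : Type*} [Fintype V] {G : SimpleGraph V}
    (h3 : 3 ≤ Fintype.card V) (h : ∀ v : V, (G.induce ({v}ᶜ : Set V)).Preconnected) :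
    G.Connected := by
  classical
  have : Nonempty V := Fintype.card_pos_iff.1 (by omega)
  refine ⟨fun x y => ?_⟩
  obtain ⟨v, hv⟩ : ∃ v, v ∉ ({x, y} : Finset V) := by
    by_contra! hall
    have := Finset.card_le_card (fun w _ => hall w : (Finset.univ : Finset V) ⊆ {x, y})
    rw [Finset.card_univ] at this
    have := Finset.card_le_two (a := x) (b := y)
    omega
  simp only [Finset.mem_insert, Finset.mem_singleton, not_or] at hv
  exact (h v ⟨x, fun h => hv.1 h.symm⟩ ⟨y, fun h => hv.2 h.symm⟩).map
    (SimpleGraph.Embedding.induce _).toHom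

theorem IsMinimalForbidden.isBiconnected {V : Type*} [Fintype V] {G : SimpleGraph V}
    (h3 : 3 ≤ Fintype.card V) (hG : IsMinimalForbidden G) : IsBiconnected G := by
  classical
  suffices h : ∀ v : V, (G.induce ({v}ᶜ : Set V)).Preconnected from
    ⟨connected_of_preconnected_induce_compl h3 h, h⟩
  intro v ⟨x, hx⟩ ⟨y, hy⟩
  by_contra hxy
  set K := G.induce ({v}ᶜ : Set V) with hK
  let R : Set V := {w | ∃ h : w ∈ ({v}ᶜ : Set V), K.Reachable ⟨x, hx⟩ ⟨w, h⟩}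
  have hvR : v ∉ R := fun ⟨h, _⟩ => h rfl
  have hxR : x ∈ R := ⟨hx, .rfl⟩
  have hyR : y ∉ R := fun ⟨_, h⟩ => hxy h
  have hyv : y ≠ v := hy
  have hstep : ∀ a b, a ∈ R → b ≠ v → G.Adj a b → b ∈ R := by
    rintro a b ⟨ha, har⟩ hb hab
    exact ⟨hb, har.trans (SimpleGraph.Adj.reachable (by simpa [hK] using hab))⟩
  obtain ⟨f, hf, hfv, hfd⟩ := exists_drawing_on hG (s := insert v R) (v := v) (y := y)
    (Set.mem_insert _ _) (by simp [hyv, hyR])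
  obtain ⟨g, hg, hgv, hgd⟩ := exists_drawing_on hG (s := Rᶜ) (v := v) (y := x) hvR (by simpa)
  obtain ⟨c, hc, hcs⟩ := exists_norm_eq_one_notMem
    (Set.finite_range fun p : V × V => f p.1 / g p.2)
  have hc0 : c ≠ 0 := by rintro rfl; simp at hc
  have hg0 : ∀ b, b ∉ R → b ≠ v → g b ≠ 0 := fun b hb hbv h0 =>
    hbv (hg hb hvR (h0.trans hgv.symm))
  have hmix : ∀ a b, a ∈ R → b ∉ R → f a ≠ c * g b := by
    intro a b ha hb hab
    by_cases hbv : b = v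
    · rw [hbv, hgv, mul_zero, ← hfv] at hab
      have := hf (Set.mem_insert_of_mem _ ha) (Set.mem_insert _ _) hab
      exact hvR (this ▸ ha)
    · exact hcs ⟨(a, b), by simp only [hab]; field_simp [hg0 b hb hbv]⟩
  refine hG.1 (isUnitDistance_iff_complex.2
    ⟨fun w => if w ∈ R then f w else c * g w, ?_, ?_⟩)
  · intro a b hab
    by_cases ha : a ∈ R <;> by_cases hb : b ∈ R <;> simp only [ha, hb, if_true, if_false] at hab
    · exact hf (Set.mem_insert_of_mem _ ha) (Set.mem_insert_of_mem _ hb) hab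
    · exact absurd hab (hmix a b ha hb)
    · exact absurd hab.symm (hmix b a hb ha)
    · exact hg ha hb (mul_left_cancel₀ hc0 hab)
  · have hcross : ∀ a b, a ∈ R → b ∉ R → G.Adj a b → ‖f a - c * g b‖ = 1 := by
      intro a b ha hb hab
      obtain rfl : b = v := by
        by_contra hbv
        exact hb (hstep a b ha hbv hab)
      rw [hgv, mul_zero, ← hfv]
      exact hfd a (Set.mem_insert_of_mem _ ha) _ (Set.mem_insert _ _) hab
    intro a b hab
    by_cases ha : a ∈ R <;> by_cases hb : b ∈ R <;> simp only [ha, hb, if_true, if_false]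
    · exact hfd a (Set.mem_insert_of_mem _ ha) b (Set.mem_insert_of_mem _ hb) hab
    · exact hcross a b ha hb hab
    · rw [norm_sub_rev]
      exact hcross b a hb ha hab.symm
    · rw [← mul_sub, norm_mul, hc, one_mul]
      exact hgd a ha b hb hab

/-! ### Packed adjacency matrices -/

/-- `force n k` is `k n`, but the kernel evaluates `n` to a numeral before it unfolds `k`. -/
noncomputable def force {α : Type} (n : ℕ) (k : ℕ → α) : α :=
  Nat.rec (k 0) (fun m _ => k (Nat.succ m)) n

@[simp] theorem force_eq {α : Type} (n : ℕ) (k : ℕ → α) : force n k = k n := by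
  cases n <;> rfl

/-- Bit `8 * i + j` of `N` tells whether `i` and `j` are adjacent in `G`. -/
def Packs (N : ℕ) (G : SimpleGraph (Fin 8)) : Prop :=
  ∀ i j : Fin 8, N.testBit (8 * i + j) = true ↔ G.Adj i j

/-- The bits `0`, `8`, …, `56`. -/
def colBits : ℕ := 0x101010101010101

/-- Moves bit `i` of `x` to position `8 * i`, for `i < 7`. -/
def spread (x : ℕ) : ℕ := Nat.land (Nat.mul x 0x40810204081) 0x1010101010101

theorem testBit_spread : ∀ x < 128, ∀ i < 8, ∀ t < 8,
    (spread x).testBit (8 * i + t) = (Nat.beq t 0 && x.testBit i) := by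
  decide +kernel

/-- Row and column `j` of the packed matrix, to the left of and above the diagonal. -/
def hook (j x : ℕ) : ℕ :=
  Nat.lor (Nat.shiftLeft x (Nat.mul 8 j)) (Nat.shiftLeft (spread x) j)

theorem testBit_hook {j x a b : ℕ} (hj : j < 8) (hx : x < 128) (ha : a < 8) (hb : b < 8) :
    (hook j x).testBit (8 * a + b) = true ↔
      (a = j ∧ x.testBit b = true) ∨ (b = j ∧ x.testBit a = true) := by
  have e : hook j x = x <<< (8 * j) ||| spread x <<< j := rfl
  rw [e, Nat.testBit_or, Nat.testBit_shiftLeft, Nat.testBit_shiftLeft]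
  simp only [Bool.or_eq_true, Bool.and_eq_true, decide_eq_true_eq]
  refine or_congr ?_ ?_
  · constructor
    · rintro ⟨h1, h2⟩
      by_cases haj : a = j
      · subst haj
        exact ⟨rfl, by simpa using h2⟩
      · rw [Nat.testBit_lt_two_pow (lt_of_lt_of_le hx
          (Nat.pow_le_pow_right two_pos (show 7 ≤ _ by omega)))] at h2
        exact absurd h2 (by simp)
    · rintro ⟨rfl, h⟩
      exact ⟨by omega, by simpa using h⟩
  · constructor
    · rintro ⟨h1, h2⟩
      by_cases hbj : j ≤ b
      · rw [show 8 * a + b - j = 8 * a + (b - j) by omega,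
          testBit_spread x hx a ha (b - j) (by omega)] at h2
        simp only [Bool.and_eq_true, Nat.beq_eq] at h2
        exact ⟨by omega, h2.2⟩
      · rw [show 8 * a + b - j = 8 * (a - 1) + (8 + b - j) by omega,
          testBit_spread x hx (a - 1) (by omega) (8 + b - j) (by omega)] at h2
        simp only [Bool.and_eq_true, Nat.beq_eq] at h2
        omega
    · rintro ⟨rfl, h⟩
      refine ⟨by omega, ?_⟩
      rw [show 8 * a + b - b = 8 * a + 0 by omega, testBit_spread x hx a ha 0 (by omega), h]
      rfl

/-- The bits of the code `c` for the pairs `(i, j)` with `i < j`. -/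
def codeRow (c j : ℕ) : ℕ :=
  Nat.mod (Nat.shiftRight c (Nat.div (Nat.mul j (Nat.pred j)) 2)) (Nat.pow 2 j)

theorem codeRow_lt (c j : ℕ) : codeRow c j < 2 ^ j := Nat.mod_lt _ (Nat.two_pow_pos j)

/-- The packed adjacency matrix of the graph in which `i < j` are adjacent if and only if
bit `j * (j - 1) / 2 + i` of `c` is set. -/
noncomputable def pack (c : ℕ) : ℕ :=
  force (hook 1 (codeRow c 1)) fun a =>
  force (codeRow c 2) fun x => force (Nat.lor a (hook 2 x)) fun a =>
  force (codeRow c 3) fun x => force (Nat.lor a (hook 3 x)) fun a =>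
  force (codeRow c 4) fun x => force (Nat.lor a (hook 4 x)) fun a =>
  force (codeRow c 5) fun x => force (Nat.lor a (hook 5 x)) fun a =>
  force (codeRow c 6) fun x => force (Nat.lor a (hook 6 x)) fun a =>
  force (codeRow c 7) fun x => Nat.lor a (hook 7 x)

theorem testBit_pack (c : ℕ) {a b : ℕ} (ha : a < 8) (hb : b < 8) :
    (pack c).testBit (8 * a + b) = true ↔
      (codeRow c a).testBit b = true ∨ (codeRow c b).testBit a = true := by
  have e : pack c = hook 1 (codeRow c 1) ||| hook 2 (codeRow c 2) ||| hook 3 (codeRow c 3) |||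
      hook 4 (codeRow c 4) ||| hook 5 (codeRow c 5) ||| hook 6 (codeRow c 6) |||
      hook 7 (codeRow c 7) := by
    simp only [pack, force_eq]; rfl
  have hj : ∀ j, 1 ≤ j → j < 8 → ((hook j (codeRow c j)).testBit (8 * a + b) = true ↔
      (a = j ∧ (codeRow c j).testBit b = true) ∨ (b = j ∧ (codeRow c j).testBit a = true)) :=
    fun j _ h => testBit_hook h (lt_of_lt_of_le (codeRow_lt c j)
      (Nat.pow_le_pow_right two_pos (show j ≤ 7 by omega))) ha hb
  have h0 : ∀ i, (codeRow c 0).testBit i = false := fun i => by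
    rw [show codeRow c 0 = 0 from Nat.lt_one_iff.1 (codeRow_lt c 0), Nat.zero_testBit]
  rw [e]
  simp only [Nat.testBit_or, Bool.or_eq_true, hj _ (le_refl 1) (by norm_num),
    hj 2 (by norm_num) (by norm_num), hj 3 (by norm_num) (by norm_num),
    hj 4 (by norm_num) (by norm_num), hj 5 (by norm_num) (by norm_num),
    hj 6 (by norm_num) (by norm_num), hj 7 (by norm_num) (by norm_num)]
  constructor
  · rintro ((((((h | h) | h) | h) | h) | h) | h) <;> rcases h with ⟨rfl, h⟩ | ⟨rfl, h⟩ <;> simp [h]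
  · rintro (h | h)
    · interval_cases a <;> simp_all
    · interval_cases b <;> simp_all

/-- The graph on `{0, …, 7}` with code `c`. -/
def codeGraph (c : ℕ) : SimpleGraph (Fin 8) where
  Adj i j := (pack c).testBit (8 * i + j) = true
  symm := ⟨fun i j h => by
    rw [testBit_pack c i.2 j.2] at h
    rw [testBit_pack c j.2 i.2]
    exact h.symm⟩
  loopless := ⟨fun i h => by
    rw [testBit_pack c i.2 i.2, or_self, Nat.testBit_lt_two_pow (codeRow_lt c i)] at h
    exact absurd h (by simp)⟩

theorem packs_pack (c : ℕ) : Packs (pack c) (codeGraph c) := fun _ _ => Iff.rfl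

theorem testBit_row {N : ℕ} {i j : ℕ} (hj : j < 8) :
    (Nat.land (Nat.shiftRight N (Nat.mul 8 i)) 255).testBit j = N.testBit (8 * i + j) := by
  change ((N >>> (8 * i)) &&& (2 ^ 8 - 1)).testBit j = _
  rw [Nat.and_two_pow_sub_one_eq_mod, Nat.testBit_mod_two_pow, Nat.testBit_shiftRight]
  simp [hj]

theorem row_lt (N i : ℕ) : Nat.land (Nat.shiftRight N (Nat.mul 8 i)) 255 < 256 :=
  lt_of_le_of_lt (Nat.and_le_right (n := N >>> (8 * i))) (by norm_num)

/-! ### A complete invariant of small graphs -/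

section Invariant

open scoped Classical in
/-- `∑ m ≤ k, (2 A) ^ m` for the adjacency matrix `A` of `G`. -/
noncomputable def walkMatrix {V : Type*} [Fintype V] (G : SimpleGraph V) : ℕ → V → V → ℕ
  | 0, i, j => if i = j then 1 else 0
  | k + 1, i, j => (if i = j then 1 else 0) + 2 * ∑ u, if G.Adj i u then walkMatrix G k u j else 0

/-- An invariant of the vertices of a graph. -/
noncomputable def vertexInvariant {V : Type*} [Fintype V] (G : SimpleGraph V) (j : V) : ℕ :=
  ∑ u, walkMatrix G 4 u j * (walkMatrix G 4 u u) ^ 2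

/-- An invariant of graphs. -/
noncomputable def graphInvariant {V : Type*} [Fintype V] (G : SimpleGraph V) : ℕ :=
  ∑ j, vertexInvariant G j ^ 2

variable {V W : Type*} [Fintype V] [Fintype W] {G : SimpleGraph V} {H : SimpleGraph W}

theorem walkMatrix_iso (e : G ≃g H) (k : ℕ) (i j : V) :
    walkMatrix H k (e i) (e j) = walkMatrix G k i j := by
  induction k generalizing i with
  | zero => rw [walkMatrix, walkMatrix, propext (e.injective.eq_iff (a := i) (b := j))]
  | succ k ih =>
    classical
    rw [walkMatrix, walkMatrix, propext (e.injective.eq_iff (a := i) (b := j)),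
      ← Equiv.sum_comp e.toEquiv]
    have h : ∀ u, (if H.Adj (e i) (e u) then walkMatrix H k (e u) (e j) else 0) =
        if G.Adj i u then walkMatrix G k u j else 0 := fun u => by
      rw [ih u, propext (SimpleGraph.Iso.map_adj_iff e)]
    refine congrArg _ (congrArg _ (Finset.sum_congr rfl fun u _ => ?_))
    convert h u <;> rfl

theorem vertexInvariant_iso (e : G ≃g H) (j : V) :
    vertexInvariant H (e j) = vertexInvariant G j := by
  rw [vertexInvariant, vertexInvariant, ← Equiv.sum_comp e.toEquiv]
  refine Finset.sum_congr rfl fun u _ => ?_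
  change walkMatrix H 4 (e u) (e j) * walkMatrix H 4 (e u) (e u) ^ 2 = _
  rw [walkMatrix_iso, walkMatrix_iso]

theorem graphInvariant_iso (e : G ≃g H) : graphInvariant H = graphInvariant G := by
  rw [graphInvariant, graphInvariant, ← Equiv.sum_comp e.toEquiv]
  exact Finset.sum_congr rfl fun j _ => congrArg (· ^ 2) (vertexInvariant_iso e j)

theorem walkMatrix_le (G : SimpleGraph (Fin 8)) (k : ℕ) (i j : Fin 8) :
    walkMatrix G k i j ≤ 17 ^ k := by
  induction k generalizing i with
  | zero => rw [walkMatrix]; split_ifs <;> simp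
  | succ k ih =>
    have key : ∀ a b c : ℕ, a ≤ c → b ≤ 8 * c → a + 2 * b ≤ 17 * c := by omega
    rw [walkMatrix, pow_succ']
    refine key _ _ _ (le_trans (by split_ifs <;> simp) (Nat.one_le_pow k 17 (by norm_num))) ?_
    have h : ∑ _u : Fin 8, 17 ^ k = 8 * 17 ^ k := by simp
    rw [← h]
    refine Finset.sum_le_sum fun u _ => ?_
    split_ifs
    · exact ih u
    · exact Nat.zero_le _

theorem walkMatrix_lt (G : SimpleGraph (Fin 8)) {k : ℕ} (hk : k ≤ 4) (i j : Fin 8) :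
    walkMatrix G k i j < 2 ^ 64 :=
  lt_of_le_of_lt (walkMatrix_le G k i j)
    (lt_of_le_of_lt (Nat.pow_le_pow_right (by norm_num) hk) (by norm_num))

theorem vertexInvariant_lt (G : SimpleGraph (Fin 8)) (j : Fin 8) :
    vertexInvariant G j < 2 ^ 64 := by
  have h : vertexInvariant G j ≤ ∑ _u : Fin 8, 17 ^ 4 * (17 ^ 4) ^ 2 :=
    Finset.sum_le_sum fun u _ => Nat.mul_le_mul (walkMatrix_le G 4 u j)
      (Nat.pow_le_pow_left (walkMatrix_le G 4 u u) 2)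
  exact lt_of_le_of_lt h (by norm_num)

end Invariant

/-! ### Evaluation of the invariant on packed matrices -/

set_option exponentiation.threshold 8192

theorem sum_mul_pow_lt {n b : ℕ} (f : Fin n → ℕ) (hf : ∀ i, f i < b) :
    ∑ i, f i * b ^ (i : ℕ) < b ^ n := by
  induction n with
  | zero => simp
  | succ n ih =>
    rw [Fin.sum_univ_castSucc, pow_succ]
    have h1 := ih (fun i => f i.castSucc) fun i => hf _
    have h2 : (f (Fin.last n) + 1) * b ^ n ≤ b * b ^ n := Nat.mul_le_mul_right _ (hf _)
    simp only [Fin.val_castSucc, Fin.val_last] at *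
    nlinarith

theorem sum_mul_pow_div_mod {n b : ℕ} (f : Fin n → ℕ) (hf : ∀ i, f i < b) (k : Fin n) :
    (∑ i, f i * b ^ (i : ℕ)) / b ^ (k : ℕ) % b = f k := by
  induction n with
  | zero => exact k.elim0
  | succ n ih =>
    have hb : 0 < b := lt_of_le_of_lt (Nat.zero_le _) (hf 0)
    have e : ∑ i, f i * b ^ (i : ℕ) = f 0 + b * ∑ i : Fin n, f i.succ * b ^ (i : ℕ) := by
      rw [Fin.sum_univ_succ, Finset.mul_sum]
      simp only [Fin.val_zero, pow_zero, mul_one, Fin.val_succ, pow_succ]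
      congr 1
      exact Finset.sum_congr rfl fun i _ => by ring
    rw [e]
    refine Fin.cases ?_ (fun k => ?_) k
    · rw [Fin.val_zero, pow_zero, Nat.div_one, Nat.add_mul_mod_self_left, Nat.mod_eq_of_lt (hf 0)]
    · rw [Fin.val_succ, pow_succ', ← Nat.div_div_eq_div_mul, Nat.add_mul_div_left _ _ hb,
        Nat.div_eq_of_lt (hf 0), zero_add]
      exact ih (fun i => f i.succ) (fun i => hf _) k

/-- A vector of eight numbers below `2 ^ 64`. -/
def packVec (f : Fin 8 → ℕ) : ℕ := ∑ j, f j * (2 ^ 64) ^ (j : ℕ)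

/-- A matrix of numbers below `2 ^ 64`. -/
def packMat (M : Fin 8 → Fin 8 → ℕ) : ℕ := ∑ i, packVec (M i) * (2 ^ 512) ^ (i : ℕ)

def rowMask : ℕ := Nat.sub (Nat.pow 2 512) 1
def fieldMask : ℕ := Nat.sub (Nat.pow 2 64) 1

/-- The 64 bits of `M` from bit `s`. -/
def field (M s : ℕ) : ℕ := Nat.land (Nat.shiftRight M s) fieldMask

/-- The 512 bits of `M` from bit `s`. -/
def rowField (M s : ℕ) : ℕ := Nat.land (Nat.shiftRight M s) rowMask

theorem land_shiftRight_eq (M s k : ℕ) :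
    Nat.land (Nat.shiftRight M s) (Nat.sub (Nat.pow 2 k) 1) = M / 2 ^ s % 2 ^ k := by
  change (M >>> s) &&& (2 ^ k - 1) = _
  rw [Nat.and_two_pow_sub_one_eq_mod, Nat.shiftRight_eq_div_pow]

theorem field_eq (M s : ℕ) : field M s = M / 2 ^ s % 2 ^ 64 := by
  unfold field fieldMask
  exact land_shiftRight_eq M s 64

theorem rowField_eq (M s : ℕ) : rowField M s = M / 2 ^ s % 2 ^ 512 := by
  unfold rowField rowMask
  exact land_shiftRight_eq M s 512

theorem packVec_lt {f : Fin 8 → ℕ} (hf : ∀ j, f j < 2 ^ 64) : packVec f < 2 ^ 512 :=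
  lt_of_lt_of_eq (sum_mul_pow_lt f hf) (by rw [← pow_mul])

theorem field_packVec {f : Fin 8 → ℕ} (hf : ∀ j, f j < 2 ^ 64) (j : Fin 8) :
    field (packVec f) (64 * j) = f j := by
  rw [field_eq, pow_mul]
  exact sum_mul_pow_div_mod f hf j

theorem rowField_packMat {M : Fin 8 → Fin 8 → ℕ} (hM : ∀ i j, M i j < 2 ^ 64) (i : Fin 8) :
    rowField (packMat M) (512 * i) = packVec (M i) := by
  rw [rowField_eq, pow_mul]
  exact sum_mul_pow_div_mod _ (fun i => packVec_lt (hM i)) i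

theorem field_packMat {M : Fin 8 → Fin 8 → ℕ} (hM : ∀ i j, M i j < 2 ^ 64) (i j : Fin 8) :
    field (packMat M) (512 * i + 64 * j) = M i j := by
  rw [← field_packVec (hM i) j, ← rowField_packMat hM i, field_eq, field_eq, rowField_eq, pow_add,
    ← Nat.div_div_eq_div_mul]
  have e : (2 : ℕ) ^ 512 = 2 ^ (64 * (j : ℕ)) * 2 ^ (512 - 64 * (j : ℕ)) := by
    rw [← pow_add]
    congr 1
    omega
  rw [e, Nat.mod_mul_right_div_self]
  exact (Nat.mod_mod_of_dvd _ (pow_dvd_pow 2 (by omega))).symm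

def colFactor : ℕ := Nat.div (Nat.sub (Nat.pow 2 4088) 1) (Nat.sub (Nat.pow 2 511) 1)
def colMask : ℕ := Nat.div (Nat.sub (Nat.pow 2 4096) 1) (Nat.sub (Nat.pow 2 512) 1)

/-- Moves bit `i` of `x` to position `512 * i`, for `i < 8`. -/
def spreadWide (x : ℕ) : ℕ := Nat.land (Nat.mul x colFactor) colMask

theorem spreadWide_eq : ∀ x < 256,
    spreadWide x = ∑ i : Fin 8, (x.testBit i).toNat * (2 ^ 512) ^ (i : ℕ) := by
  have h : ∀ x < 256, Nat.beq (spreadWide x) ((x.testBit 0).toNat +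
      (x.testBit 1).toNat * Nat.pow 2 512 + (x.testBit 2).toNat * Nat.pow 2 1024 +
      (x.testBit 3).toNat * Nat.pow 2 1536 + (x.testBit 4).toNat * Nat.pow 2 2048 +
      (x.testBit 5).toNat * Nat.pow 2 2560 + (x.testBit 6).toNat * Nat.pow 2 3072 +
      (x.testBit 7).toNat * Nat.pow 2 3584) = true := by
    decide +kernel
  intro x hx
  rw [Nat.eq_of_beq_eq_true (h x hx), Fin.sum_univ_eight]
  simp only [← pow_mul, Nat.pow_eq, Fin.coe_ofNat_eq_mod, Nat.reduceMod, Nat.reduceMul, pow_zero,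
    mul_one]

/-- The neighbours of `u`, as a column of a packed matrix. -/
def neighborCol (N u : ℕ) : ℕ := spreadWide (Nat.land (Nat.shiftRight N (Nat.mul 8 u)) 255)

open scoped Classical in
theorem neighborCol_eq {N : ℕ} {G : SimpleGraph (Fin 8)} (h : Packs N G) (u : Fin 8) :
    neighborCol N u = ∑ i : Fin 8, (if G.Adj i u then 1 else 0) * (2 ^ 512) ^ (i : ℕ) := by
  rw [neighborCol, spreadWide_eq _ (row_lt N u)]
  refine Finset.sum_congr rfl fun i _ => ?_
  rw [testBit_row i.2]
  have := h u i
  rw [G.adj_comm] at this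
  by_cases hG : G.Adj i u
  · rw [this.2 hG, if_pos hG]; rfl
  · rw [Bool.eq_false_iff.2 (fun hb => hG (this.1 hb)), if_neg hG]; rfl

/-- The product of the matrix with columns `c0, …, c7` with the packed matrix `M`. -/
def mulPacked (M c0 c1 c2 c3 c4 c5 c6 c7 : ℕ) : ℕ :=
  Nat.add (Nat.add (Nat.add (Nat.add (Nat.add (Nat.add (Nat.add
    (Nat.mul (rowField M 0) c0) (Nat.mul (rowField M 512) c1)) (Nat.mul (rowField M 1024) c2))
    (Nat.mul (rowField M 1536) c3)) (Nat.mul (rowField M 2048) c4)) (Nat.mul (rowField M 2560) c5))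
    (Nat.mul (rowField M 3072) c6)) (Nat.mul (rowField M 3584) c7)

theorem mulPacked_eq {M : Fin 8 → Fin 8 → ℕ} (hM : ∀ i j, M i j < 2 ^ 64) (c : Fin 8 → ℕ) :
    mulPacked (packMat M) (c 0) (c 1) (c 2) (c 3) (c 4) (c 5) (c 6) (c 7) =
      ∑ u, packVec (M u) * c u := by
  simp only [← rowField_packMat hM, Fin.sum_univ_eight]
  rfl

def packedOne : ℕ := Nat.div (Nat.sub (Nat.pow 2 4608) 1) (Nat.sub (Nat.pow 2 576) 1)

/-- One more step of the recursion for `walkMatrix`. -/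
def walkStep (M c0 c1 c2 c3 c4 c5 c6 c7 : ℕ) : ℕ :=
  Nat.add packedOne (Nat.mul 2 (mulPacked M c0 c1 c2 c3 c4 c5 c6 c7))

theorem packedOne_eq (G : SimpleGraph (Fin 8)) : packedOne = packMat (walkMatrix G 0) := by
  have h : Nat.beq packedOne (packMat fun i j => if i = j then 1 else 0) = true := by
    decide +kernel
  rw [Nat.eq_of_beq_eq_true h]
  refine congrArg packMat (funext fun i => funext fun j => ?_)
  rw [walkMatrix]
  split_ifs <;> rfl

theorem packMat_add (A B : Fin 8 → Fin 8 → ℕ) :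
    packMat (fun i j => A i j + 2 * B i j) = packMat A + 2 * packMat B := by
  simp only [packMat, packVec, Finset.mul_sum, Finset.sum_mul, ← Finset.sum_add_distrib]
  exact Finset.sum_congr rfl fun i _ => Finset.sum_congr rfl fun j _ => by ring

theorem sum_packVec_mul (A M : Fin 8 → Fin 8 → ℕ) :
    ∑ u, packVec (M u) * ∑ i : Fin 8, A i u * (2 ^ 512) ^ (i : ℕ) =
      packMat fun i j => ∑ u, A i u * M u j := by
  simp only [packMat, packVec, Finset.mul_sum, Finset.sum_mul]
  rw [Finset.sum_comm]
  refine Finset.sum_congr rfl fun i _ => ?_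
  rw [Finset.sum_comm]
  exact Finset.sum_congr rfl fun u _ => Finset.sum_congr rfl fun j _ => by ring

theorem walkStep_eq {N : ℕ} {G : SimpleGraph (Fin 8)} (h : Packs N G) {k : ℕ} (hk : k ≤ 4) :
    walkStep (packMat (walkMatrix G k)) (neighborCol N 0) (neighborCol N 1) (neighborCol N 2)
      (neighborCol N 3) (neighborCol N 4) (neighborCol N 5) (neighborCol N 6) (neighborCol N 7) =
      packMat (walkMatrix G (k + 1)) := by
  classical
  have e := mulPacked_eq (walkMatrix_lt G hk) fun u : Fin 8 => neighborCol N u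
  simp only [Fin.coe_ofNat_eq_mod, Nat.reduceMod] at e
  rw [walkStep, e, packedOne_eq G]
  simp only [neighborCol_eq h]
  rw [sum_packVec_mul (fun i u => if G.Adj i u then 1 else 0), Nat.add_eq, Nat.mul_eq,
    ← packMat_add]
  refine congrArg packMat (funext fun i => funext fun j => ?_)
  simp only [walkMatrix, ite_mul, one_mul, zero_mul]

/-- The packed matrix `walkMatrix G 4`, for the graph with packed adjacency matrix `N`. -/
noncomputable def walkPacked (N : ℕ) : ℕ :=
  force (neighborCol N 0) fun c0 => force (neighborCol N 1) fun c1 =>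
  force (neighborCol N 2) fun c2 => force (neighborCol N 3) fun c3 =>
  force (neighborCol N 4) fun c4 => force (neighborCol N 5) fun c5 =>
  force (neighborCol N 6) fun c6 => force (neighborCol N 7) fun c7 =>
  force (walkStep packedOne c0 c1 c2 c3 c4 c5 c6 c7) fun M =>
  force (walkStep M c0 c1 c2 c3 c4 c5 c6 c7) fun M =>
  force (walkStep M c0 c1 c2 c3 c4 c5 c6 c7) fun M => walkStep M c0 c1 c2 c3 c4 c5 c6 c7

theorem walkPacked_eq {N : ℕ} {G : SimpleGraph (Fin 8)} (h : Packs N G) :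
    walkPacked N = packMat (walkMatrix G 4) := by
  simp only [walkPacked, force_eq]
  rw [packedOne_eq G, walkStep_eq h (by norm_num), walkStep_eq h (by norm_num),
    walkStep_eq h (by norm_num), walkStep_eq h (by norm_num)]

def square (n : ℕ) : ℕ := Nat.mul n n

/-- The packed vector `vertexInvariant G`, for `M = packMat (walkMatrix G 4)`. -/
def vertexPacked (M : ℕ) : ℕ :=
  Nat.add (Nat.add (Nat.add (Nat.add (Nat.add (Nat.add (Nat.add
    (Nat.mul (rowField M 0) (square (field M 0)))
    (Nat.mul (rowField M 512) (square (field M 576))))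
    (Nat.mul (rowField M 1024) (square (field M 1152))))
    (Nat.mul (rowField M 1536) (square (field M 1728))))
    (Nat.mul (rowField M 2048) (square (field M 2304))))
    (Nat.mul (rowField M 2560) (square (field M 2880))))
    (Nat.mul (rowField M 3072) (square (field M 3456))))
    (Nat.mul (rowField M 3584) (square (field M 4032)))

theorem vertexPacked_eq (G : SimpleGraph (Fin 8)) :
    vertexPacked (packMat (walkMatrix G 4)) = packVec (vertexInvariant G) := by
  have hlt := walkMatrix_lt G (le_refl 4)
  have e : vertexPacked (packMat (walkMatrix G 4)) =
      ∑ u : Fin 8, rowField (packMat (walkMatrix G 4)) (512 * (u : ℕ)) *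
        (field (packMat (walkMatrix G 4)) (512 * (u : ℕ) + 64 * (u : ℕ)) *
          field (packMat (walkMatrix G 4)) (512 * (u : ℕ) + 64 * (u : ℕ))) := by
    rw [Fin.sum_univ_eight]
    rfl
  rw [e]
  simp only [rowField_packMat hlt, field_packMat hlt, packVec, vertexInvariant, Finset.sum_mul]
  rw [Finset.sum_comm]
  exact Finset.sum_congr rfl fun j _ => Finset.sum_congr rfl fun u _ => by ring

/-- `graphInvariant G`, for `I = packVec (vertexInvariant G)`. -/
def invariantPacked (I : ℕ) : ℕ :=
  Nat.add (Nat.add (Nat.add (Nat.add (Nat.add (Nat.add (Nat.add (square (field I 0))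
    (square (field I 64))) (square (field I 128))) (square (field I 192))) (square (field I 256)))
    (square (field I 320))) (square (field I 384))) (square (field I 448))

theorem invariantPacked_eq (G : SimpleGraph (Fin 8)) :
    invariantPacked (packVec (vertexInvariant G)) = graphInvariant G := by
  have hlt := vertexInvariant_lt G
  simp only [graphInvariant, ← field_packVec hlt, Fin.sum_univ_eight, sq]
  rfl

/-! ### The size of an isomorphism class -/

open scoped Classical in
/-- The graphs isomorphic to `G`. -/
noncomputable def isoClass (G : SimpleGraph (Fin 8)) : Finset (SimpleGraph (Fin 8)) :=
  {H | Nonempty (G ≃g H)}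

theorem mem_isoClass {G H : SimpleGraph (Fin 8)} : H ∈ isoClass G ↔ Nonempty (G ≃g H) := by
  simp [isoClass]

attribute [irreducible] isoClass

open scoped Classical in
/-- The automorphisms of `G` that fix each vertex less than `k`. -/
noncomputable def autFixing (G : SimpleGraph (Fin 8)) (k : ℕ) : Finset (Equiv.Perm (Fin 8)) :=
  {σ | (∀ i j, G.Adj (σ i) (σ j) ↔ G.Adj i j) ∧ ∀ i : Fin 8, i.val < k → σ i = i}

open scoped Classical in
/-- The vertices that an automorphism fixing each vertex less than `k` may map `k` to. -/
noncomputable def autCell (G : SimpleGraph (Fin 8)) (k : Fin 8) : Finset (Fin 8) :=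
  {v | k ≤ v ∧ vertexInvariant G v = vertexInvariant G k ∧
    ∀ j < k, walkMatrix G 4 j v = walkMatrix G 4 j k}

theorem card_autFixing_le (G : SimpleGraph (Fin 8)) (k : Fin 8) :
    (autFixing G k).card ≤ (autFixing G (k + 1)).card * (autCell G k).card := by
  classical
  have h1 := Finset.card_le_mul_card_image (f := fun σ : Equiv.Perm (Fin 8) => σ k)
    (autFixing G k) (autFixing G (k + 1)).card ?_
  · refine h1.trans (Nat.mul_le_mul_left _ (Finset.card_le_card ?_))
    intro v hv
    obtain ⟨σ, hσ, rfl⟩ := Finset.mem_image.1 hv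
    simp only [autFixing, Finset.mem_filter, Finset.mem_univ, true_and] at hσ
    let e : G ≃g G := ⟨σ, hσ.1 _ _⟩
    simp only [autCell, Finset.mem_filter, Finset.mem_univ, true_and]
    refine ⟨?_, vertexInvariant_iso e k, fun j hj => ?_⟩
    · by_contra! hlt
      have := σ.injective (hσ.2 (σ k) hlt)
      omega
    · have := walkMatrix_iso e 4 j k
      rwa [show e j = j from hσ.2 j hj] at this
  · intro v hv
    obtain ⟨τ, hτ, rfl⟩ := Finset.mem_image.1 hv
    refine Finset.card_le_card_of_injOn (fun σ => τ⁻¹ * σ) ?_ fun a _ b _ h => mul_left_cancel h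
    intro σ hσ
    simp only [autFixing, Finset.coe_filter, Finset.mem_filter, Finset.mem_univ, true_and,
      Set.mem_ofPred_eq] at hσ hτ ⊢
    refine ⟨fun i j => ?_, fun i hi => ?_⟩
    · rw [← hτ.1]
      simp [hσ.1.1]
    · rw [Equiv.Perm.mul_apply, Equiv.Perm.inv_eq_iff_eq]
      rcases Nat.lt_succ_iff_lt_or_eq.1 hi with hi | hi
      · rw [hσ.1.2 i hi, hτ.2 i hi]
      · rw [Fin.ext hi, hσ.2]

theorem card_autFixing_eight (G : SimpleGraph (Fin 8)) : (autFixing G 8).card ≤ 1 := by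
  classical
  refine Finset.card_le_one.2 fun a ha b hb => ?_
  simp only [autFixing, Finset.mem_filter] at ha hb
  exact Equiv.ext fun i => (ha.2.2 i i.2).trans (hb.2.2 i i.2).symm

theorem card_autCell_seven (G : SimpleGraph (Fin 8)) : (autCell G 7).card ≤ 1 := by
  refine Finset.card_le_one.2 fun a ha b hb => ?_
  simp only [autCell, Finset.mem_filter] at ha hb
  omega

theorem comap_mem_isoClass (G : SimpleGraph (Fin 8)) (σ : Equiv.Perm (Fin 8)) :
    G.comap σ ∈ isoClass G := by
  rw [mem_isoClass]
  exact ⟨(SimpleGraph.Iso.comap σ G).symm⟩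

theorem factorial_le_mul_card_isoClass (G : SimpleGraph (Fin 8)) :
    40320 ≤ (autFixing G 0).card * (isoClass G).card := by
  classical
  have h1 := Finset.card_le_mul_card_image (f := fun σ : Equiv.Perm (Fin 8) => G.comap σ)
    Finset.univ (autFixing G 0).card ?_
  · have h2 : (Finset.univ.image fun σ : Equiv.Perm (Fin 8) => G.comap σ) ⊆ isoClass G := by
      rw [Finset.image_subset_iff]
      intro σ _
      exact comap_mem_isoClass G σ
    have h3 : (Finset.univ : Finset (Equiv.Perm (Fin 8))).card = 40320 := by
      rw [Finset.card_univ, Fintype.card_perm, Fintype.card_fin]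
      norm_num [Nat.factorial]
    have h4 := Nat.mul_le_mul_left (autFixing G 0).card (Finset.card_le_card h2)
    omega
  · intro H hH
    obtain ⟨τ, -, rfl⟩ := Finset.mem_image.1 hH
    refine Finset.card_le_card_of_injOn (fun σ => σ * τ⁻¹) ?_ fun a _ b _ h => mul_right_cancel h
    intro σ hσ
    simp only [autFixing, Finset.coe_filter, Finset.mem_univ, true_and,
      Set.mem_ofPred_eq] at hσ ⊢
    refine ⟨fun i j => ?_, fun i hi => absurd hi (Nat.not_lt_zero _)⟩
    have h2 : (G.comap σ).Adj (τ⁻¹ i) (τ⁻¹ j) ↔ (G.comap τ).Adj (τ⁻¹ i) (τ⁻¹ j) := by rw [hσ]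
    simpa using h2

/-- Compares columns `k` and `v` of the packed matrix `M` in the rows before row `n`. -/
noncomputable def sameAbove (M k v n : ℕ) : Bool :=
  Nat.rec true (fun j r => cond (Nat.beq (field M (Nat.add (Nat.mul 512 j) (Nat.mul 64 k)))
    (field M (Nat.add (Nat.mul 512 j) (Nat.mul 64 v)))) r false) n

theorem sameAbove_eq_true {M k v n : ℕ} : sameAbove M k v n = true ↔
    ∀ j < n, field M (512 * j + 64 * k) = field M (512 * j + 64 * v) := by
  induction n with
  | zero => exact iff_of_true rfl (by simp)
  | succ n ih =>
    rw [Nat.forall_lt_succ_right, ← ih, and_comm]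
    change cond (Nat.beq _ _) (sameAbove M k v n) false = true ↔ _
    rw [Bool.cond_false_right, Bool.and_eq_true, Nat.beq_eq]
    rfl

/-- One plus the number of `v`, `s ≤ v < s + n`, with the same invariants as `k`. -/
noncomputable def countSame (M I k Ik n s : ℕ) : ℕ :=
  Nat.rec (motive := fun _ => ℕ → ℕ) (fun _ => 1) (fun _ r v =>
    cond (Nat.beq (field I (Nat.mul 64 v)) Ik)
      (cond (sameAbove M k v k) (Nat.succ (r (Nat.succ v))) (r (Nat.succ v))) (r (Nat.succ v))) n s

theorem card_filter_lt_countSame {M I k Ik n s : ℕ} :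
    ((Finset.Ico s (s + n)).filter fun v => field I (64 * v) = Ik ∧
      ∀ j < k, field M (512 * j + 64 * k) = field M (512 * j + 64 * v)).card <
    countSame M I k Ik n s := by
  classical
  induction n generalizing s with
  | zero => simp [countSame]
  | succ n ih =>
    have h := ih (s := s + 1)
    rw [show s + (n + 1) = s + 1 + n by ring, ← Finset.insert_Ico_add_one_left_eq_Ico (by omega),
      Finset.filter_insert]
    have e : countSame M I k Ik (n + 1) s = cond (Nat.beq (field I (Nat.mul 64 s)) Ik)
      (cond (sameAbove M k s k) (Nat.succ (countSame M I k Ik n (s + 1)))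
        (countSame M I k Ik n (s + 1))) (countSame M I k Ik n (s + 1)) := rfl
    split_ifs with hp
    · have hp1 : Nat.beq (field I (Nat.mul 64 s)) Ik = true := by rw [Nat.beq_eq]; exact hp.1
      rw [e, hp1, sameAbove_eq_true.2 hp.2]
      exact lt_of_le_of_lt (Finset.card_insert_le _ _) (Nat.succ_lt_succ h)
    · refine lt_of_lt_of_le h ?_
      rw [e]
      cases Nat.beq (field I (Nat.mul 64 s)) Ik <;> cases sameAbove M k s k <;> simp

noncomputable def cellBound (M I k n : ℕ) : ℕ :=
  force (field I (Nat.mul 64 k)) fun Ik => countSame M I k Ik n (Nat.succ k)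

theorem card_autCell_le (G : SimpleGraph (Fin 8)) (k : Fin 8) {n : ℕ} (hn : k + 1 + n = 8) :
    (autCell G k).card ≤
      cellBound (packMat (walkMatrix G 4)) (packVec (vertexInvariant G)) k n := by
  classical
  rw [cellBound, force_eq]
  refine le_trans ?_ (Nat.succ_le_of_lt card_filter_lt_countSame)
  rw [Nat.succ_eq_add_one, ← Finset.card_insert_of_notMem (a := (k : ℕ)) (by simp)]
  refine Finset.card_le_card_of_injOn (fun v : Fin 8 => (v : ℕ)) ?_ fun a _ b _ h => Fin.ext h
  intro v hv
  simp only [autCell, Finset.coe_filter, Finset.mem_univ, true_and, Set.mem_ofPred_eq] at hv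
  simp only [Finset.coe_insert, Finset.coe_filter, Finset.mem_Ico, Set.mem_insert_iff,
    Set.mem_ofPred_eq]
  rcases hv.1.eq_or_lt with h | h
  · exact Or.inl (by rw [h])
  · refine Or.inr ⟨⟨by simpa using h, by have := v.2; simp only [Nat.succ_eq_add_one]; omega⟩,
      ?_, fun j hj => ?_⟩
    · change field _ _ = field _ (64 * k)
      rw [field_packVec (vertexInvariant_lt G), field_packVec (vertexInvariant_lt G), hv.2.1]
    · have := field_packMat (walkMatrix_lt G (le_refl 4)) ⟨j, by omega⟩
      simp only at this
      rw [this, this]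
      exact (hv.2.2 ⟨j, by omega⟩ hj).symm

/-- A bound for the number of automorphisms. -/
noncomputable def autBound (M I : ℕ) : ℕ :=
  Nat.mul (Nat.mul (Nat.mul (Nat.mul (Nat.mul (Nat.mul (cellBound M I 0 7) (cellBound M I 1 6))
    (cellBound M I 2 5)) (cellBound M I 3 4)) (cellBound M I 4 3)) (cellBound M I 5 2))
    (cellBound M I 6 1)

theorem card_autFixing_zero_le (G : SimpleGraph (Fin 8)) : (autFixing G 0).card ≤
    autBound (packMat (walkMatrix G 4)) (packVec (vertexInvariant G)) := by
  set M := packMat (walkMatrix G 4)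
  set I := packVec (vertexInvariant G)
  have h : ∀ (k : Fin 8) (n : ℕ), k + 1 + n = 8 →
      (autFixing G k).card ≤ cellBound M I k n * (autFixing G (k + 1)).card := fun k n hn => by
    rw [mul_comm]
    exact (card_autFixing_le G k).trans (Nat.mul_le_mul_left _ (card_autCell_le G k hn))
  have h7 : (autFixing G 7).card ≤ 1 :=
    (card_autFixing_le G 7).trans (Nat.mul_le_mul (card_autFixing_eight G) (card_autCell_seven G))
  calc (autFixing G 0).card
      ≤ cellBound M I 0 7 * (cellBound M I 1 6 * (cellBound M I 2 5 * (cellBound M I 3 4 *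
        (cellBound M I 4 3 * (cellBound M I 5 2 * (cellBound M I 6 1 * 1)))))) := by
        refine (h 0 7 rfl).trans (Nat.mul_le_mul_left _ ?_)
        refine (h 1 6 rfl).trans (Nat.mul_le_mul_left _ ?_)
        refine (h 2 5 rfl).trans (Nat.mul_le_mul_left _ ?_)
        refine (h 3 4 rfl).trans (Nat.mul_le_mul_left _ ?_)
        refine (h 4 3 rfl).trans (Nat.mul_le_mul_left _ ?_)
        refine (h 5 2 rfl).trans (Nat.mul_le_mul_left _ ?_)
        exact (h 6 1 rfl).trans (Nat.mul_le_mul_left _ h7)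
    _ = autBound M I := by simp only [autBound, Nat.mul_eq, mul_one, mul_assoc]

theorem div_autBound_le_card_isoClass (G : SimpleGraph (Fin 8)) :
    40320 / autBound (packMat (walkMatrix G 4)) (packVec (vertexInvariant G)) ≤
      (isoClass G).card :=
  Nat.div_le_of_le_mul ((factorial_le_mul_card_isoClass G).trans
    (Nat.mul_le_mul_right _ (card_autFixing_zero_le G)))

/-! ### Testing biconnectedness -/

/-- Adds to a packed relation `M` the pairs that are related by way of `k`. -/
def warshallStep (M k : ℕ) : ℕ :=
  Nat.lor M (Nat.mul (Nat.land (Nat.shiftRight M k) colBits)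
    (Nat.land (Nat.shiftRight M (Nat.mul 8 k)) 255))

theorem testBit_mul_of_sparse {r : ℕ} (hr : r < 256) {j : ℕ} (hj : j < 8) (i : ℕ) :
    ∀ C : ℕ, (∀ t, C.testBit t = true → 8 ∣ t) →
      (C * r).testBit (8 * i + j) = (C.testBit (8 * i) && r.testBit j) := by
  have key : ∀ C : ℕ, (∀ t, C.testBit t = true → 8 ∣ t) → C % 2 ^ 8 < 2 ^ 1 := fun C hC => by
    refine Nat.lt_pow_two_of_testBit _ fun t ht => ?_
    rw [Nat.testBit_mod_two_pow]
    by_contra h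
    simp only [Bool.not_eq_false, Bool.and_eq_true, decide_eq_true_eq] at h
    have := hC t h.2
    omega
  have split : ∀ C : ℕ, C * r = 2 ^ 8 * (C / 2 ^ 8 * r) + C % 2 ^ 8 * r := fun C => by
    conv_lhs => rw [← Nat.div_add_mod C (2 ^ 8)]
    ring
  have small : ∀ C : ℕ, (∀ t, C.testBit t = true → 8 ∣ t) → C % 2 ^ 8 * r < 2 ^ 8 := fun C hC => by
    have h := Nat.mul_le_mul_right r (Nat.le_of_lt_succ (key C hC))
    omega
  induction i with
  | zero =>
    intro C hC
    have h1 := key C hC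
    rw [split, Nat.testBit_two_pow_mul_add _ (small C hC), if_pos (by omega)]
    have h0 : C.testBit (8 * 0) = decide (C % 2 ^ 8 = 1) := by
      rw [Nat.mul_zero, Nat.testBit_zero]
      congr 1
      apply propext
      omega
    rw [h0]
    rcases (show C % 2 ^ 8 = 0 ∨ C % 2 ^ 8 = 1 by omega) with h | h <;> rw [h] <;> simp
  | succ i ih =>
    intro C hC
    rw [split, Nat.testBit_two_pow_mul_add _ (small C hC), if_neg (by omega),
      show 8 * (i + 1) + j - 8 = 8 * i + j by omega, ih, Nat.testBit_div_two_pow,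
      show 8 * (i + 1) = 8 * i + 8 by ring]
    intro t ht
    rw [Nat.testBit_div_two_pow] at ht
    have := hC _ ht
    omega

theorem dvd_of_testBit_colBits_of_lt : ∀ t < 64, colBits.testBit t = true → 8 ∣ t := by
  decide +kernel

theorem dvd_of_testBit_colBits {t : ℕ} (h : colBits.testBit t = true) : 8 ∣ t := by
  have ht : t < 64 := by
    by_contra! hlt
    rw [Nat.testBit_lt_two_pow (lt_of_lt_of_le (show colBits < 2 ^ 64 by decide +kernel)
      (Nat.pow_le_pow_right two_pos hlt))] at h
    exact absurd h (by simp)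
  exact dvd_of_testBit_colBits_of_lt t ht h

theorem testBit_colBits : ∀ i < 8, colBits.testBit (8 * i) = true := by decide +kernel

theorem testBit_warshallStep (M : ℕ) {i j k : ℕ} (hi : i < 8) (hj : j < 8) :
    (warshallStep M k).testBit (8 * i + j) = true ↔ M.testBit (8 * i + j) = true ∨
      (M.testBit (8 * i + k) = true ∧ M.testBit (8 * k + j) = true) := by
  change (M ||| Nat.land (Nat.shiftRight M k) colBits *
    Nat.land (Nat.shiftRight M (Nat.mul 8 k)) 255).testBit _ = true ↔ _
  rw [Nat.testBit_or, testBit_mul_of_sparse (row_lt M k) hj, testBit_row hj]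
  · change (_ || ((M >>> k &&& colBits).testBit (8 * i) && _)) = true ↔ _
    rw [Nat.testBit_and, Nat.testBit_shiftRight, testBit_colBits i hi, Nat.add_comm k]
    simp
  · intro t ht
    change (M >>> k &&& colBits).testBit t = true at ht
    rw [Nat.testBit_and, Bool.and_eq_true] at ht
    exact dvd_of_testBit_colBits ht.2

/-- The first `n` steps, starting with step `k`, of Warshall's algorithm for the transitive
closure. -/
noncomputable def warshall (n M k : ℕ) : ℕ :=
  Nat.rec (motive := fun _ => ℕ → ℕ → ℕ) (fun M _ => M)
    (fun _ r M k => force (warshallStep M k) fun M => r M (Nat.succ k)) n M k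

theorem warshall_succ (n M k : ℕ) :
    warshall (n + 1) M k = warshall n (warshallStep M k) (k + 1) := by
  have e : warshall (n + 1) M k =
      force (warshallStep M k) fun M => warshall n M (Nat.succ k) := rfl
  rw [e, force_eq]

theorem testBit_warshall_of_testBit {n M k i j : ℕ} (hi : i < 8) (hj : j < 8)
    (h : M.testBit (8 * i + j) = true) : (warshall n M k).testBit (8 * i + j) = true := by
  induction n generalizing M k with
  | zero => exact h
  | succ n ih =>
    rw [warshall_succ]
    exact ih ((testBit_warshallStep M hi hj).2 (Or.inl h))

theorem testBit_warshall_imp {n M k : ℕ} (hk : k + n ≤ 8) {Q : ℕ → ℕ → Prop}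
    (hQ : ∀ a b c, Q a b → Q b c → Q a c)
    (h : ∀ i < 8, ∀ j < 8, M.testBit (8 * i + j) = true → Q i j) :
    ∀ i < 8, ∀ j < 8, (warshall n M k).testBit (8 * i + j) = true → Q i j := by
  induction n generalizing M k with
  | zero => exact h
  | succ n ih =>
    rw [warshall_succ]
    refine ih (by omega) fun i hi j hj hij => ?_
    rcases (testBit_warshallStep M hi hj).1 hij with h1 | ⟨h1, h2⟩
    · exact h i hi j hj h1
    · exact hQ _ _ _ (h i hi k (by omega) h1) (h k (by omega) j hj h2)

theorem testBit_warshall_trans {n M k : ℕ} (hk : k + n ≤ 8)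
    (h : ∀ x < k, ∀ i < 8, ∀ j < 8, M.testBit (8 * i + x) = true → M.testBit (8 * x + j) = true →
      M.testBit (8 * i + j) = true) :
    ∀ x < k + n, ∀ i < 8, ∀ j < 8, (warshall n M k).testBit (8 * i + x) = true →
      (warshall n M k).testBit (8 * x + j) = true →
      (warshall n M k).testBit (8 * i + j) = true := by
  induction n generalizing M k with
  | zero => exact h
  | succ n ih =>
    rw [warshall_succ, show k + (n + 1) = k + 1 + n by ring]
    refine ih (by omega) fun x hx i hi j hj => ?_
    have hk8 : k < 8 := by omega
    have hx8 : x < 8 := by omega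
    rw [testBit_warshallStep M hi hx8, testBit_warshallStep M hx8 hj, testBit_warshallStep M hi hj]
    rcases Nat.lt_succ_iff_lt_or_eq.1 hx with hx | rfl
    · rintro (h1 | ⟨h1, h2⟩) (h3 | ⟨h3, h4⟩)
      · exact Or.inl (h x hx i hi j hj h1 h3)
      · exact Or.inr ⟨h x hx i hi k hk8 h1 h3, h4⟩
      · exact Or.inr ⟨h1, h x hx k hk8 j hj h2 h3⟩
      · exact Or.inr ⟨h1, h4⟩
    · rintro (h1 | ⟨h1, -⟩) (h3 | ⟨-, h3⟩) <;> exact Or.inr ⟨h1, h3⟩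

/-- The positions in a packed matrix outside row and column `v`. -/
def deletedMask (v : ℕ) : ℕ :=
  Nat.mul (Nat.sub 255 (Nat.shiftLeft 1 v)) (Nat.sub colBits (Nat.shiftLeft 1 (Nat.mul 8 v)))

theorem testBit_deletedMask : ∀ v < 8, ∀ i < 8, ∀ j < 8,
    (deletedMask v).testBit (8 * i + j) = (!(Nat.beq i v) && !(Nat.beq j v)) := by
  decide +kernel

theorem testBit_deletedMask_iff {v i j : ℕ} (hv : v < 8) (hi : i < 8) (hj : j < 8) :
    (deletedMask v).testBit (8 * i + j) = true ↔ i ≠ v ∧ j ≠ v := by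
  rw [testBit_deletedMask v hv i hi j hj]
  simp only [Bool.and_eq_true, Bool.not_eq_true', ← Bool.not_eq_true, Nat.beq_eq, ne_eq]

theorem deletedMask_lt : ∀ v < 8, deletedMask v < 2 ^ 64 := by decide +kernel

theorem land_deletedMask_eq_iff {M v : ℕ} (hv : v < 8) :
    Nat.land M (deletedMask v) = deletedMask v ↔
      ∀ i < 8, ∀ j < 8, i ≠ v → j ≠ v → M.testBit (8 * i + j) = true := by
  change M &&& deletedMask v = deletedMask v ↔ _
  constructor
  · intro h i hi j hj hiv hjv
    have h1 := (testBit_deletedMask_iff hv hi hj).2 ⟨hiv, hjv⟩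
    rw [← h, Nat.testBit_and, Bool.and_eq_true] at h1
    exact h1.1
  · intro h
    refine Nat.eq_of_testBit_eq fun t => ?_
    rw [Nat.testBit_and]
    by_cases ht : t < 64
    · rw [← Nat.div_add_mod t 8]
      have hi : t / 8 < 8 := by omega
      have hj : t % 8 < 8 := by omega
      by_cases hd : (deletedMask v).testBit (8 * (t / 8) + t % 8) = true
      · have h1 := (testBit_deletedMask_iff hv hi hj).1 hd
        rw [hd, h _ hi _ hj h1.1 h1.2, Bool.and_self]
      · rw [Bool.not_eq_true] at hd
        rw [hd, Bool.and_false]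
    · rw [Nat.testBit_lt_two_pow (lt_of_lt_of_le (deletedMask_lt v hv)
        (Nat.pow_le_pow_right two_pos (not_lt.1 ht))), Bool.and_false]

/-- The positions of the diagonal in a packed matrix. -/
def diagBits : ℕ := 0x8040201008040201

theorem testBit_diagBits : ∀ i < 8, ∀ j < 8, diagBits.testBit (8 * i + j) = Nat.beq i j := by
  decide +kernel

/-- Tells whether the graph that is packed in `N` remains connected when `v` is deleted. -/
noncomputable def connectedWithout (N v : ℕ) : Bool :=
  force (deletedMask v) fun F =>
    Nat.beq (Nat.land (warshall 8 (Nat.land (Nat.lor N diagBits) F) 0) F) F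

theorem connectedWithout_iff {N : ℕ} {G : SimpleGraph (Fin 8)} (h : Packs N G) (v : Fin 8) :
    connectedWithout N v = true ↔ (G.induce ({v}ᶜ : Set (Fin 8))).Preconnected := by
  rw [connectedWithout, force_eq, Nat.beq_eq, land_deletedMask_eq_iff v.2]
  set M := Nat.land (Nat.lor N diagBits) (deletedMask v) with hM
  have hbit : ∀ i j : Fin 8, M.testBit (8 * i + j) = true ↔
      (G.Adj i j ∨ i = j) ∧ i ≠ v ∧ j ≠ v := fun i j => by
    change ((N ||| diagBits) &&& deletedMask v).testBit _ = true ↔ _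
    rw [Nat.testBit_and, Nat.testBit_or, Bool.and_eq_true, Bool.or_eq_true, h i j,
      testBit_diagBits i i.2 j j.2, testBit_deletedMask_iff v.2 i.2 j.2, Nat.beq_eq,
      Fin.val_inj, ne_eq, ne_eq, Fin.val_inj, Fin.val_inj]
  have htrans := testBit_warshall_trans (n := 8) (M := M) (k := 0) (by norm_num)
    (fun x hx => absurd hx (Nat.not_lt_zero x))
  constructor
  · rintro hall ⟨x, hx⟩ ⟨y, hy⟩
    have h1 := testBit_warshall_imp (n := 8) (M := M) (k := 0) (by norm_num)
      (Q := fun a b => ∃ (a' b' : ({v}ᶜ : Set (Fin 8))), (a' : Fin 8).val = a ∧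
        (b' : Fin 8).val = b ∧ (G.induce ({v}ᶜ : Set (Fin 8))).Reachable a' b') ?_ ?_ x x.2 y y.2
      (hall x x.2 y y.2 (fun e => hx (Fin.ext e)) (fun e => hy (Fin.ext e)))
    · obtain ⟨a, b, ha, hb, hab⟩ := h1
      rwa [show a = ⟨x, hx⟩ from Subtype.ext (Fin.ext ha),
        show b = ⟨y, hy⟩ from Subtype.ext (Fin.ext hb)] at hab
    · rintro a b c ⟨x, y, rfl, rfl, hxy⟩ ⟨y', z, h1, rfl, hyz⟩
      rw [show y' = y from Subtype.ext (Fin.ext h1)] at hyz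
      exact ⟨x, z, rfl, rfl, hxy.trans hyz⟩
    · intro i hi j hj hij
      obtain ⟨h1, h2, h3⟩ := (hbit ⟨i, hi⟩ ⟨j, hj⟩).1 hij
      refine ⟨⟨⟨i, hi⟩, h2⟩, ⟨⟨j, hj⟩, h3⟩, rfl, rfl, ?_⟩
      rcases h1 with h1 | h1
      · exact SimpleGraph.Adj.reachable (G := G.induce ({v}ᶜ : Set (Fin 8))) h1
      · cases h1
        exact .rfl
  · intro hpre i hi j hj hiv hjv
    have hreach := hpre ⟨⟨i, hi⟩, fun e => hiv (congrArg Fin.val e)⟩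
      ⟨⟨j, hj⟩, fun e => hjv (congrArg Fin.val e)⟩
    rw [SimpleGraph.reachable_iff_reflTransGen] at hreach
    have key : ∀ b : ({v}ᶜ : Set (Fin 8)), Relation.ReflTransGen
        (G.induce ({v}ᶜ : Set (Fin 8))).Adj ⟨⟨i, hi⟩, fun e => hiv (congrArg Fin.val e)⟩ b →
        (warshall 8 M 0).testBit (8 * i + (b : Fin 8)) = true := fun b hb => by
      induction hb with
      | refl =>
        exact testBit_warshall_of_testBit hi hi ((hbit ⟨i, hi⟩ ⟨i, hi⟩).2
          ⟨Or.inr rfl, fun e => hiv (congrArg Fin.val e), fun e => hiv (congrArg Fin.val e)⟩)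
      | @tail b c _ hbc ih =>
        refine htrans b (by omega) i hi c (Fin.is_lt _) ih ?_
        exact testBit_warshall_of_testBit (Fin.is_lt _) (Fin.is_lt _)
          ((hbit b c).2 ⟨Or.inl hbc, b.2, c.2⟩)
    exact key _ hreach

/-- Tells whether the graph that is packed in `N` is biconnected. -/
noncomputable def biconnectedPacked (N : ℕ) : Bool :=
  cond (connectedWithout N 0) (cond (connectedWithout N 1) (cond (connectedWithout N 2)
    (cond (connectedWithout N 3) (cond (connectedWithout N 4) (cond (connectedWithout N 5)
    (cond (connectedWithout N 6) (connectedWithout N 7) false) false) false) false) false)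
    false) false

theorem biconnectedPacked_iff {N : ℕ} {G : SimpleGraph (Fin 8)} (h : Packs N G) :
    biconnectedPacked N = true ↔ IsBiconnected G := by
  have h1 : IsBiconnected G ↔ ∀ v : Fin 8, connectedWithout N v = true := by
    simp only [connectedWithout_iff h]
    exact ⟨fun h => h.2, fun h => ⟨connected_of_preconnected_induce_compl (by simp) h, h⟩⟩
  rw [h1]
  simp only [biconnectedPacked, Bool.cond_false_right, Bool.and_eq_true]
  constructor
  · rintro ⟨h0, h1, h2, h3, h4, h5, h6, h7⟩ v
    fin_cases v <;> assumption
  · intro h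
    exact ⟨h 0, h 1, h 2, h 3, h 4, h 5, h 6, h 7⟩

/-! ### Testing containment -/

/-- Tells whether `p i` holds for all `i < n`. -/
noncomputable def allBelow (n : ℕ) (p : ℕ → Bool) : Bool :=
  Nat.rec true (fun i r => cond (p i) r false) n

theorem allBelow_eq_true {n : ℕ} {p : ℕ → Bool} : allBelow n p = true ↔ ∀ i < n, p i = true := by
  induction n with
  | zero => exact iff_of_true rfl (by simp)
  | succ n ih =>
    rw [Nat.forall_lt_succ_right, ← ih, and_comm]
    change cond (p n) (allBelow n p) false = true ↔ _
    rw [Bool.cond_false_right, Bool.and_eq_true]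

/-- The entry `i` of the list of 5-bit numbers that is packed in `w`. -/
def entry (w i : ℕ) : ℕ := Nat.land (Nat.shiftRight w (Nat.mul 5 i)) 31

/-- Tells whether `i ↦ entry w i` is an injection from the numbers below `n` to those below `m`
that takes the relation packed in `N` to the relation `A`. -/
noncomputable def embeds (n m N w : ℕ) (A : ℕ → ℕ → Bool) : Bool :=
  allBelow n fun i => force (entry w i) fun x => cond (Nat.blt x m)
    (allBelow i fun j => force (entry w j) fun y => cond (Nat.beq x y) false
      (cond (Nat.testBit N (Nat.add (Nat.mul 8 i) j)) (A x y) true)) false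

theorem isContained_of_embeds {n m N w : ℕ} {A : ℕ → ℕ → Bool} {H : SimpleGraph (Fin n)}
    {G : SimpleGraph (Fin m)} (hH : ∀ i j : Fin n, H.Adj i j → N.testBit (8 * i + j) = true)
    (hG : ∀ i j : Fin m, A i j = true → G.Adj i j) (h : embeds n m N w A = true) :
    H.IsContained G := by
  simp only [embeds, allBelow_eq_true, force_eq, Bool.cond_false_right, Bool.and_eq_true,
    Bool.cond_false_left, Bool.not_eq_true', Bool.cond_true_right, Bool.or_eq_true,
    ← Bool.not_eq_true, Nat.beq_eq, Nat.blt_eq] at h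
  let f : Fin n → Fin m := fun i => ⟨entry w i, (h i i.2).1⟩
  have hlt : ∀ i j : Fin n, j < i → f i ≠ f j ∧ (H.Adj i j → G.Adj (f i) (f j)) := fun i j hij => by
    obtain ⟨h1, h2⟩ := (h i i.2).2 j hij
    exact ⟨fun e => h1 (congrArg Fin.val e),
      fun ha => hG _ _ (h2.resolve_left fun hn => hn (hH i j ha))⟩
  refine ⟨⟨⟨f, fun {i j} ha => ?_⟩, fun i j hij => ?_⟩⟩
  · rcases lt_trichotomy i j with hlt' | rfl | hlt'
    · exact ((hlt j i hlt').2 ha.symm).symm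
    · exact absurd rfl ha.ne
    · exact (hlt i j hlt').2 ha
  · by_contra hne
    rcases lt_or_gt_of_ne hne with hlt' | hlt'
    · exact (hlt j i hlt').1 hij.symm
    · exact (hlt i j hlt').1 hij

/-- The adjacency relation of `G27`, with rows of 32 bits. -/
def g27Packed : ℕ := 0x30104010000010210000000008018000141010001088001008800000180000001800004010008046e0001009c08080040008100000608000002100030800c000022010000359004400284002043040000002300000051008012290082a8150400098b000000450241447e

/-- The adjacency relation of `G27`. -/
def g27Adj (x y : ℕ) : Bool := Nat.testBit g27Packed (Nat.add (Nat.mul 32 x) y)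

theorem adj_of_g27Adj : ∀ i j : Fin 27, g27Adj i j = true → G27.Adj i j := by
  rw [G27_eq]
  decide +kernel

/-- The adjacency relation that is packed in `N`. -/
def packedAdj (N x y : ℕ) : Bool := Nat.testBit N (Nat.add (Nat.mul 8 x) y)

/-- The packed adjacency matrices of the graphs `minForbidden8 i`. -/
def minForbidden8Packed : Fin 13 → ℕ :=
  ![0x2828dc22e123150e,
    0x68909c62a123150e,
    0x6192986426194986,
    0x608a9425463b4d16,
    0x41a4542e13721d8a,
    0xc24542586fb0d16,
    0x42a45425067b8d16,
    0x92c5425c2730d96,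
    0x182c54a5c2730d16,
    0x68949161864b0d36,
    0x68b0d065861b0d16,
    0x46921c6831a3c50e,
    0x61b0d864261b0d86]

theorem packs_minForbidden8 (i : Fin 13) : Packs (minForbidden8Packed i) (minForbidden8 i) := by
  fin_cases i
  · exact (by unfold Packs F_8_12_1; decide +kernel : Packs (minForbidden8Packed 0) F_8_12_1)
  · exact (by unfold Packs F_8_12_2; decide +kernel : Packs (minForbidden8Packed 1) F_8_12_2)
  · exact (by unfold Packs F_8_12_3; decide +kernel : Packs (minForbidden8Packed 2) F_8_12_3)
  · exact (by unfold Packs F_8_13_1; decide +kernel : Packs (minForbidden8Packed 3) F_8_13_1)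
  · exact (by unfold Packs F_8_13_2; decide +kernel : Packs (minForbidden8Packed 4) F_8_13_2)
  · exact (by unfold Packs F_8_13_3; decide +kernel : Packs (minForbidden8Packed 5) F_8_13_3)
  · exact (by unfold Packs F_8_13_4; decide +kernel : Packs (minForbidden8Packed 6) F_8_13_4)
  · exact (by unfold Packs F_8_13_5; decide +kernel : Packs (minForbidden8Packed 7) F_8_13_5)
  · exact (by unfold Packs F_8_13_6; decide +kernel : Packs (minForbidden8Packed 8) F_8_13_6)
  · exact (by unfold Packs F_8_13_7; decide +kernel : Packs (minForbidden8Packed 9) F_8_13_7)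
  · exact (by unfold Packs F_8_13_8; decide +kernel : Packs (minForbidden8Packed 10) F_8_13_8)
  · exact (by unfold Packs F_8_13_9; decide +kernel : Packs (minForbidden8Packed 11) F_8_13_9)
  · exact (by unfold Packs F_8_13_10; decide +kernel : Packs (minForbidden8Packed 12) F_8_13_10)

/-- Tells whether `w` packs an embedding of one of the 19 forbidden graphs, with index `t`, in the
graph that is packed in `N`. -/
noncomputable def embedsForbidden (t w N : ℕ) : Bool :=
  if h : t < 13 then embeds 8 8 (minForbidden8Packed ⟨t, h⟩) w (packedAdj N)
  else if t = 13 then embeds 4 8 0x70b0d0e w (packedAdj N)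
  else if t = 14 then embeds 5 8 0x916090916 w (packedAdj N)
  else if t = 15 then embeds 6 8 0x50e13321d2a w (packedAdj N)
  else if t = 16 then embeds 7 8 0xa1c226123550e w (packedAdj N)
  else if t = 17 then embeds 7 8 0x21542e13321d4a w (packedAdj N)
  else embeds 7 8 0x325168170b4c2c w (packedAdj N)

theorem not_isFLe8Free_of_embedsForbidden {t w N : ℕ} {G : SimpleGraph (Fin 8)} (hN : Packs N G)
    (h : embedsForbidden t w N = true) : ¬ IsFLe8Free G := by
  have hG : ∀ i j : Fin 8, packedAdj N i j = true → G.Adj i j := fun i j => (hN i j).1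
  rintro ⟨f1, f2, f3, f4, f5, f6, f7⟩
  unfold embedsForbidden at h
  split_ifs at h with h1
  · exact f7 _ (isContained_of_embeds (fun i j => (packs_minForbidden8 ⟨t, h1⟩ i j).2) hG h)
  · exact f1 (isContained_of_embeds (by unfold F_4_6_1; decide +kernel) hG h)
  · exact f2 (isContained_of_embeds (by unfold F_5_6_1; decide +kernel) hG h)
  · exact f3 (isContained_of_embeds (by unfold F_6_9_1; decide +kernel) hG h)
  · exact f4 (isContained_of_embeds (by unfold F_7_10_1; decide +kernel) hG h)
  · exact f5 (isContained_of_embeds (by unfold F_7_11_1; decide +kernel) hG h)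
  · exact f6 (isContained_of_embeds (by unfold F_7_11_2; decide +kernel) hG h)

/-- Removes the lowest set bit. -/
def dropBit (x : ℕ) : ℕ := Nat.land x (Nat.pred x)

theorem exists_three_bits : ∀ x < 256, Nat.beq (dropBit (dropBit x)) 0 = false →
    ∃ a < 8, ∃ b < a, ∃ c < b, x.testBit a = true ∧ x.testBit b = true ∧ x.testBit c = true := by
  decide +kernel

/-- Tells whether the graph that is packed in `N` contains the complete bipartite graph with parts
of size 2 and 3. -/
noncomputable def containsK23 (N : ℕ) : Bool :=
  Bool.not (allBelow 8 fun i => force (Nat.land (Nat.shiftRight N (Nat.mul 8 i)) 255) fun x =>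
    allBelow i fun j =>
      Nat.beq (dropBit (dropBit (Nat.land x (Nat.shiftRight N (Nat.mul 8 j))))) 0)

theorem not_isFLe8Free_of_containsK23 {N : ℕ} {G : SimpleGraph (Fin 8)} (hN : Packs N G)
    (h : containsK23 N = true) : ¬ IsFLe8Free G := by
  rw [containsK23, Bool.not_eq_true', ← Bool.not_eq_true, allBelow_eq_true] at h
  simp only [force_eq, allBelow_eq_true] at h
  push Not at h
  obtain ⟨i, hi, j, hij, h⟩ := h
  have hj : j < 8 := by omega
  rw [ne_eq, Bool.not_eq_true] at h
  obtain ⟨a, ha, b, hb, c, hc, h1, h2, h3⟩ := exists_three_bits _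
    (lt_of_le_of_lt (Nat.and_le_left (n := Nat.land (N >>> (8 * i)) 255)) (row_lt N i)) h
  have hadj : ∀ t (ht : t < 8), (Nat.land (Nat.land (Nat.shiftRight N (Nat.mul 8 i)) 255)
      (Nat.shiftRight N (Nat.mul 8 j))).testBit t = true →
      G.Adj ⟨i, hi⟩ ⟨t, ht⟩ ∧ G.Adj ⟨j, hj⟩ ⟨t, ht⟩ := fun t ht hbit => by
    change (Nat.land (Nat.shiftRight N (Nat.mul 8 i)) 255 &&& N >>> (8 * j)).testBit t = true
      at hbit
    rw [Nat.testBit_and, testBit_row ht, Nat.testBit_shiftRight, Bool.and_eq_true] at hbit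
    exact ⟨(hN ⟨i, hi⟩ ⟨t, ht⟩).1 hbit.1, (hN ⟨j, hj⟩ ⟨t, ht⟩).1 hbit.2⟩
  obtain ⟨ia, ja⟩ := hadj a ha h1
  obtain ⟨ib, jb⟩ := hadj b (by omega) h2
  obtain ⟨ic, jc⟩ := hadj c (by omega) h3
  rintro ⟨-, hfree, -⟩
  refine hfree ⟨⟨⟨![⟨i, hi⟩, ⟨a, ha⟩, ⟨b, by omega⟩, ⟨j, hj⟩, ⟨c, by omega⟩],
    fun {x y} hxy => ?_⟩, ?_⟩⟩
  · have hxy' : ∀ x y : Fin 5, F_5_6_1.Adj x y → (x = 0 ∨ x = 3) ∧ (y = 1 ∨ y = 2 ∨ y = 4) ∨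
        (y = 0 ∨ y = 3) ∧ (x = 1 ∨ x = 2 ∨ x = 4) := by
      unfold F_5_6_1
      decide +kernel
    rcases hxy' x y hxy with ⟨rfl | rfl, rfl | rfl | rfl⟩ | ⟨rfl | rfl, rfl | rfl | rfl⟩
    · exact ia
    · exact ib
    · exact ic
    · exact ja
    · exact jb
    · exact jc
    · exact ia.symm
    · exact ib.symm
    · exact ic.symm
    · exact ja.symm
    · exact jb.symm
    · exact jc.symm
  · have e1 := ia.ne
    have e2 := ib.ne
    have e3 := ic.ne
    have e4 := ja.ne
    have e5 := jb.ne
    have e6 := jc.ne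
    simp only [ne_eq, Fin.mk.injEq] at e1 e2 e3 e4 e5 e6
    have hinj : (List.ofFn ![(⟨i, hi⟩ : Fin 8), ⟨a, ha⟩, ⟨b, by omega⟩, ⟨j, hj⟩,
        ⟨c, by omega⟩]).Nodup := by
      simp
      omega
    exact List.nodup_ofFn.1 hinj

/-! ### Lists of representatives of isomorphism classes -/

/-- `l` lists codes of graphs in the order of their invariants, which lie between `lo` and `hi`,
and at least `m` graphs are isomorphic to one of them. -/
structure IncreasingInvariants (l : List ℕ) (lo hi m : ℕ) : Prop where
  le : lo ≤ hi
  bounds : ∀ c ∈ l, lo ≤ graphInvariant (codeGraph c) ∧ graphInvariant (codeGraph c) < hi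
  pairwise : l.Pairwise fun a b => graphInvariant (codeGraph a) < graphInvariant (codeGraph b)
  le_sum : m ≤ (l.map fun c => (isoClass (codeGraph c)).card).sum

theorem IncreasingInvariants.append {l l' : List ℕ} {a b c m m' : ℕ}
    (h : IncreasingInvariants l a b m) (h' : IncreasingInvariants l' b c m') :
    IncreasingInvariants (l ++ l') a c (m + m') where
  le := h.le.trans h'.le
  bounds x hx := by
    rcases List.mem_append.1 hx with hx | hx
    · exact ⟨(h.bounds x hx).1, (h.bounds x hx).2.trans_le h'.le⟩
    · exact ⟨h.le.trans (h'.bounds x hx).1, (h'.bounds x hx).2⟩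
  pairwise := List.pairwise_append.2 ⟨h.pairwise, h'.pairwise,
    fun x hx y hy => (h.bounds x hx).2.trans_le (h'.bounds y hy).1⟩
  le_sum := by
    rw [List.map_append, List.sum_append]
    exact Nat.add_le_add h.le_sum h'.le_sum

theorem IncreasingInvariants.cons {l : List ℕ} {a c hi m m' : ℕ}
    (ha : a ≤ graphInvariant (codeGraph c))
    (h : IncreasingInvariants l (graphInvariant (codeGraph c) + 1) hi m)
    (hm : m' ≤ (isoClass (codeGraph c)).card + m) : IncreasingInvariants (c :: l) a hi m' where
  le := (ha.trans (Nat.le_succ _)).trans h.le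
  bounds x hx := by
    rcases List.mem_cons.1 hx with rfl | hx
    · exact ⟨ha, h.le⟩
    · exact ⟨(ha.trans (Nat.le_succ _)).trans (h.bounds x hx).1, (h.bounds x hx).2⟩
  pairwise := List.pairwise_cons.2 ⟨fun x hx => (h.bounds x hx).1, h.pairwise⟩
  le_sum := by
    rw [List.map_cons, List.sum_cons]
    exact hm.trans (Nat.add_le_add_left h.le_sum _)

theorem card_simpleGraph_le : Fintype.card (SimpleGraph (Fin 8)) ≤ 2 ^ 28 := by
  classical
  have h : Fintype.card (SimpleGraph (Fin 8)) ≤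
      ((⊤ : SimpleGraph (Fin 8)).edgeFinset.powerset).card := by
    rw [← Finset.card_univ]
    refine Finset.card_le_card_of_injOn (fun G => G.edgeFinset) ?_ ?_
    · intro G _
      simp
    · intro G _ H _ hGH
      exact SimpleGraph.edgeFinset_inj.1 hGH
  rwa [Finset.card_powerset, SimpleGraph.card_edgeFinset_top_eq_card_choose_two,
    Fintype.card_fin] at h

theorem IncreasingInvariants.exists_iso {l : List ℕ} {lo hi : ℕ}
    (h : IncreasingInvariants l lo hi (2 ^ 28)) (G : SimpleGraph (Fin 8)) :
    ∃ c ∈ l, Nonempty (codeGraph c ≃g G) := by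
  classical
  have hnodup : l.Nodup := h.pairwise.imp fun hab => by
    rintro rfl
    exact lt_irrefl _ hab
  have hcard : (l.toFinset.biUnion fun c => isoClass (codeGraph c)).card =
      (l.map fun c => (isoClass (codeGraph c)).card).sum := by
    rw [Finset.card_biUnion, List.sum_toFinset _ hnodup]
    intro a ha b hb hab
    change Disjoint (isoClass (codeGraph a)) (isoClass (codeGraph b))
    rw [Finset.disjoint_left]
    intro H h1 h2
    rw [mem_isoClass] at h1 h2
    obtain ⟨e1⟩ := h1
    obtain ⟨e2⟩ := h2
    have e : graphInvariant (codeGraph a) = graphInvariant (codeGraph b) :=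
      (graphInvariant_iso e1).symm.trans (graphInvariant_iso e2)
    have : Std.Symm fun a b => graphInvariant (codeGraph a) ≠ graphInvariant (codeGraph b) :=
      ⟨fun _ _ h => h.symm⟩
    exact (h.pairwise.imp fun hab => hab.ne).forall (List.mem_toFinset.1 ha)
      (List.mem_toFinset.1 hb) hab e
  have huniv : (l.toFinset.biUnion fun c => isoClass (codeGraph c)) = Finset.univ := by
    refine Finset.eq_univ_of_card _ (le_antisymm (Finset.card_le_univ _) ?_)
    rw [hcard]
    exact card_simpleGraph_le.trans h.le_sum
  have hG : G ∈ l.toFinset.biUnion fun c => isoClass (codeGraph c) := by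
    rw [huniv]
    simp only [Finset.mem_univ]
  obtain ⟨c, hc, hcG⟩ := Finset.mem_biUnion.1 hG
  rw [mem_isoClass] at hcG
  exact ⟨c, List.mem_toFinset.1 hc, hcG⟩

open scoped Classical in
theorem IncreasingInvariants.numIsoClasses_eq {l : List ℕ} {lo hi : ℕ}
    (h : IncreasingInvariants l lo hi (2 ^ 28)) {P : SimpleGraph (Fin 8) → Prop}
    (hP : ∀ G H : SimpleGraph (Fin 8), G ≃g H → P G → P H) :
    numIsoClasses 8 P = l.countP fun c => decide (P (codeGraph c)) := by
  have hset : Quotient.mk (isoSetoid 8) '' {G | P G} =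
      (((l.filter fun c => decide (P (codeGraph c))).map
        fun c => Quotient.mk (isoSetoid 8) (codeGraph c)).toFinset : Set _) := by
    ext q
    simp only [Set.mem_image, Set.mem_ofPred_eq, List.coe_toFinset, List.mem_map, List.mem_filter,
      decide_eq_true_eq]
    constructor
    · rintro ⟨G, hG, rfl⟩
      obtain ⟨c, hc, ⟨e⟩⟩ := h.exists_iso G
      exact ⟨c, ⟨hc, hP _ _ e.symm hG⟩, Quotient.sound ⟨e⟩⟩
    · rintro ⟨c, ⟨-, hc⟩, rfl⟩
      exact ⟨_, hc, rfl⟩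
  rw [numIsoClasses, hset, Set.ncard_coe_finset, List.toFinset_card_of_nodup, List.length_map,
    List.countP_eq_length_filter]
  refine List.Pairwise.map _ ?_ (h.pairwise.filter _)
  intro a b hab he
  obtain ⟨e⟩ := Quotient.exact he
  exact hab.ne (graphInvariant_iso e).symm

open scoped Classical in
/-- `b` of the graphs with codes in `l` are biconnected, `f` of these are free of the forbidden
graphs, and these `f` graphs are contained in `G27`. -/
structure Classified (l : List ℕ) (b f : ℕ) : Prop where
  countP_biconnected : l.countP (fun c => decide (IsBiconnected (codeGraph c))) = b
  countP_free :
    l.countP (fun c => decide (IsBiconnected (codeGraph c) ∧ IsFLe8Free (codeGraph c))) = f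
  isContained : ∀ c ∈ l, IsBiconnected (codeGraph c) → IsFLe8Free (codeGraph c) →
    (codeGraph c).IsContained G27

theorem Classified.append {l l' : List ℕ} {b f b' f' : ℕ} (h : Classified l b f)
    (h' : Classified l' b' f') : Classified (l ++ l') (b + b') (f + f') where
  countP_biconnected := by
    rw [List.countP_append, h.countP_biconnected, h'.countP_biconnected]
  countP_free := by rw [List.countP_append, h.countP_free, h'.countP_free]
  isContained c hc := (List.mem_append.1 hc).elim (h.isContained c) (h'.isContained c)

theorem Classified.cons_of_not_biconnected {l : List ℕ} {b f c : ℕ} (h : Classified l b f)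
    (hc : ¬ IsBiconnected (codeGraph c)) : Classified (c :: l) b f where
  countP_biconnected := by
    rw [List.countP_cons_of_neg (by simpa using hc), h.countP_biconnected]
  countP_free := by
    rw [List.countP_cons_of_neg (by simp [hc]), h.countP_free]
  isContained x hx hb := by
    rcases List.mem_cons.1 hx with rfl | hx
    · exact absurd hb hc
    · exact h.isContained x hx hb

theorem Classified.cons_of_not_free {l : List ℕ} {b f c : ℕ} (h : Classified l b f)
    (hc : IsBiconnected (codeGraph c)) (hf : ¬ IsFLe8Free (codeGraph c)) :
    Classified (c :: l) (b + 1) f where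
  countP_biconnected := by
    rw [List.countP_cons_of_pos (by simpa using hc), h.countP_biconnected]
  countP_free := by
    rw [List.countP_cons_of_neg (by simp [hf]), h.countP_free]
  isContained x hx hb hfree := by
    rcases List.mem_cons.1 hx with rfl | hx
    · exact absurd hfree hf
    · exact h.isContained x hx hb hfree

theorem Classified.cons_of_isContained {l : List ℕ} {b f c : ℕ} (h : Classified l b f)
    (hc : IsBiconnected (codeGraph c)) (hG : (codeGraph c).IsContained G27) :
    Classified (c :: l) (b + 1) (f + 1) where
  countP_biconnected := by
    rw [List.countP_cons_of_pos (by simpa using hc), h.countP_biconnected]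
  countP_free := by
    have hf : IsFLe8Free (codeGraph c) := (isUnitDistance_G27.of_isContained hG).isFLe8Free
    rw [List.countP_cons_of_pos (by simp [hc, hf]), h.countP_free]
  isContained x hx hb hfree := by
    rcases List.mem_cons.1 hx with rfl | hx
    · exact hG
    · exact h.isContained x hx hb hfree

/-- Goes through `n` codes of graphs that are packed in `d`. It compares the invariants, the sum of
bounds for the sizes of the isomorphism classes, and the numbers of biconnected graphs and of
those among them that are free of the forbidden graphs, to `hi`, `m`, `B` and `F`. The embeddings
that are packed in `w` show that a graph is or is not free of the forbidden graphs. -/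
noncomputable def survey (hi m B F n lo acc d w b f : ℕ) : Bool :=
  Nat.rec (motive := fun _ => ℕ → ℕ → ℕ → ℕ → ℕ → ℕ → Bool)
    (fun lo acc _ _ b f => cond (Nat.ble lo hi)
      (cond (Nat.ble m acc) (cond (Nat.beq b B) (Nat.beq f F) false) false) false)
    (fun _ r lo acc d w b f =>
      force (pack (Nat.mod d 0x10000000)) fun N =>
      force (walkPacked N) fun M =>
      force (vertexPacked M) fun I =>
      force (invariantPacked I) fun i => cond (Nat.ble lo i)
        (force (Nat.add acc (Nat.div 40320 (autBound M I))) fun acc =>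
          force (Nat.shiftRight d 28) fun d =>
          force (Nat.succ i) fun i =>
          cond (biconnectedPacked N)
            (force (Nat.succ b) fun b => cond (containsK23 N) (r i acc d w b f)
              (force (Nat.land w 31) fun t =>
                force (Nat.shiftRight w 5) fun e =>
                force (Nat.shiftRight w 45) fun w =>
                cond (Nat.beq t 31)
                  (cond (embeds 8 27 N e g27Adj) (force (Nat.succ f) fun f => r i acc d w b f)
                    false)
                  (cond (embedsForbidden t e N) (r i acc d w b f) false)))
            (r i acc d w b f)) false)
    n lo acc d w b f

/-- Some list of codes satisfies both `IncreasingInvariants` and `Classified`. -/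
def Surveyed (lo hi m b f : ℕ) : Prop :=
  ∃ l, IncreasingInvariants l lo hi m ∧ Classified l b f

theorem Surveyed.append {x y z m b f m' b' f' : ℕ} :
    Surveyed x y m b f → Surveyed y z m' b' f' → Surveyed x z (m + m') (b + b') (f + f') :=
  fun ⟨_, h1, h2⟩ ⟨_, h3, h4⟩ => ⟨_, h1.append h3, h2.append h4⟩

theorem exists_of_survey {hi m B F n lo acc d w b f : ℕ}
    (h : survey hi m B F n lo acc d w b f = true) :
    ∃ b' f', b + b' = B ∧ f + f' = F ∧ Surveyed lo hi (m - acc) b' f' := by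
  induction n generalizing lo acc d w b f with
  | zero =>
    change cond (Nat.ble lo hi) (cond (Nat.ble m acc) (cond (Nat.beq b B) (Nat.beq f F) false)
      false) false = true at h
    simp only [Bool.cond_false_right, Bool.and_eq_true, Nat.ble_eq, Nat.beq_eq] at h
    obtain ⟨h1, h2, h3, h4⟩ := h
    refine ⟨0, 0, h3, h4, [], ⟨h1, by simp, by simp, by simp [h2]⟩, ⟨by simp, by simp, by simp⟩⟩
  | succ n ih =>
    set c := Nat.mod d 0x10000000
    have hM := walkPacked_eq (packs_pack c)
    have e : survey hi m B F (n + 1) lo acc d w b f =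
      force (pack c) fun N =>
      force (walkPacked N) fun M =>
      force (vertexPacked M) fun I =>
      force (invariantPacked I) fun i => cond (Nat.ble lo i)
        (force (Nat.add acc (Nat.div 40320 (autBound M I))) fun acc =>
          force (Nat.shiftRight d 28) fun d =>
          force (Nat.succ i) fun i =>
          cond (biconnectedPacked N)
            (force (Nat.succ b) fun b => cond (containsK23 N) (survey hi m B F n i acc d w b f)
              (force (Nat.land w 31) fun t =>
                force (Nat.shiftRight w 5) fun e =>
                force (Nat.shiftRight w 45) fun w =>
                cond (Nat.beq t 31)
                  (cond (embeds 8 27 N e g27Adj)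
                    (force (Nat.succ f) fun f => survey hi m B F n i acc d w b f) false)
                  (cond (embedsForbidden t e N) (survey hi m B F n i acc d w b f) false)))
            (survey hi m B F n i acc d w b f)) false := rfl
    rw [e] at h
    simp only [force_eq, hM, vertexPacked_eq, invariantPacked_eq, Bool.cond_false_right,
      Bool.and_eq_true, Nat.ble_eq] at h
    obtain ⟨hlo, h⟩ := h
    have hinc : ∀ {l m'}, IncreasingInvariants l (graphInvariant (codeGraph c) + 1) hi
        (m - (acc + 40320 / autBound (packMat (walkMatrix (codeGraph c) 4))
          (packVec (vertexInvariant (codeGraph c))))) → m' = m - acc →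
        IncreasingInvariants (c :: l) lo hi m' := fun hl hm => by
      refine IncreasingInvariants.cons hlo hl ?_
      have := div_autBound_le_card_isoClass (codeGraph c)
      omega
    cases hbic : biconnectedPacked (pack c) with
    | false =>
      rw [hbic, cond_false] at h
      obtain ⟨b', f', h1, h2, l, hl, hl'⟩ := ih h
      refine ⟨b', f', h1, h2, c :: l, hinc hl rfl, hl'.cons_of_not_biconnected ?_⟩
      rw [← biconnectedPacked_iff (packs_pack c), hbic]
      exact Bool.false_ne_true
    | true =>
      rw [hbic, cond_true] at h
      rw [biconnectedPacked_iff (packs_pack c)] at hbic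
      cases hK : containsK23 (pack c) with
      | true =>
        rw [hK, cond_true] at h
        obtain ⟨b', f', h1, h2, l, hl, hl'⟩ := ih h
        exact ⟨b' + 1, f', by omega, h2, c :: l, hinc hl rfl,
          hl'.cons_of_not_free hbic (not_isFLe8Free_of_containsK23 (packs_pack c) hK)⟩
      | false =>
        rw [hK, cond_false] at h
        cases ht : Nat.beq (Nat.land w 31) 31 with
        | true =>
          rw [ht, cond_true, Bool.and_eq_true] at h
          obtain ⟨he, h⟩ := h
          obtain ⟨b', f', h1, h2, l, hl, hl'⟩ := ih h
          exact ⟨b' + 1, f' + 1, by omega, by omega, c :: l, hinc hl rfl,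
            hl'.cons_of_isContained hbic (isContained_of_embeds
              (fun i j => (packs_pack c i j).2) adj_of_g27Adj he)⟩
        | false =>
          rw [ht, cond_false, Bool.and_eq_true] at h
          obtain ⟨he, h⟩ := h
          obtain ⟨b', f', h1, h2, l, hl, hl'⟩ := ih h
          exact ⟨b' + 1, f', by omega, h2, c :: l, hinc hl rfl,
            hl'.cons_of_not_free hbic (not_isFLe8Free_of_embedsForbidden (packs_pack c) he)⟩

theorem Surveyed.of_survey {hi m b f lo : ℕ} (n d w : ℕ)
    (h : survey hi m b f n lo 0 d w 0 0 = true) : Surveyed lo hi m b f := by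
  obtain ⟨b', f', h1, h2, h3⟩ := exists_of_survey h
  rw [Nat.zero_add] at h1 h2
  subst h1 h2
  exact h3

/-! ### The survey of the 12346 graphs on 8 vertices -/

set_option maxRecDepth 100000

theorem surveyed_0 : Surveyed 0x0 0x249e969129979 689819 1 1 :=
  .of_survey 100 0xc01e000005e02c600702116540208474000e2070209215041044a000844c000004b084048d094404d02084b4042064c001086a02440070000607000000f201947001006a30810471001104d061b3001010456025504c000e0a303002a300006a3044404e0018f2002088a10000455000849602088ac001120b02085b010804a30840589021330100085b0210001e000401e000001e8000f210000f21062e204001060e0408721080868c062ab000420603000090b004045600196a000084748000d700000d7002162060808605000104d0008b21020c03400004740044007000020700000070209aa001000ec00000ec0421049001400b000008b021520c02084940008b0c02084a4000845402084a0000044c000000b021402c00004ac082049801000560000056021120c00084a4021120100004a1000000d02088a0000045400084a0000004c0000003021120000004a0000000c00000010000000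
    0xe0a46411c1f (by decide +kernel)

theorem surveyed_1 : Surveyed 0x249e969129979 0xbbcd0d1d514f9 1362480 5 5 :=
  .of_survey 100 0xf0d800449e000449e082068d084c49680016930001693020e20700196a1041046a0008607000004f064c92100084b600298d806196a004085b20208a56081c86c084448d10214d102084f40211661020919c8410f0a00220cd0c544610840ccc041104b08125510208b250424519004c88e001218b00090f1030409e0208515042401b000091b001405e21008ab00086a30a326810a4c88c0208d70021120b4010969021402d00004ad04206a3201482b001084b02162070020a4d004c496021401e000049e0010b0b08204990008a0700000570629a5002110ec02089290a4c4940208496041402b00008ab041264600084a3081445c048286300108ea218041e020c4b402084ac010218b002044d021169209000da00010da2010c6c041520b204e0070008b0d02084a1000044d008600f02116a1041110b05000ea00008ea058402b038401e0008a56041124a001402b00000ab0210f0c08204d8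
    0x2518a92041f5102d18920f90ce11ca107c9058455183e55044d20c1f (by decide +kernel)

theorem surveyed_2 : Surveyed 0xbbcd0d1d514f9 0x2016c5bb5db409 1664096 2 2 :=
  .of_survey 100 0x2084560208d74201060f0240d74000844d041964c02116b2001105b201086b021330d048046d2008617118090f0840f0d00404570808655908184b21110730840d71062ab0c042064d02110da03108ea021096902084b6014404f000ab07304c407021121e0408607000084f001046d0255207001086b042220f02090dc0009aa3212109b020844c000044bc10025710444870100257000025780016550001655210045e021ca26083264502c18a30480c6a1029989409111b001045e051072310804a70021a4d004404f085508b02108ea024c4960011713001155c0431a4a20084750208495024258310112478020d71042c6160008a2700090da0908971400924d03089b20020d7100104ea02085b1101118b04405a3084c88e040c02b000086b08298d800084750260d8c021120700004a704197210a2aa81082405d0208b0d0008933020c03300004730110969008c82d08404e50a544a18000f0d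
    0x14538c44483ea114c36841f (by decide +kernel)

theorem surveyed_3 : Surveyed 0x2016c5bb5db409 0x3cbaac765e8d09 1655500 12 12 :=
  .of_survey 100 0xc1e2230020979021314d8208d74020c933022491b231123302088ad00630cd00220ed061d22c10444a7210849e100890f048c41e08444ad080a4e50220cf20211a4e001445e10085170420d7802116ac20194710808da92311139020c8ae00196b290131530408d6c02086a3061b30c004ab070209aac041086b10644878240db2020889e001104f800c475004490f0208455044c60709088da14531430a361190a55213040911b003604b03002a700006a7000a4e502095b1020d075181a68641100ee02084a302644930208933028c4350080c76800604f000604f021521e03085b109210d90290d29800b0d605085a9000c475c1000eb618001f88430cdc1000de041164a01000eb00000eb018401f0820cd801000de00000de08210d9210401f00210d9210001f000401f000001f08084ad108084f000c49e05001730000973082045d042447c000b1550814539062ab1202440570218f0c0222a65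
    0x86a3558c40fa895588e907cc749464103f53bc8b1881f5134712120f9490d0c5107d0769123103ee411233881f221a938c40f9c905d44307f5159862083e535c430901f (by decide +kernel)

theorem surveyed_4 : Surveyed 0x3cbaac765e8d09 0x6855899d88b779 1846740 10 10 :=
  .of_survey 100 0x1124f028d0bc820b31501220ed066155140088ee0008b1e0210f0d0864693000919b03000de00004de021a5ac820c8ae231121e040845e00086a700110eb1081a0f00104ee020c073022298b0c18d68042451b20084ab0010b2b07087340424473001046b0410cea0211693080a55502112ec1008d8e2018f2c1090c63041330b020b0f40140b0f08c0d71042445e0219674041446e00418cb0420cea0a4c49682095b180425870104077820b18d158206700196ac11000e700020e7085484b0008473021449e00085ad1008497c0220ed061b321020a96541081b30208607000044f820c93c080a687042b2d2222989a061b14c201c82b004198b098045d098401f0020e4d08420c7002401f000011f0a4d215030019b000059b084ca8e0a5520d04a60ab409086b02084754020979020e0a7048311b0009a8b0008497001155909000de00010de05000eb00008eb042e04d401072d001164d0210f23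
    0xda80c51083e67aca410c1f3a88308920f988e38c2207d64b95e3103e9390c31041f8185518560fa882704e907c8e6a4e3103e4d3e501881f (by decide +kernel)

theorem surveyed_5 : Surveyed 0x6855899d88b779 0x9acd6689e5e4d9 1848840 10 9 :=
  .of_survey 100 0x2c147540085b31050d6302111f80020f7110195f040084f508408eb0808979008c83e0228eac0818e6ca1004be0410d6a0208b740208cec03112ec0820cda0619692021165502410f3040851b0108b1e0cc0c4e1830e430665692008951d8040ce3001c47600085b301010db8000d7c0000d7c21004be09000db00010db31084a78820e5300084f54818a4e020aa87088284f082e293431031e0864a8b0649686068a51602085bc01110eb020931d401407e022aaa3024c607008121f020851d23110ab0244517062e0a302088ab0828cd8842447306196540414473212071d048186b01004de0260cf20018d6c040872d0008457021403e00004be0030d69c0420e7038401f02210d9000c01f000005f02328ea001070f0900a4f02084b3020a0f6010873502088a7021124b025171340086a7102d255401055e0032b0b028309e0d204da03010f38000f2d0000f2d402095b082485b084ca560422647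
    0x17215e312c1f21843b9420fd9038e85007c7631d01103e32b8c70881f2896620c20f988b13c6107d44b08e8483fa09a031441f (by decide +kernel)

theorem surveyed_6 : Surveyed 0x9acd6689e5e4d9 0xe0574c638679a1 2011016 8 7 :=
  .of_survey 100 0x4c88f084c44d0009a5e2288c3502085ad0210b0f041044f04294f11054467800a64701004eb908184f050406f042059b0210cea80018eb00018eb03410f3104058f004094f0230d7803206b30808697061c62600088de066568c1451543054066702318da011096b028482f21004770a4c88d2100f2d000a157003505b222a4f409440de034128f40a10f9084c49e0508733020a1b380131da008487e1090d2b023604b022d21d04314da040c02f000086f000b393000844b2308933081c47c0c55661000a647080c85d03000eb00004eb104994d030218f02090f5042044f021097301086a700804771384a27102a8ce311104f02644750840cce841156909810f90840ce3023453902332530429719020e0572110b2b201e11e001096b0429671400896d08524e3081a55c02108ee00088ed20a601f42c60a740640ed020c037000047780044be00044be020c8ab5090467071096a0220b1b00204de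
    0x28e41892d07cceb0507103ea299a21841f146d0d2060f95074906207dc838924183f7310a31041f (by decide +kernel)

theorem surveyed_7 : Surveyed 0xe0574c638679a1 0x12f65cf5af2d351 2023896 19 16 :=
  .of_survey 100 0x1b7a110c148f02218d9304958d0460cea001324f0a4c495a10521f2008c6d0018cec0910a6b22a0cba008085f02110de02240bb020d275230b315820c85e8000f1e0000f1e111070f202a49e038063702086a70c4c66588470cd0018e660290d3308196930311273040c67611405570a30cd8109186b001107b021096d22532470040d7305085751108a67041164b8008d7c000a6a74008a4f80044770004477198449e00c184f1864ccc041a96a0180f2d021401f000049f0664f21031071e020c73500104eb0408f0b08530cb081e06d0008657028087e021d13908220db0209aec0008d7c0310b2b040c86b202a87301405570808a570232b0b0c4c4ec031095e020c2372940cec1081d7102096559011647103255301085b3a100f2d02324e506656a129230d9041096b0c3604b104c90f021c4b621044be0040477044a58e07804ad0810cda282b691005504f020844d21004af02420e70211273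
    0xad88b80c40f988e38c2207d623d60eb03ea395231101f4286449c40fa2d11c34207ca769123103f390c507ac1f598a408860f9f507091607d6228de6083e83892a68c1f350625bc20f96e33088107c2951c83103e708d2d1281f (by decide +kernel)

theorem surveyed_8 : Surveyed 0x12f65cf5af2d351 0x19903eb95f36ea1 1926120 15 15 :=
  .of_survey 100 0x844f3060ce302116b310818eb02232cd023445e0c196e80c4c6a3401c31e0418f23000891f01815b902088be08298d9020c01f000045f800c93b0892473201086f021169e00114f30020df821084be0808cda200887702452570844657301c62702085b322195b80218daa042064f0809ada0408667820e2a7001447e0a50cf2008c81f058047e840c57c403224f040e1ab81844be0228ea50818cf209804bb083265302110eb08096dc0a48cf4000c93b231401f22c149e800168f000168fc10031f051124f001086f410031f010031f000031f0218d6c020869708204dd450824f30a248f004258f0244717042c8730a2e0f10419578820a5f4004c497800ab0f04085ab40884be103604f038093b00084de1008dec0840ccd2308475084c88f3028da98180f2d0664f0c0231a4d801171b11085b38000d6d0000d6d0a2c69c202205f08084ed000e07704630cb0009aab0810e4b024519b204b057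
    0x2ee613c6107d2570c47203e3538e92081fb98a418820f91d64890707c28510e2483e923ac241c1f7586141c40f90e848c2207e1136861103f57d9701881f709a349c80f9e0143ac207e1a71c48b03ea2590249c1f (by decide +kernel)

theorem surveyed_9 : Surveyed 0x19903eb95f36ea1 0x219246483932b39 2329320 25 23 :=
  .of_survey 100 0x310f6c8000ced0000ced000c8af081268f042466d04084de08c0c5705804770008cf603086a702144be821169e448c07e020bba1210045f801606f900c59e10118eb051056d0208f353018d6c02115b90409675048d01f010855d22c1873020a18f42a10f904414f32100f1e06c144d00444af42c0b0f509057310084b70a50cec81040fe041171b02084ab0260cd601012de084c49702567070d440eb303460f10ce9072418f2a0631a5a0a4c455210031f000431f020895d0234a0f200c41f0a1cb1a08084de8021a5b024b9cc229503b06c610f08116da00204db1081a4f404896d1450d63802265713209e902118fa080c09f0020f1b00084770a50f130818e652308aae80424e7428c2372830e5a0a550da022969504104eb021daaa03110eb001167309104ed020847302544a7004155d021411f8010d731419a4e00114fa021a556041165e0818e56820d2b30210f2d24615593029693123528b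
    0x38e658c2207de5b9062583f11d9101681fb250411c60f95e658c4107d28258ee103ee428823a41f35c6221420fa74720c0817d4838c82483e6868430c41f7212719040f9ac74384107d0708d24103e649c652081f22031d0c40fc2c888c5a07dd03d563103eb3a8641241f15cc518480fc48bb404307ee751049183f65c7501881f (by decide +kernel)

theorem surveyed_10 : Surveyed 0x219246483932b39 0x2a63e91aa680ef1 2021880 23 16 :=
  .of_survey 100 0x2089370381675101da4e081e6a3020b25702115f80808cfc1028ce5046444f0b10b1b131134d1860ccd23220de0629b190320f5c000b0d7820b0f50412573025504f03085b303000fe00004fe081f24d90115e904126670020ced0a2aa93908451f001165700098eb0a50f0d1011a4f081a5530180f1e0a3268d004c6a78001eec0001eec101054f0e5f301043446b0e3e6a004218eb1019555441a1ab022ea6504125ab022969302160770a28cd80310a4f0018cea001e1ab20230db023451b0a29999200851f0d4424f20498730c5524b02096750018faa8009697020e1b306894bc001155d081c46da100f1e061b2e20208f2d2888e1e0030f6902364ec020c8be10225d31828cf1084049f10084770840f8b1018d561818cec001046f2040cee04114fa8209a9e880e0f30c28ea90208457841730b061d20b0d10769040ab0f0048dec021096bc1000ef1040d4701000ef00000e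f0e5d710000a5b3
    0x32de428c40fb9030d8e207c2a39069103e9438e410c1f2683180c40f91650986207e0e408fab03e70a5641881f511070a440f88d72146107dc4b2448383e9b0c274081fb3a23d4040fea0158e2207eb670c4b803f1102c88687f (by decide +kernel)

theorem surveyed_11 : Surveyed 0x2a63e91aa680ef1 0x344a402274e3981 2109240 20 15 :=
  .of_survey 100 0x21324f0008d6d00804fe080c87d82126a7123eb030c5486b50885b300084eb020e04f041c6760a18e721180d73041466e8440cee021c73502110db020ab0f402d25d0408477041c4730840ced0629a560411769824195d090a5dc0810f1b06616550d086750418faa050d26d09084de003624f020c09f101c4a702296550d085f800196b3020893b020e0b7131218f0421a5b0818d69208983b402c0bb231087e021165e061b15c024199b024298f01020ef01005bb0440e67000c4770828cda149156940a0eab0020e57074c725024a5871010d6d020c6378180f1e40087b309000fb00010fb800445f000445f101958b90114f31431559000849f201c43e03088de212049f0708b2d031214f00824774018f6c0018d69042af8a3031a4b0090e6e2141a4f042447d0220e9e07086b60e5d6a003001bb00005bb8009a570381aab0a544b302260de00087b300360eb00925ab021521f88132cb23088be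
    0x3061a88c40fd8674a08207ce858ece103e1511c71241f2056a68860f94cb2046207c3124343103e53a5641881f33ac838820fd4e40ac6207d6751069103e171ee41881f30464114e01156608c8207ca6b8864083e01b4883a45f (by decide +kernel)

theorem surveyed_12 : Surveyed 0x344a402274e3981 0x3f2d47673e44949 2086770 18 11 :=
  .of_survey 100 0x4028a4f0231ae931090de90214dd084449fc0105fa072069e02084f304098eb084ca8f020891f042d29b408097b030019f000059f061d22dc04078f001164f024c99e078c53c222a49e000c86f226cc7400112eb044a5470421a4f03004eb02515f120196b3009507b90130cf80214db40284de0248f9603099f80218f13041a5f20a54473001967505005fa02c0dad90419cb0210f2b044978d1184477132099b188989b02444770231ada8208d7c020d21f001e0ee14296550020ceb40206de1488d2d01085fc02088af02116adc0085fc1250ce6301a867061f32104214de0b531c9022609f4008b5e02130de10218db025459e0d086ad8000cde0000cde0910f5a0411573820aaa703040fe0c1965a841472b0848ce30522b4b008071f02328cba08251f02928ee028c8be218403f618003f018403f02087b4210403f008403f210003f000403f000003f0428f7105084de020959d041616b103444f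
    0x112e08ce207c61459c7103eb41d2020c5f7188718440f98442a0e907d27b8483103e68e9611881f89b411c040fdc2b23c6207dcd48947183fa804831441f (by decide +kernel)

theorem surveyed_13 : Surveyed 0x3f2d47673e44949 0x4e1ef5d047a4121 2333248 21 17 :=
  .of_survey 100 0x40c62f07116f200404f70008b1f020999b0211a4f064d9a902087b30a2aa8d00195b9062ab0ba01d47c020969702084de010a38f02644f50408cee044b2c7021979a1020d5b0ae34d1020a5b3001445f8020cde41205f9041076d1249687202a4f5040879e0861ec900089bb10418cf029507da142557821521f2018f2d022259b40086b70848dad04294d90820e5703008fe0020cde8244477025519b042264f19088de082aee112498ce058256d0018eae002a6972030eab02a0db9020844b0221a8f800e6a7824199b0c5cd68001b38b001097bc1000df0820cd901000df00000df01440ef04525e3109355308094f900088fe061d1330212667042c71d820a717002a8de021167340604cf02098de81008efc019b69061b78c024d0f5048cd3a01004f723524e60d4068f02088eb51800ef03115f801405f3000cd7c072a754841507b0caf0590018f2d0e5b7801049dcc022ab9331088af02550f3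
    0x87129a3483e11a0e44881f3145719020f90e03146110608158fa703ea218e90881fd20503d9c0fa9a74904307f4385848883f7191074805f186c772040f96302684307d65204c3103f7290c31041f23ac241d20fc608b0b4307dd012347b03e9304e41881f (by decide +kernel)

theorem surveyed_14 : Surveyed 0x4e1ef5d047a4121 0x5ce96298b0826f9 2239440 27 16 :=
  .of_survey 100 0x8094dd0508775c01125f142964d0d9264e2008b1f0840cde43080eb09000df00010df842447b05085fc06e708b041446f02550ed03089fc0231a5e04a487b2048ea7020d09f04092f300195f80420ceb0d4c4ec0008677421c23713119da1018d4d244c437061d22b01085bd20198fa1890c6b0a544ad000845f03000ef00004efc04a78743081bd0208477088285f022b19d04121eb205258f04366630c1e55c01088fe02196ec020c4b702646570432753c0196ec06499a302112de202a8de0491579281a4ab001971d60196b30818eec40404f70281a1f028309f204959d2049a8f231487e0d4055b0460dda2033a4b0408d6d0618d6c201b0ed8408d7a024e18f4108bab022a7950c18cea800467700046770c5446b061f30d0b084f5294049f0008cf32290c3e4089a730280d3d0a4ccf4001125f201969e241b8ea028c4be084445f2018cab506c68720094bd13210dd0300aaf0c5d5580410d6b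
    0x9390c11881f598a408860fc0327ac6207c293d84e403e870c8249c1f014261100382cc51106107ea181d16103e8624e30105f32c6411420fb5443082307ca341c49203ef315611881f00d076a922f9469020e417d7011eb6703ec1a0e04905f (by decide +kernel)

theorem surveyed_15 : Surveyed 0x5ce96298b0826f9 0x6b9d5db88d6be31 2149315 26 17 :=
  .of_survey 100 0x211097b0a8a8ab400871f2266857218043f0b0e297001565e010407f404c5b308c485f0fc62070908ade2520477210007f000407f0808e8f050a35703087b3061d139061d21e061b30b20c0c77048b0de8420ceb225561702360eb0232755221d4bc0a19a8b00110ef02196b32818c7a02316e902618f3121d05e04295b90820cde0c1f28b3039e4c021e1b302170ed1040ce70c51eca201c93b23144be021378d02411dd00196ad8021eda0230d7c022caab030c1bd231169e038403f208043f000c03f000007f10a0e8f0c4d8da1989655200845f20924af062e9a9000871f124a5870420e4f1048d47021569e0280c7e0100fab040a4e7088ca1f005d55c0619a4e0040d4f005155d06371598210cee0a54f13841155b0828edc81010df0808cf3020889f04a605f02196b601010df10196e5889705b00195b32308eb6040a557001964b8424477431031f8001aeb0001aeb0a6d6910c294d901404f7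
    0x14cb08c8207dd145b43103e6225070881f0dc8658c40f9d230948207d48224e3103e0200c5184502056770c40fac31d406207e28142c3d03e3500883a45f81dda15900f8062380a12411674347103e181d0eb081f09daa1a440fd9038ea0207c9672502383e7510614881f (by decide +kernel)

theorem surveyed_16 : Surveyed 0x6b9d5db88d6be31 0x7ecbaaf2427a4d9 2056208 31 20 :=
  .of_survey 100 0x601ca2f025470f061b75404170eb8001df80001df8820a5970a54f0d062cb33128da17c08407f40187b30110b6b0629aec0664cec09020df0218cea020eb0f025318f0009ade08914f944c159b020844f243364d0a32ed2084ca57021131f40204fb0a51ee1006449f30194a7054078f00220df02086b7294045f005cd6c081a7550010f6d841166b4010b6b1236a47821569e090c29f2462d530a556930008cde4294a2f008407f061f0ec07085b308529cb004a58f041964b10298de0820a5f1018d76200871f004968f05804fe0a2a655030125f820c8af8000dfa0000dfa003487b103468f06656550848cf6040846f00ae47502111bb023624f022a4f50120a5f245650f0231675306b4c51218d65066445e05240fb2311a5e601969e000897b0a55a4d0a28fb10710b6a0048d7320084fe041166b1239f500d4a7450260ea740089af8044d73081097b0410f6a031431f030855d0308bb30720f71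
    0x1013a483103e039062280300d871d4040fba0ba9c6207c0609c4400e088db438081f0ac8628c40fb9a2224e307ea121d63103eb290661041f22daa48860fd9038c05a07d151d970103f0d38e8b081f720e920c40f852eb20e207f48846c3103f6185c83881f33d6520860fbb48b40e207d440a0e9103e43894d48c1f (by decide +kernel)

theorem surveyed_17 : Surveyed 0x7ecbaaf2427a4d9 0x92d0ee3847c90d9 2469040 28 17 :=
  .of_survey 100 0x1008d5700314db0a1b38d101e0e78214f2d041b30f221b7151014cee021b38b028c41f821378d044d11f4090a6f021b19e0c8c43b040867708c0e4f022aa57128ba47204b0cf4008f75282b8d9023f29306c38ce0840ce7020c47709089f92819e710208cf544c0d5e004a4e70651b4e80439cb1891d590c544ee02440ef13229cd000895f023493b084c95b0218dba40084f70a370d9082e0dd03405f3451426f0a4da8b000979d4028b9b1218da301220df010471f025496d214095f0232b4b0908aed238287700210df02087b52019673064cea6201965e181f0cd0260ced040845f0629655082c8bb1235a8b0720a4f4308b9e038c8be2429ea9001c47e048c47e0248cf628c0c1f0411eea0230e5e072407b085155d02344be06197ac80116de02088fe068c43e000caaf0851acb04495da043664e081215f0219aab20544af02098eb0818cda00084f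782099b32910e6d042a6a708930db0230df8
    0x7194041060608e30d081f305c8b1c40f9f444246017e5503c501aff048ace01d1f72503208e0f9da45092307d11b4062d03f6a9c6e5881f9ca0012de3f88ad4906a07e0309ece103e5bbc8b10c1fd40ee122c0f99a92086107d4472047483e858ece3881f (by decide +kernel)

theorem surveyed_18 : Surveyed 0x92d0ee3847c90d9 0xaab8afde49c8f99 2310000 28 14 :=
  .of_survey 100 0x20a1b784268eb1254ce6084a5d308c14db188ccb30460e4f01210df000c67763904be0828cd9021403f00004bf09085f90818e6d0a9441f081a6e30020cdb021a717042a68f8010f5e042969b061e12702a0cbe058d21f401525f0088d3b2889e1d60196ad800c45f0a55a5304cd61708a249f023af540460ceb8000eaf0000eaf1290d760060cde85016de0a90eae080869f03104fe023447d02756550210ced0a2a9f10008f9e050876d14a4c6d041a5734260df1001b78d0208b1f1290c670444d730a2ab9303092de801525f062ab3304196ab144b9c3291605f2380cbe800169f000169f0c54f0b021aa6703440ef0208d6d0210a6f010897713096e503000df00004df08440df020a0f7c18407f041c72b04acc7c10114cf0c2e6550a5484f18299d90291a2f02264f5820da9e0a329da02089bb4291b1b042a4de0c8b0ed820f0f5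0510b6b44648eb00150fb0008ceb0220cde003447b024a98f
    0x1a3520e917cc722461103f2d2e0078c5fb460340b40fc1223bac807cd408d6f103e538dc60881f48a0e01ec8f84abb8c8207ce8d0a0eb03e028ce22003032cee18440f9d4d2092307d2e80ac7023eb35c241881f (by decide +kernel)

theorem surveyed_19 : Surveyed 0xaab8afde49c8f99 0xc4d02a1d0160609 2425080 32 14 :=
  .of_survey 100 0x618f2300204df02c0caf1249dcc0019f718000cfe0000cfe04085af03405b78040f8f302d49b024999b06196930818daba1004bf0c36a4b062a78d8302797048407f025d55c021a5b33018d760ac195da309a9e0040df30a2ea930210f7614a1a4f1489a67021517d04834de024a59721004bf20a245f00294dd0009df8404c19f08ce857102d09f031097b1860dd30820cdb02195b3801175d062b1dc88154f9104998f040c46f80115f900225dd142e6470818df81028d9b0019a4f07115f8443278b6060ced800c677429453b03090fd086449f041c47e1290dae900d99b200c83f12498c7050931f1580cee0a32793001407f0810f730418e6e258305f021ab0f041a5ea02195f802214db020a94f0009b9b000cb1f0808fb3024095f020e5b5062e4ec0a531d31018dab023155d258187b18c4c5721220df0cce4a3820cd7c103165704a0e2f054c6a7294449f0c8a5ad1008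8ef0661ee1221b95a
    0x22e86876103e0000031040d0ba08b1c40f80052086103ce400cc20942122ca61881fd597088c40fa0e51a44407c001102500df570c4bb401fb25c718880f99e45844307d4e19047483e5424672081faa4043ac43f9f42441d607f4e81ec8103e61e8301441f (by decide +kernel)

theorem surveyed_20 : Surveyed 0xc4d02a1d0160609 0xe37e3b29dd114c1 2021040 31 9 :=
  .of_survey 100 0x31125f501c56d020a5f50092d730629a7c4009aeb80336cd31098eb061c627025cd6c22648af025451f02544af02085b7026da8b8000d7b0000d7b0c32b4b0216177050871f02086770a360de0c4c44f028443f0018cee8009aeb0818e73000c07f8000d770000d770c88e6d061a7a38421aeb0a36257081e5750a9453d8000f1f0000f1f002a4d71260f872418f2b248b45e0a18f9a02098db031057d020c8fe0841ecd211407f066525709084fd05085bb09004df87816b302110ef021445f061b32d0210cde4828b9b0828e9b02084eb0212b6711085b7008ccbe1218ce60a2aee1042965d01195f88208d73064c5b60009aeb020c03f000047f0425a5b8024a5f3140ce70422ee308131db0e5d6920019eec820bb55004e98f208c83f4230df803010df058407f06a295e24638cb044a4e70618faa21404ef042c47d00814fd0208f75080e657042278f8009df808c0cde0ac549d008c83f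22a349d
    0xeb242241c1f75d0720c40facc12906207ce60142219000014641002f22e30d0c40fc0e45d44307c830a50700be028cc4088101c61a45840fc1da3891607ece868e2403e4184c7008ac (by decide +kernel)

theorem surveyed_21 : Surveyed 0xe37e3b29dd114c1 0x1031d6129fde2631 2256240 38 11 :=
  .of_survey 100 0x4298db06a521f3018f271228ce30029ade12896970619655041bb630234d7c308987704245bb40d195b14196e3038407f07830de061c97a0208f9e0ca24f3000a9af26b2d29040859fa21e9338080f1fc080e7780044bf00044bf02085bb2288cbe0110f5e018169f02125ed601c47e02220df1818f4d08324db431076d408871f0a1aace054055f0020df9221c87e0e5d68c22516a7a10047f0c5d55c00084ef0210b6b401c0fec21c73508294dd10494d70c4c55d2940ceb6088d3b203acec04117ab028b09f041e06f061964e061a7560809b9b2028cbe402929f88131db626c89e210047f43840bfc1001fb41001fb01001fb00001fb0020ede0c4c4de88116de301d0778422ece020caaf085e687106ccd6004bac7041517b0420dfa081a65704096de2311a6b0408fab068a59e8841ecd8815a5b2041cf3004d99b0008f5e8241df100214fd0c32753049246f0818f1e002169f06a296d110859f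
    0xeb19070881f185d641c40fe8361c60207ca33088101d64114670182940c2eb1c40f80a1390c01c18341c0920be41882501cca598a408c40faca61106107e517c04058fe0014241804f00000188206d43182c6207c2b198a4103f8cbc40a2c7f (by decide +kernel)

theorem surveyed_22 : Surveyed 0x1031d6129fde2631 0x1213722be9b735c1 2327640 36 8 :=
  .of_survey 100 0x800447f000447f082e4f50248d730208cde042af650840f57054c5b302a0c770419f7224a305fa94449f091497b25084fe0844cde4308b6d145514f042407f861f0ec0689aab244a58f0236b0f39328cb021d675008c43f23104fe225318f23107370212b4f0e5cf210618d6a0c1c71e1490d6b80216dd04e38cb14195730720f5a63888be0060ccf083e8da6060ceb0310f76008487f02335f12908b1f051c71e0b31b5903220df281a68f801466f8220e4f389cc2d0240df60a48ee580260df0a5568d062d29b8820ef3021096f2029a1f0d091f902137550818e5e0282977000893f2428cfa1009de9001457b13211dd0508577303486fa00cc7e02818fe0211df800830df089245f0e5f0cc0834cfa03004ef086d8d90040d771248de5128e4a70235a6d020d29f0441b4f2050d2f8210cde8409eea1aae893041472f21a249f1864ccd040b3578110f6d19089ed068c93e8208fb311104ef1018cee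
    0x5310e110c02000e30904079f4183ac207ce183916103ea41c834881f886da80c40f80e3308800c036aac70103e5584c41881f41c2349002f800110ca023e0e41f56103e0000052040d (by decide +kernel)

theorem surveyed_23 : Surveyed 0x1213722be9b735c1 0x144d019c3f2173e9 2381400 36 12 :=
  .of_survey 100 0x22bb93061c4ab06930eb031531f205145f201a4778009a770218f272250d6d848171f07085fc0761b5302097b512c0d57066b9e1271b30d9021dd9001047f0209df8210165f0b529ce02116be0010e6f00098fb0720aee06299f805004df82170de1080d770b331d91228cf60862dd30321b5d052055f0d086ed210c07f142c55d0849ee5221b0ed085555d05225de0020f1f1018f0f0218f2b066d4f4c290f3302614db088c83f020845fa100cfe074c9ae00668cf0818cee022eaa721044bf0209af38020cfe51804ef31089770209bb30c5cd6c0008d7d60285bd08558eb0009a5f8822acf242c4bb020cb1f13111f3020859f0049df1423278b14a0e4f040e0ef0b48f960889e9e200b19f070b38b09060df0408dfa245155b40197b30c196e90818d790260cde121995e02090fb00088df032529f145314f820c5bd02099fc149164f0b40797026599b00099bb062ab1e0231a4f0418f6a02196a7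
    0xa330482041c9090e3103e000482198b2838fa122c0f95071a40227c022982020e461c430d081f01c46094048388940c4707ee521862083e001c012086f010251180382ca4184c207d110c2c3103e0300a120c520ac8619440f9c2a1912207ce8359c1103e1b916f10c1f (by decide +kernel)

theorem surveyed_24 : Surveyed 0x144d019c3f2173e9 0x16cb9d1ab69760a9 2278080 39 10 :=
  .of_survey 100 0xa5521f87816ad0234cfa8829edc1980cde0929ad9209f01f074c9760218cf60208dbe1b8c4b58213755042a79e0a18dba0240f57122959d024a557301944f254995e0b08b9b141955ea009e7302448ef4239aec12531c742189fa048b5750c2969b2008e770309ade4508b6b0618f0d0008cfe8209bb38222b8f05001fb00009fb2009a7709448ef0d212db020e1b7021bae30018f7619086d7066d6960c2aacb01125f30a1b19b003179b1a74ce110096d7122aac7040855f202a49f241a6672020cfe001b1f3021b6d601844bf24624cf0c5e58e022bad3080ab1f061957c041274f8841ecb004e58f0461de9021964b081e05f0062ec7201047f041167e0d440ef201a86f29408ef8844ced40e18db0018d6b1aae8550c3278b02318db20084bf050e17703108ef508897720d4c2f001165f8010f6b04095f9223169b040a7574218bab64730cb401897b050cb2f8820df9008447f0b409de0308677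
    0xdce920860f80e5304801423640e02d03e4126ce3a01f00000208206a20e58ec207c0320440316560c7438081f00000290206c0da1c42207d6620ca1103e009040198b225cc219420faca60906207c00000a4081b529c8b1881f (by decide +kernel)

theorem surveyed_25 : Surveyed 0x16cb9d1ab69760a9 0x19945f1744ac2689 2492840 36 6 :=
  .of_survey 100 0x21123f4918b7303004df0380dbe42192eda10447f441935b0d4c6a78208cde0920df9b03644f1b948ab024bac70dc44af124c5971230d730109aeb0008d77001b75531085b7030aba706196ae242a65722c0d1f2061ced820a9ed8822ed30308dfc072b2d60a48f550220d7d294959d0a9487b081a64f4029af312a18db0a50cf34018f76828259f8211aeb8249f9682099f980244bf4029b5d2149a4f24734ce00350fb020a78f8508fae0249f93148c51f063f0ec0b10aeb269d43c022e6974099a73410079f04416cf05099fa062e2370d805bb08654dd0410f6b94a644f06499ab14c0d4f0860ccf02964af002aece10335cd12b1cec04337530419657061e16d03195f800084df10099db80014df00014df000c93f0034a6f20114fb020a9772018c7e200a5b7302c49f2818d79210447f2010d7b031407f064d0f381005fd001964f02314db188c85f026445f010079f02110df844b9ce02824f7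
    0x4092589e01fc051988200600310a010c32000461940179a3a1860207ec8184ee103f0a99611881f000a320801780c0110a11c40029061101e019887100307542b38c02f8000118a123e2686861103e000c242880f (by decide +kernel)

theorem surveyed_26 : Surveyed 0x19945f1744ac2689 0x1cb3a02532e71929 2377200 30 7 :=
  .of_survey 100 0x469eca08ce497062b257042ea4f000c87f08554ed0040d5f444c0ef02228ef042165f066da8b06196758280e770a4da9e0808df907085be02a1e9b0c3664b82431d70018ced18a0cde2018d3b2120d7d0a360bb21084bf228b09f890a9de101b7870089a77024bb870419f6902294dd0040cef443c6ae0834e73081b2ed080a4f704294db4874657201b05f110855f83119fa13199f22b4c4754061acf050c4fe0940f5712aada5801b78b0310f5e02316de0018f6d102b9cd0b122cf0219a4f0234d790180cfe00c1ceb001447f020a9afc1000ff2080c3f01000ff00000ff31088ef80098ef0420d7b0840f1f00299f90840cfec0197b30649b0f8410f6b842daab0220dbb0210f2f101964f046568f0d0c27707c159e0221a5f07a521f02197b322898bb3018cee058047f005515f02938eb0808ede40332cf02894bb00360ef90250df820bb8b063f2560254dab02429e7024d99e0008f1f06656b3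
    0x248c343103eb2bc660881f010a10186290c2eb20e207c00010a3089e0000041040d0008030c41780043086103c85018e1188263a4640881f000e111003784abb906207f5041dd6103e18d91a8081f (by decide +kernel)

theorem surveyed_27 : Surveyed 0x1cb3a02532e71929 0x1ff1b5a5d05e33c1 2162440 37 5 :=
  .of_survey 100 0x40111fb020c5bb2318e760c3aee2085497b1861ecd078071f0c4a55721000ff00040ff0288caf081ea4f14ad49e028487f020c07f02527a7882aed600112ef0228cde8001ede0001ede042c45f0a4c4de022f0dd44c8f2708096dd0818cf31239f8c08c1e570661eec0220cfe066bb8300111fb429125f06a605f020a8f7125155741081fb45c0577020a5b702260df048b17d491939b0ac0cde01005fb0665675062ab0f0209aeb0c535da07c1a4f125d9a388430df210887f232ab17201af27041d65e50699cd8420d7b041e56d05090df018447f001979b02099bb228c83f40315f9042aece1180d770208ceb0240daf04216db0b0c0fd020893f048e53702631dd142c4771030f731029b9b021ab76002cb1f28aae170c3264f09830df000847f068953d0718faa1318fa62048d1f1008d77048cd3e2118f1e205551f231071f2869e8d02090df82127570d0a2cf804af47050c67703001fb00005fb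
    0x61048500e20018012086f0a5d641c40f849a8c06207c00088a400de1491071805f3a42519040f800000c41034041844501a2b214261881f (by decide +kernel)

theorem surveyed_28 : Surveyed 0x1ff1b5a5d05e33c1 0x238b7f675c514519 2461200 42 5 :=
  .of_survey 100 0x230eee1120f8f1330f4d022c8fe01111fb21094fd60190fb0210cfec04c9af004a9e707c25574dc064fc0c18ef45202ef04096af49c10df428c0bf821331f31298f30309bb3021523f0890e7e0818f6d83116de06e34cd5029ade8208f6d190859fc1005fb023457d0a49ef410814df1869ec50818e570432f4b02088bf0008d7b0018ceb042d4f943101fe064a9570380d7d101b5cd8020cef0a18df8041157b02296f51049b8f065cd6c0618f2e041165f8821ed9045457e1094d2f0664f2d43287b5252a7170e3aee01871dc902654dd0a32fa942a8cfc0232ee6044b5d30251de942192de0228ef682366a7132ab87232a4f5001c97b41012df0408d7d08a2a5f041374b062e077021169f13350f3800569f000569f1080cef0a28cd90020cef072c8fa2032e6705007770a537934dc04eb4828adb141d5ba81040ff285e90f042da5b2928e9e01012df050c71f40a0f1f218c43f06b707300550ef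
    0x43144103ce5208610188030ca011032000c1110037800000c410340530c4400600000432848f1b90638440fc34e3891607c0000083105a6758283881f092b058c40fa602700f647c0000083081a0004a02086f (by decide +kernel)

theorem surveyed_29 : Surveyed 0x238b7f675c514519 0x27a8c91e05f68811 2465820 43 5 :=
  .of_survey 100 0x38047f82830df00212df020a4f7201cd3e02195fc04096eb0b346ad0a5378d020c93f03204df062e0eb828487f190895f04c15bb061b31e02088df09000ff00010ff0a62ed604414ef1860ccf0088dbb901f0e7091465f042c4fe0231aebc3085fc18e2cc700650df042447f19225dd142f28f1818ced501a7a713085b70c3447b12d5867404a9e70818ceb004c4f7101155fc018f768410d7b224a58f0cc145f038487f0828f9b8820cfb41089fe400879f0320df94428677022a5f5021a7a72259ea60234e73081e31f0c18d6d0510f6b12197534871acb13515d306ce927061971ec0619db10299f990814df0a368fa021b1f3483e2578008d7b002a8fe0461ecb23c185f041256f1032757442925f0980cfe064f317101b5d3023179b0c54f2b002c8fb0c39ee80309b9b614919f001f0de485055f0a50cde0464e4f000879f00325f30ad4c73449c47e0088cfe1418cee223251f0c2c4bb0818fab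
    0x3156219020f800000c410340038083089e0014811880f5988508c40f8006110a00bc00000c2081a0018402846f591e608c40f8005184c013cf770482183e5598811881f (by decide +kernel)

theorem surveyed_30 : Surveyed 0x27a8c91e05f68811 0x2b840ab3fe413551 2348808 37 4 :=
  .of_survey 100 0xa08187f401c6af0850deb020c8bf02084ef4108b77001e15f8024cfe28cb4971109acf04207bb0d086eb02c0d77c04c977402a6d70618d7600135de1aae495c1089fe02331db024c9af441a16f0d8a4ed1250ce70b09ade228b05f0129ade0d88cfa0018cde066569e02199fa483625f208187f1248d970a4c89f2109a77401075f1028cd7062e4f60a2ceb30669ee10018dfa0208eaf8210cfe0009fb30210d77061b774334998b0218fb3481d27d0464ceb061d07e02084bf131c7170819b5b0908ede203167d02a1a5f40089fb229b475044978f0a4c8af0c8b8fa0029adbc0195fc202a8fe5060df30bc28cfc0a0eaf1039dd8000c47f08554db048ab2f080c4bf243acea11099f306a2f33061f32d020a95f0829af90818e4f063466b0108b778249ddc40087b78080d3f0a50ced021bb8b01005bf0c4c64f82364de062e9ab00114df201cc7e001075f231c93b108cc770290d7e00898fb021cb2f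
    0x16628483103e039461200510004428c20780050048313c0021825009e68e8700881f0000029062685662906207c303a1d6103e02142330051 (by decide +kernel)

theorem surveyed_31 : Surveyed 0x2b840ab3fe413551 0x303a921e01320421 2449272 43 2 :=
  .of_survey 100 0x62cd7c014c9af841bb4b00324ef0c4a4cf022ca7704495ed294169f02144bf0b42ae710098df029171f012c5bd04085fe42cb0d703000ff00004ff081f0de0c60cdb0428eee145596b0c3b6c90ad1e4d42316de0a1b9da821169f0c75a4b00195bb30c9ca70d088fb08495dd11005f70c2e6b3028ba4f0489a6f0635579425096f104d98f0260ee70028df9040965f081cd79066d6553051cee8001eeb0001eeb03041bf0aaae550460deb1034ceb801567744e0ceb84a34de200c47f041976d0819df80220cfd081ab4f121d9ab10325f30619f6c025515f9020cef00810ff2288d3b231123fc0105fb1031ecb4028eed01085fd02360ef4029adb061964b0c18e6b22b583b061a5732331a730210d7b0693b2b0d8a95b01087b70ac2cf60249b8f0022f8f828f09f0264cde0c5cd6913085f3800adf60208cfe43083b743081fd281e63707225fc210847f0a93a6d188af1702130df1108f57502d29f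
    0xc20940379ca32080609dc732c61103e0000051040d000001882069c61859c207ce33044021500014602044f (by decide +kernel)

theorem surveyed_32 : Surveyed 0x303a921e01320421 0x35555dd6b13a1f21 2500680 51 6 :=
  .of_survey 100 0xa354f98000f770000f770018f3e042a9eb084c95f483279b070857d0a9359b0418ceb0208f1f4230f5e2180d3f061b78d0a336d30888eaf065b74520195bb062eb0f428a15f43191f9c018f6d1330f8b02a24f701c0d7744296de068ba670008cef1265a57848d61f606169f081f0db0a48cde422a5f5294259f0460f4f41221df0a89e9e1274ce30009ede044c5770619573008b0df9008cf70a2da5d9861ecd0208d77028f05f0048d774060ecf061f16d0a32f4d282adb90c8e63719894dd401c07f04495f3190a9ed021979d01004ffc1112ef0818cde04325eb0410d6f010c1bf603a4ed14b586b820c93f0d18f699019ee60d8c47d041a7670a1af6510a30df020939f2474c6b00296dd109507f0c6ce53305d4572309abe061b5f28001df90001df90a4d8ed45285f903113bb088a95f0b445bd07097ad041c6770c494db41085fd0d0a5fc0430f6b02361bb0289aaf0c1e56d201b4dec0805bf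
    0x428c400bc61722c7103e126a301881f710e511820f80042846203e860bc0b18be0000052040d1860e45840f80c2090a01c400000a3081a0008c42802f000003142069c642980110c0030465101e7358617081f (by decide +kernel)

theorem surveyed_33 : Surveyed 0x35555dd6b13a1f21 0x39bb13f61f979621 2352000 33 1 :=
  .of_survey 100 0x20c4bf02156be072179b08c0d5f141d96b0618e6e61184fe208b49f238b09f062e3b30b260fd025b7960980cfb02625d70c2aee3422d0fd0c2ea4f08166af91419cf0281a3f141c46f08296dd14639cb8000cdf0000cdf03104df02499f307131eb048d07f101978f021d0fe0a4a4d702325dd021f0de1219dec400c0ff3118d730060cef02136f6021447f0218fab60324fe021731f068ad761818ceb024b0f70818f5e00206df181d59b000b6d78209a5f042ab4f01195fc245b54d80094df07212db121cd76203255f02137ad230893f0008b3fc1087b704087be0309aeb0a3d699305cd27102aec70841ede00294fd005d5b303091fd523ab560428dfa02112ef0909adb422a9f344c0d7e272ab3305412ef231087f0e5b78c086ccfc0818dfa01105fb42499de0219ade101c5772019a6f0c49f4d908b4d702111fb083e69e1030deb8009ede0420cef210b0df02087b702550ef0820edb0b125de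
    0x62888300620000062840d000001882068003018820bc7644750103e0088e0198b2 (by decide +kernel)

theorem surveyed_34 : Surveyed 0x39bb13f61f979621 0x3e829793cd742861 2408840 44 2 :=
  .of_survey 100 0x8d4c7e1019677021964f061e96e028a99f8021df9303d85b181cd6d442b2cf10295dd10195de2310d7e0cc60ef0050d6f2cd351b8423b5b014c5b704894fd063aee203087b728326ed8011eeb00085bf020d9bb0c49dda062a79e066449f0c4d8eb42488ef481c6771520eee104995f421cb3e1018f6702084df04896af0228ef322565370021df90219af3061f30f105b7879253787020b9ed0308bbe8100f778841ede04105fb080a4df228c43f093467d11212df0218f9e05087af062b2f383040ff03111fb8410d6f2018f3e00085fb003e6a70f62ace601923f001565f0044d77141d573092a6f502525af201b0fe301949f068da2f3031e73241d47e2874c5b8819df811499de8a5379302531cf272b2b30220cfb064cbae038165f1051dcb024c5b70218d6b0a18f1b0a8af1740206dfc01e15f8210f6b06656ad3112577061c47e0661f531489cee09085fd20494f704ab8fa800af8f821159f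
    0xa408c027800728c400bdc538cc1103e000c012888f000002904068004080a21bc061840239640008871840f000e418440780042806113c00188a4005ee391611881f (by decide +kernel)

theorem surveyed_35 : Surveyed 0x3e829793cd742861 0x45de9f5271cbd2b1 2467920 51 4 :=
  .of_survey 100 0x1060cef1251dce07225de020a1f700132ef271b32d080b9db45087be0108b3f48196de021ca6f0288cfe1418d67021997d010c0ff0c8af0f201147f2b3621f84454fe0c4cd73c22ab9e0aa2ced0222ded1128fad188cc7718364cf050c33f0ad684f1018ce7165f15606a4e3e026bb8d4250f67033335d041b2cf29444bf2233a4f281af0f8844cfe42327572008d3f041076f03112ef0220cef222e8af606c49f06964af10196e70331aeb0020cdf52e29570629a4f14a1ceb0409f6d800e5b7084a5d723088bf8849dd982137ad0781a6f004c4ef00204ff1818f6d082e0df04316db08644df020879f8c4cd7c0a954bb068b5b311c159f020db1f0a28cf9023664f0022ee742299f90318f761889cf39862ec72060cef28c1c7d250b0fe200987f0c32f4b03005fbd0197b382156be80019fb00019fb042a71f222a49f129d8730c1b78b02650df128d91f032079f189ccab866378d0ca34db2008b3f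
    0x1071f424581f0008209c037bca132c6207c8b304a3103e0018801882f000001882068004188a00bc00388a3005e0000031040d018a2184048b8c438c2207c0031424101e001ca31002f (by decide +kernel)

theorem surveyed_36 : Surveyed 0x45de9f5271cbd2b1 0x4c67befee9d41f01 2351440 50 2 :=
  .of_survey 100 0xa64cde0421eebc08c4bf840c47f4888dbb501d15f021c6af07246af34e1e0f001969f061d5b9035515f6030d7b882669f0d8165f01085bf2818c7b040c17f044959f02098df229523f42a1a5f061f31e028969f0348fa712296f5c018f5e0048cf702a9eb30310b6f2180c7f088e45f1a9e4b6441c57d02924ef60630df442e0ef43081bf42c14f7206487f062a5fc10cb98f014c97705085fd285ace3062bb8b241b8eb1920ede0848cfe8209fb3c01057f129394f06297b951405f7025b5e581019fb04324ef061d69e1431f4b040f15f04195f9065555e11195fc052075f80025f700025f70041dde080da5f800b1fd169f2270829ed92291e3e441a767020847fa94259f8209fad14a1d5b0c3664f1090d6f0061eed0a61dd91232de3601997b023e4f61249de5085d5b9070871f42360ef121d6a705091fb069652f06197b3202a8ef0018f6b07215f90b18df80a294dd020dabe064cb764430f6b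
    0x14410356521823103e0000031040d000c011023780e6184a0144b413c8b00fe0000041880d (by decide +kernel)

theorem surveyed_37 : Surveyed 0x4c67befee9d41f01 0x53425be3ae1f2459 2202816 51 0 :=
  .of_survey 100 0x20bbb30820cdf02170fe00096f70a88f3d19844bf49089fb0728f6988838fb03085fd0330dfa432079f225b647800f0df028c87f0818eed27630ed0209dfc15095ed03240ff42c18ef49192db1818cde041c66f242a4fe1289ea727294fc05105fb0a18cf3821f0de231257740104ff252447f43087b7148b55702930df025d96d0218dfa203447f15096e7025b78744295f901085fb251157b428a5b7231331f1849acf03195fc38a9cb9121a9ee2910e6f02516cf1818fab040b775039523f024a5b7a94169f070b38f04085fb0840cdf0a51f8b2310cfe02114df0218cde02518ef144978f000f0df8084d3f0c49f8b042e64f29124ef06c394f21220ff0428cfe0231adb4b5238f006cd9b482e0df42490df43081fb0041f8f1489677045166f00088ff0629edc840adee0663b8b04264ef202369f09660df227398b801b7ad0211ede42625d7431433f030a1f7820cf37150d15f2d4a6a70a525f3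
    0xe4081a0000051040d0000018820680072046013c003082500de0000041040d (by decide +kernel)

theorem surveyed_38 : Surveyed 0x53425be3ae1f2459 0x5b670e13159efa59 2448600 49 1 :=
  .of_survey 100 0x298df0ae1ef1064ade60675b690230e77880d69f070b1dd048c47f02195bb864d575880e59f40306ef4a5cb1e102a5d7052e1bb1034eee40487b70629ade1081aef2250d7e48284df0828cfd8a5378d0228df954b2667304995f820bbb302140ff078171f8211ede241967e0a1b1f902220ff250b15f223f31d0c50f6b6089a3f0c18fab00232df0061ede093279b041b74b18aceb3084c8df82155bb1a75a8b0033b5b643a676021d25f1042de7c0088ff821b74d401a1fe231487f0009aef80016df00016df1a3ccf240187af0a51ed314499eb60294fd0211eed20198fb222b8dd01090ff1980cfe0632ece4249ae7020965f2508dbb069173b045155f001f17d0188cfe03084df0020efe051076f0411eeb11085f70218f3702758eb4b921bbe0196be821557d048965f18ae8f3061d21f502d0df081c4fd10085bf8421eeb0074ceb041957d8000f5f0000f5f0a2cead0e5bb8a0231a7b0418f6b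
    0x1008508de000464308af000e20900378000010620340000062081a67904b28c1f000c51882078006100830bc0019882005e0014641002f (by decide +kernel)

theorem surveyed_39 : Surveyed 0x5b670e13159efa59 0x62bbf92cd6a21b91 2308152 46 1 :=
  .of_survey 100 0x5ade301132ef09496d7820da9f0a926af0618f76020ab771464d4f08cb8cf0918f6d408a1bf184cce7273296b868b59e021097f383ad4d0c9e6763018f2f0c644fb1289db330b4c7e020c47f07633cd211057f0818e771860ecf272d0bb0c30eeb43405f78084c7f03004ff001f31f0d084df0008dfe063175d206b8de8022ecf00c9db30a28cdd0828e9f251447f04834fe82c1ceb1461dcb263b59a01044ff100cd770219b1f001473f403abab99260df083d69b18a60df025cf270041ddb0009eeb0874d5b2289e371da605f0221df9028c4bf06915bb4308b770219677019165f840b77506a2e67030339f122a9ed448c53f1d8c6378209dfc0275a4f271957c272b29e03531cf0018d7b0018cfe001d6be06c1d6d245354f28c0cfe801eb2f184cd5714496e72c3e45e4008f77085b5cd820b7b50248daf0209ede8422f4f10515cf020bb8f0a92d6d8820cdf065517b88470df090a1df00084ff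
    0x18871002f0148119c028800000c410340029043005e40d1e25807f (by decide +kernel)

theorem surveyed_40 : Surveyed 0x62bbf92cd6a21b91 0x6ba306bed065e961 2214072 52 1 :=
  .of_survey 100 0x216dfc21b39e1009dde639123f0008cdf07223ed198c8fe02336de1419b4f0218f2f0664f1e098c4bf06e1f71101c55f02085bf0928ede272c93b2018cfea022f1f189b6d68064cfe0651de9029307f089cc7e189165f941d5730c4a6e71008faf80099fb002ccfe8211dfa2309a9f00115fb02092df0a51ecd06519eb01088ff40750fbc009aef10298df108adf62308cfe06196f603105fb1008f778000f3f0000f3f2018e6f0b8487f204db1f144b5c74448df30a368db0d4c4ebc3089fe061b75502110ff0839eda1d88d6d8d125eb05085fb2044d3f1311757138c4772250f2f1234a6f1028cf7806569f0061df900099fb0cc1e4f020aded070a5ed050873f0e3af4c2419e730213757830339f8009eeb061e56d062ea4f12346af078e33780095fd022bade05296f30661ecdc2197b31980cef02294fd1b60dcd0a1aee6028b0df331996d242a71f001965f144a5e7d09197b314c9af2940cef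
    0x1882068007208600bc00000c4189a0014433002f00000290406aca60906207c0030c24101e0014623002f (by decide +kernel)

theorem surveyed_41 : Surveyed 0x6ba306bed065e961 0x75375448852cea59 2446920 44 1 :=
  .of_survey 100 0x42a0e9f062c47b0a18dfc02c1fb38080f3f145554f13333d30a5cf33422a2f7002e59f0a28f9b05085bf206ccbe8209ede8411f6b020a7b780244ff022a8ef00830ff068b68f3075a4f00364ef189cf2d1055b4f046bb8b02117fc0a29add061a5f6c0084ff151d36d31c18ef02aacf50d086fe09325db12cbb87000a9ef8211eed042e07f800c5bf0724a5f3439cea1290daf02a4ebe2b28f1d0859de9c08c47f084c4df0828cfb00225df2818d7d0818cdb0a1ccfa24298fb0018f1f041374f0828edd2860e5f4659b6303019fb085cd6d0e3da5a801175f061d57913345fc032ca77922af872048d5f00c1e77080ab5f0caaef26272557081e5fc068d87b001d5bb183afcc0a48ceb8010f6f06644fe824559f610897f04261fb20738eb204adf6048b7b3000c5bf83061bf041557b12199de272ab1e224b8cfe01d23f03220ff03550ef00116efc818f6d1428ccf05092df820e5b78020dfb0e5cf23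
    0x19e45844307c0018045091e0014c21840f (by decide +kernel)

theorem surveyed_42 : Surveyed 0x75375448852cea59 0x7fa4decf07bf1531 2367540 52 2 :=
  .of_survey 100 0x221f05f2230eaf0236b6d18ae8ed585d0cf042c4bf06e34ed8900dfb20c1e7790a35dd94a1e4f9009ded0a30df912499f3840e96f3050d6f23144bf0e3eb0b14296d70234e7e1318f760629df840c98ef4818bfa0010dfb0220efe224cc770220cdf18ae8de021b79e0a89a9f150c55f21229fb024bb57401457f430879f0318fb3024db1f0a2e8ddc8296dd0428e6f0210f77091c71f61204ff0a564cf27630dea31331f089ce2f0710f6b1009f5708454df40396f306755790a52ec79009df30671f694b321f9841656f020b39f90819fb0219f7c0619eea52d14e7040857f1219b8f068b4de2929af9022ea770211df9e030d7b0908adf058b31f0818e6f0818df90500f6f0208cef124d0f70518dfa0a9259f0841ddb8265aed0281e770034d7b409057f0409eeb0b9631f0818cfe129b5ad59640df001c47f09a0cfb04e34de064d27706364eb17915730cce44f2418f2f091a7570618cee21294fd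
    0xa2081ab214c30881f000c520c0178000010610342f2ac82183e610ca700486 (by decide +kernel)

theorem surveyed_43 : Surveyed 0x7fa4decf07bf1531 0x8989476e33ae7e29 2582160 51 0 :=
  .of_survey 100 0x221afb325d5170d406ef0219a5f021b77509088ff066471f43112df070e0ef0c325dbd01978f020cb3f80c587f60e0eaf1020eef1290d77821db7c0674e6e0acaf17081baeb31114df0018d6f1271f530c3467b0230cfb0629aeb09086df152a5de00144ff069b67602085fb06296de189447fc24c5b7084ccfe13195fc0049ddea28d83f2219677061e177230c4bf002e95f08262df4248f57448a55fa100f3f0251fab01419fb023447f2828e9f0418e6fa00d4bfc010f6f131d39e0218e77061c73e081af6d001b3ed230847f067565e02195b7004d8ef848547f46a9a738208fbe022e5bd647164f021335f142cceb02425f7002b5dd8000d7f0000d7f0a9ba5e0290d3f0a72ece06d1f2b848355f880a79f0232f73142c59f023671f06a14fd081af7303092df71290df4018b5f2060cdf922f0d7113455f0262f570669ef2247375300a4e3f103cd730664ced0409b5f820bacf2100f3f08196db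
    0x5190400bc00000a4081a0018451802f (by decide +kernel)

theorem surveyed_44 : Surveyed 0x8989476e33ae7e29 0x9367cfed5c78c7b9 2548560 47 1 :=
  .of_survey 100 0x801f0ef024497f223af3363904bf181aec70ad34de00415df9232de30789a7e042467f0a90f1f04099fb0224cfd149155f10335db871176d0109aef332c4b7908d9bb07824ef029b68f1331b5b0a3269f0a8ca3f004b9cf0064f1f20c4d3f0eae86d203acee4218b7e024bb8f06495ed8249f9e042a4df12298fd03648df2818e778180f3f881cf7c0292d7e0a5cf2d81095fd0bc0e77a311a5f044cf2f314c9770c18f6b40c1aef04115fb8c3664f0a28cdb0410f6f248b45f1119b4f021473f265af2660e0f1fc5206ef085655f0ab661f820e3b7080e8df0208faf820b39f209ad3e050c7be0264cfe02356bbc508777314c5b70a1a9ed0ac0d9f066b5f1081d67d021f31f02b587b042afab0a5e9ab800c8ff084ceaf0461eeb039157d2260cf70818f1f0180f3f183af4d066daab06af07da310cfe025cdb3028adbe1a9af070209df98241f8f02088ff0671eea04225fb10216df0b30f790210dfe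
    0x62081a1596e410c1f000c419c017800001062034002080608de0000061880d (by decide +kernel)

theorem surveyed_45 : Surveyed 0x9367cfed5c78c7b9 0x9f249af5a81b68f1 2483040 57 2 :=
  .of_survey 100 0x28c47f0228cf7081b6de143b753c4295f90208dfe0908f7d43089fb13299f990115fb061c46f0c525cf0618fab2248d770808f9f820cb3f0d18f7a189adab04125ef85044ff009547f1391a6f182c8df0e5da8b0218cfe211b0fe000a5bf2119677325d4a70760fab0708b77003af4b042d8fb603b35d0cae47d0c4c4ef041b7731c74d4b88a2df94988afe0731b5b14e1ceb8210dfe0008f5f425a5f61274dab041d73b079167e422e0df82170df042adfa810c5bf0d4c7b30a50cfe1288db702a0c7f01216df488a4df208bb1f8220cdf21260ff8a2e69703296dd12299db0209aef421a1fe062a5f30810dfb01115fb8211eeb1028cef0f4ab47063b75c081c47f024c4ef13197752289a3f0318dfa0219fad28c0c7f1918f731475b4b0209af78840f5f2580c7f2230e6f1034d7b44292fb03229fb021d9bb0262ee7078165f0ba2a5f0e75a4b0308fbe183d65d80814ff8893b5b0234cfe032279f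
    0x594c120c40f8005190400bccb09483103e0018612004f (by decide +kernel)

theorem surveyed_46 : Surveyed 0x9f249af5a81b68f1 0xad16eb32cad1f529 2510760 52 0 :=
  .of_survey 100 0x7087772428e6f0d0879f00652df1264ccf88444ff2348dbe222969f02825bf041c47f02131df1089e77146b6c70a577938209df91250de743606f712b3b8b02248ff042af8f001d69f42d0d7e0b3279ba100d7f0e5cd710040d7f0cd1e6b041276f06a9e750ece4a70e3aecc07205fd0019dfa026d4dd80096df1089d7d0b92a6f104cd771948ee71948f8f1360ee702c1f1f0dc255f50761cf8212b6f061b2e70049df3601d6be143b74d203b68f0b4ab57003e64f02145bf0d616db305b58f22294fd05261fb2818d7b8812ecf0a18f5ea01bbab078447f104b9cf82116f7c0362ef002a79f28194fb8008dfb1081cef102d4fd08116df021e977203247f2118f2f0a18f3d0229ef584115fb081f25f82419fb42c14df110979f0c6ce5e12c9ea7824b9f30432f4f89461df02c1e77102e95f223b9792848cf72aacc3d8410f6f2039eab000c4ff0039df80780cfe21830ff084af57001e96f30298df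
    0x18a21802f (by decide +kernel)

theorem surveyed_47 : Surveyed 0xad16eb32cad1f529 0xbd333d79cc9bc611 2348920 51 0 :=
  .of_survey 100 0x121d5fc03127770469ecb02084ff8449eee04294df0b348fb0880e7f042d4fd50716cf2059e670a74cde243e47e55a1b5b1818dde028b9bb90335db021cf370449dfa8000cff0000cff40317f9a00a5bf0251dde0a296dd249147f82119fb061f0de1039de931494f706496e78909bf902346fe0a29ed919516cf209ad2f110c5bf426d0fd4858fab2548f2f068bb7306195fa0210cdf48c99f9030cb3f0288cbf900d0ff06c9f1e13109ef074c9af0019ede020a5f7061b34f1273bc306195be0a924ef022ccfe061a78f0d296dd3144d778820efb151c72f2332a6f0a50f1f3239e93083665f0451f6b404979f1071dcb045374f830e3b7023f0db0d4a6e71109aef281c4bf03085fb884adde425ab67400c4ff0718f760ab64bb40e14df004b5d7201cf3e041adee0a2aa9f0300dfb1918fab82445bfc1001ff41001ff01001ff00001ff02099fb42c8f370281a7f485a5ed201963f009355f02c1dfc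
    0x520c400bc0028c46005e0014623002f (by decide +kernel)

theorem surveyed_48 : Surveyed 0xbd333d79cc9bc611 0xcce3b34c848047b9 2590000 53 0 :=
  .of_survey 100 0x285ad5e062a6770c9adab0380f3f08664df4239ade0451deb824bb8f0a525cf0d326eb061b7ad1848cef8019ede423e2770208dfd31196770228cfb105b5c70cce47763916be02125ef8281a7fc4296ed227359b022da5f2239f391828cf77131aeb021f0fe0819f5d3118d7e13240ff429b2af0108f9f0518f6b229787e12cd87712b705f15c155f22336de072b1dd8629df810197f3091467f401897f1980cdf223af1e02362ef082b6dd0218f1f48306df1981ede226da1f020b1df18894df0273b8b00c1cef002a9fb0ccf05f040975f042da7b50b165f073617b0a5778d0788dbe0449ded0210f6f0a28ebd07085fe029371f0028cdf43c09fe8308fbe0010d7f001977d061ca6f441935f1049df3022adf3169e52712e34d70c72f4b1110f6f281a4ef094c8df029653f001b3de08c2cef0311b5f1928ede04095fb042e95f226b4f50d086ef0728fad0c8c47f145e567048b4f704c34ef031473f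
    0x10a23806f (by decide +kernel)

theorem surveyed_49 : Surveyed 0xcce3b34c848047b9 0xdb76ae0284d82ea9 2485896 59 0 :=
  .of_survey 100 0x41e96f048d63f228b8fe0019eeb0249dde29088ff0219dfc306ccaf0848cdf152ca6f0c48d7751185fe0210dfb0a6e95d2960cfb0fc2f560249f970208cdf12e1cde0b29add061975d2318f3e55a1aeb0dc447f1c59dc9426c9bb50695dd062e7b38049ddd40515fb0320dfd0c4e5ed0d085fb10115df232a9bb800379f000379f064cfae066d8de09125fb0234d7b061f77407299f90094c7f2010d7f401c0ff021965f841bb6b0b51acf048d87f063465f8241ddb123bb8b50744ef139507f0818cfb0e5ccea1120eef18ae49f048b6af8244cef42760ef186ccde0020edf202acfe15105ef446c4fe8231ff82019e7e081d69f204adaf252a71f0264f1f06e2d571029df91984cfe246b59b25090ff00ae8fe50aa59f0510f6f0254daf30194ef256255f048b71f0671dda0a3ce7502364efa31169f0b90cfe0764b5e001ab6f8832f5b423979d4060fdec908adf0209eeb0d18dfa824d9bb0c5cd6d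
    0x0 (by decide +kernel)

theorem surveyed_50 : Surveyed 0xdb76ae0284d82ea9 0xeda2e9a6116c5969 2321760 60 0 :=
  .of_survey 100 0x5116ef189f05f0c18d7b181cfab0e3aecac0361fb458873f082e8df221c87f0b089fb0908dfd1818cfe0844cdf101c7afa081e3f84c355f1a5d4cd0828cdf0429df9271b31e0020cff0fc66a7041167f0a54fab41021ff42745bb0d1a78f244cf2f03115fd06537e3513075f3069e570c39ee914a655f040c4ff0a4c8df302cdbb001b35f639523f445976d188d8fb12ccd37246b4de068d6be1289fb302370df0008d7f01362ef05244ff13199de0a50ecf60185bf44c98ef021f0ef02130ff02116bf41401ff0018f7784c34ef01007bfc0197bb0a8c4bf10c1d5f2118eaf06937ab004a5f740316fb0428fbb222dabb0ac4eaf42e44bf25296bb020c8ff02197fc47c32e744a8dbb0464cef062baf3228adbe06196de25294fd064c4f7075496f11001ff00021ff061e16f6468d5b0308faf062a71f23195bd081ccfe2049eafc0a60ff0239df818a0cdf069f31e0a8b9f9820c5bf065b7870219eee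
    0x3882068003208a00bc0000062081a0010623002f (by decide +kernel)

theorem surveyed_51 : Surveyed 0xeda2e9a6116c5969 0x102d1374bfd4b71f1 2488920 57 0 :=
  .of_survey 100 0x42327de44b167b0d48ee70d9447f45286f70024efe0c5af470019df90a51ef3062e64f502c6f7821f0fe066cd7392577870428efe408b0ff074c9770909adf002aecf020a5bf201ab6f203647f503e15f06e1e57263af0b02533cf02814ff069567e2031e7b82c1dbb428897f4018f770a3aee5601cf3e63888bf03131df230965f0ad585f0a51ede431c33f0619a6fa942ded0088f3f201b71f0449f570075aeb12ad4bd010c4ff42aca3f0a1f1f90e5fb8a2239e7502a2cf7024cd770b409df4718b6ba100cff0892cef0029adf130d1fd84c547f1180d7f24aae2f033735dc02a9fb2049e770a51fda0820edf02418ff8210cdf0c4f1db070879f203aceb8220f5f8a2aecd0e3aee130364ef021c47f841e5770030f5f0618f5e02c45bf030a5f70831edbc4296db8849df988364fb0c2eaeb881f2de084c9fb820a9ef2018d3f201947f82216df3565a4f2239e9e489a677042a79f50e0d5f00644ff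
    0x63906500825 (by decide +kernel)

theorem surveyed_52 : Surveyed 0x102d1374bfd4b71f1 0x11496af4fa9737669 2427936 52 0 :=
  .of_survey 100 0xa5ccee8208cdf263e6764468ee7203467f0540def4288fbe8851ddb078957d0249df3025d5fce1260ff404d0ff0218d6f061b775042a5fd0661eed02361fb0e3ef709180d7f03225df062ea77c3092df0aa2df90a74e4f0b1c97d184cf8f02115bf43085fb25084ff210b0ff0a28edd0c1e57d861f77429194fd15296d70818fbb81005ff529f0f601005ff850b35f2263acf0c8aeee025179f59884df03216df1259de5061957d01197fc103cceb0a1baed0228fbd1034d5f02197bb603b25f141b9eb0a4c8bf8209eeb00195fd829357d0a6b6d5041b1fb8234eaf072979b40316df1251dde022aee703115fb0230fbb042e55f204d87f12b1e8f238b0bf8081fbb0a54cfe064b9de1860cdfa029e7d0260fde0840ddf401979f0a48cf70a30e5f022aaf71253fc641c1aef084add7281af5e8004f3f0004f3f00c14ff87856be03001ff00005ff241bb6b8820edf14a64ef2239eb3042adeb283ce3b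
    0x0 (by decide +kernel)

theorem surveyed_53 : Surveyed 0x11496af4fa9737669 0x12b15e54784fa8851 2475480 63 0 :=
  .of_survey 100 0xc2d6f90a55a5f0a34cfe1029adf00087bf1ab569b323f15d822b5dd06ad4bd840c4ff881aeee000af77084ccef068f0fe042b2df0a5b9cb42b1a5f031175f42362ef0c1e97b42b0d7b00515df1029ddd0840cff101979f028cd3f041d65f061b79e225d877071127f0b1c97bc008bfe423b2d70c5cd6b06acc7e0819df9405eb670a2a8df14364ef0018dfe0a18cfea10a5bfc01b35f065cf270219ede82358fb40195fd0218fbe0a49ef51039dd90848dfd325d7171008d7f06195f9142ce7785216df2140d7f061e73702d55bb9041dcf1818ecf0419f6b026e9de59361db2088f3f8210f3f21007bf890ca7f183cced1491f6b0a544bf446c6af443a78f061b9fa065da6720499fb003e7b3044a9ef0a49f9d0c5565f2c6adda021e59f9984cfe1041dcf1819fda07105fb063379b0ca665f1239ddc078b31f123da73228da3f229b8af8229ede302cd7d802e4df07411df0008bfe0219dfa04297f9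
    0x390a2005e000ca22002f (by decide +kernel)

theorem surveyed_54 : Surveyed 0x12b15e54784fa8851 0x142a5334fb8dc87a1 2306080 56 1 :=
  .of_survey 100 0x6644df2018c7f8309aef0664eaf5049bcf42c98ef2218e6f03362efc029adf4428fbba81b79b248b71f601ab6f022aed71439de902529ef1091cef165d765062f29f42744ef1019dde1b8c6b7007565f0829adf062af73e018cfe44d0d6f0408d7f603a677041b35f0231aef0918df90071eeb612a0ff02096df18acc9f289b49f141b7570618f6b070cb7e125559f2031e5f0d88d7b800bb5f0820cff081f0df04499fb800e7b70008cff1239f4d03646f7044d4ef48d14df0213fec44897bb26735e93064d5f41107fe0a9cd3b061d6be0a9e4af0208dfb23325bb0230cdf132c59f0c5d55b40087bf0084f3f181c47f9981ede0c5d64f0180cff8009efe001a5f7003af5e07117bb26ae4be0fc1eec02495fd0629fb90908dfb000bb5f02098ff418e1bf502caef062e8fe26e54bb0c4bacf0489e6f0636677848b59f4290f7e04327eb0a18eaf041b74f421a1ef0639f690b296dd1219ef60108bfe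
    0xc3081ab090a61881f (by decide +kernel)

theorem surveyed_55 : Surveyed 0x142a5334fb8dc87a1 0x15a45b282bca84489 2458428 66 0 :=
  .of_survey 100 0x71d26f1851ddb0fc4677c018f77149cd2fc0405ff0618cde04195fe0275aeb03197fc441b1fb2b8aa7700196ef862f9f8291275f0309adf0a4b9db041c73f021ab6f0849adf9261fcd28c34df241ad7e884ccf7042ccfb8264d9f023e64f607cf2d124b9d701087bf526c5f5066b755048b0ff42725cf11115df8840cff062c4fb1251f8f30c1cef062e677050077f4828ff9169f26760616df0639f5a249d43f0e3eb5a026bbcd14e1ccf190c79f488a6f7c0087bf3128d9f0649dfc0a344bf124d9f32310f7e49505df0251ddb0a6d4dd83115fd02c1cef400a1ff074a5e700195fb0018f6f020dbbb211cf3e26cb59ea941eed346d4de8845ede072c6af181b5dd1451deb024c9bf0654f2f2251cfe070a7b7c1441ffc088f3f0f5535b02ccf3710199fb03c1fb32b1a5fc0230faf0a368fb1918dde8231eeb1251ded0a53acf0260eef023af4b0008b7f101b5d78004d7f0004d7f0618f2f864f38f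
    0x1c831002f (by decide +kernel)

theorem surveyed_56 : Surveyed 0x15a45b282bca84489 0x1722c1ccf962b4631 2420880 58 0 :=
  .of_survey 100 0x325cf2786c6577709a577184ccf74430f7b21197bb191475f061b7ab626bb93b1096f70228cdf8219dfa049f17bb031eeb000da7f012b2df205b78f244b59f0a51eed07c155f063e4ed02a28ff020c3bf023e5fc820dbbb862e7b31261ed7190d2df0c364ef1cb664f0330ffa86a4f3b1b89aed0c34d7b100d9fb9031ddb06c2daf10344ff40195fb085cdfa4018f6f103cf6d009ad7e001d0ff1ccade3181d69f021777560994bf061b15f07085bf062adf6508c5bf02165fe0b1279f068b8fe0048def0218faf8249df3041e17f2288c7f0864cdf0a5569f06e70de2249dbd5018faf040e77702545bf0a91ebb19844ff0218f7e0818efe4ab0f7906c696f33195fc8001dfb0001dfb061b77334e1ceb1b1a7d643489f70a4c4df821167f8819df90c3665f41087bf82099bf1048df7143cd6b0d8c47f042c6bf225b557003e677048b4df38c9d9b0231edb0ece6a742525f719e1ecd484d2df0808edf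
    0x0 (by decide +kernel)

theorem surveyed_57 : Surveyed 0x1722c1ccf962b4631 0x18e5105876c8e4ce9 2431800 59 0 :=
  .of_survey 100 0x3271ced208b4bf0039efac1087bf0a1c87f821777502113fb0211efe209b4fe062f0fb0a1ce7e1120ddf42361fb022a9f702319fb1a5dae3139155f030c3bf10296df02316df0044d7f820c4ff862f1f90469edea264cfe2839e5b283ae4f1c9cf2b0c2e8ef0a54f1f40894ff024c5bf0664f5e181ccfe422a79f0c18d6f53887b70fc2ee6863735b0674ceb0a5ccde82a4c7f8012f6f0219b5f4219bbb861eb6e0c8ae7782137de01361fb325d6a7a4a647f50c0def011077f8208f5f48525dfe02a79f251a56f1318f67402c4ff40089ff9984f1f0289a7f0011f7b0a32df907a0cfe1910dfbb064cef0220cff00d1d7b1269dd30a1af6d5030eef2d48dfa8665aeb128e5b750899fb02cda770209ffc4028eef43a04ff5019b5f401d0ff800cf3f02e4f1f0228f9f130a9f70d08fbb230b39f0888ebf021b35f089e97b03a60ff2918d7b00089ff061f31f861f3ab0a50ff31819ede08c1cdf0a54eaf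
    0x0 (by decide +kernel)

theorem surveyed_58 : Surveyed 0x18e5105876c8e4ce9 0x1acba4ebdd0c1b999 2575440 59 0 :=
  .of_survey 100 0x40085ff0fc60ef021d65f1c5d65704195fb062abde6438f7a085b7cd0e5daab141b5ebc018dfe064adee244d4bf243647f0041dfb949566f129f5ad165d59e03113fb0216b6f243aceb0f552eb091a7f30210b7f0208d7f0c364fb43192ef8a51ef30418f6f4850f5f001bfec100e5f70230dfb82269fb0c49f5b061d57d02a24ff06ae49f1789aee0184f3f029197f0c1e5bb089baeb0528fbb92c1ee72251f1f081b2df021379f023bb5d214a5f78c4d79b00085ff103e5de109e5af0a54d7b066ccde102a5df183aec7820e7b79009fde08c9f5d8a51edec1652df0219df98c1eb6b1028f5f040b5fd061b3ed0471eeb32770cf02195fd07216fd21087bf061d73b0661df92231ebb0c49df907206df15099fb00196bf061957b451876f861b7ad289b45f20c1c7f27325fa51289df00b647fc0089ff2918f1f1a71ecd0271ef30c4af4f8044d7f042a75f122cdbb882e4df1464d5f0b0a6f7445175f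
    0x0 (by decide +kernel)

theorem surveyed_59 : Surveyed 0x1acba4ebdd0c1b999 0x1ce03842b6987f589 2310280 65 0 :=
  .of_survey 100 0xa92d7d0a4cf1fa9125fb0444f6f2189a7f1659f65078bb6d4dc06ef4218f7e2818c7f020b79f132afd6c0195fb0a32ee702898ff01089ffc0e4f1fa23671f02121ff8012def4308bfe0a19ef344325fb143cceb8001edf0001edf0428eef900e5f7502c8ff265b59e8c32eeb0018f5f0588f7e1081eef861b79e285ace70cc0f5f0c4d8ef124cd7743807bf18934df5050def2311a7fe01c73f10765cf09926ef229d43f04296df0060cff0722aef07a697b070e1bf221bb1f822aed78000ffe0000ffe801bfec0011eef9819eed0518f7e221f0bf0c4c5fd202a8ff0209efe2acf09f038bbb3949656f1261ddb30ef857b110f6f42196fe8184f3fa30cb3f0c4cd7b064955f5058de710e1ddb08c0cff0a3665f20196bf8211efe0218dfe42396dd44616df13419df8c2e79b054e1ef4419b6f1088d7f8041dfb1671dda0f18f7c0b88e9f061b5f312a2d9fa09347f62d197b1819df302087bf052a79f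
    0x0 (by decide +kernel)

theorem surveyed_60 : Surveyed 0x1ce03842b6987f589 0x1ec5b0cf76543d9c9 2464248 58 0 :=
  .of_survey 100 0x9851ddb2251e6f1b1a79703087bf023e5bd351976d0118f77002e79f01085ff13150ff0e5d64b2060cff8243bcf840baef4328ffc063567b0e5d5f8062b75d0619bfa0d1175f12b6cee0264cdf848567f8c1b5f900196df0a3aecd0793b6b06364ef0629ede8c8cf3b8011dfb061969f022e4df22554bf04894ff0210cff049b677165b7870160f5f3059d4f23130ff021c97f864e9af0634d7b1908dfb02d1dbb0e3aeec023ea77c0085ff0689f3b4231aefc0196efc018f6f41105ff025b5f33019f1f2018f3fb180d7f0118dfe81061ff0629dfc2b32a5fa28b9bb323b8f3020b9fd0488d7f861d6be08a0cff0100ffe1894c7f0310b7f0011dfb049b6af4349bde03096df86c715f8633aeb025d9bb00195bf4850eef203aeee06c587f00e70df05093fb1418cef4a38efc0288dbfd090f6f0018cdf061bb4f009d63f02914ff1288fb7a29371f0c61ddb205af678a2af9d049ad7e43c179f132bbd3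
    0x8511c60304a000ce22002f (by decide +kernel)

theorem surveyed_61 : Surveyed 0x1ec5b0cf76543d9c9 0x213129a4fc238d931 2270520 60 0 :=
  .of_survey 100 0xe01b35f334c5b70dc64ef221b4f78000f7f0000f7fc1061ff0d0c67f0a362df14317db2a5adb316e4caf023bb9b281ce3f222a79f000cd7f0e3e64b42195fd8049fde26b34bb2b50cfe062d4fd06332ef0818dfb0818cdf021f7758208d7f0241f9f343e477101ccef861b775623b39b0272ee7c1089ff02111ff0a4caf7005cd772309abf84135fb9234eaf0421efb03361fb0ac2d5f1049dcf2673b4b23536e7523c5bd45093fb105b7c70389bbb4100ffe17625d706d1f73078b77523116bf820af771081dfb0a50fed69c0cfe20195bfc28b39f0aa4cbf02d395f03107bf289f47d4239adb0130dfb2910e7f0208b7f0274d7b870ab77e028efe129ddba16ab6970a2adf9020dabf079567e0272f4f02170ff9081eef0720efe081aecf02156bf0439efa821379f1f9d6b2842aecf0a30efe9310dfe07816bf025f0f7386ccde061f0fe07c14df221b5bb1249df30a1bacf001967f070c73f02e1e9f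
    0x445380cf (by decide +kernel)

theorem surveyed_62 : Surveyed 0x213129a4fc238d931 0x23a15dbc0a1238799 2314200 61 0 :=
  .of_survey 100 0x1025ff0649dde607cf1e0662bcf23c54bf04085ff0c30f7b446cdfa18545df0422eef103ccfe023775d0009dfb08196df230a5bf143f7530265ede45207fb03171fb058b35f9834cfb06a1f1f06a2e6f17299f9285de5e021d0ff39c14df471c37e0c5cf6d0c4ccef0a8b8df0918f7d303df1b0d8af731ace597c30c3bf061b3af265ad760b1467f002e9fb9009ef70a364df53511df11089ff509d97b20e34df6468cfe14a1d5f820dabf0208cff601b0ff8021edf083aede023ce7e0e9e93b020f0ff0a18cfb2b3269f221b71f188b4df0619f5e181cf1f0a332df800cd7f206cf1f0a1ceaf8a31ede9081dfb009d87f0024cff043167f06d55bb041375f0a3f6dc103ddf80639df81580d7f05644ff0818eef1c764cf0908edf058a5bf8c2e4fd0f4ab8f0a30cdf5028eef201967f2540d7f0c2ccfb023e677080e8ff050a1ff221ad773049cef030bbf313216df820bb5f2290f3f072eb5e211d27f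
    0x0 (by decide +kernel)

theorem surveyed_63 : Surveyed 0x23a15dbc0a1238799 0x262fc09121176c2c9 2369220 67 0 :=
  .of_survey 100 0x403a7f32340d7f02135fb227759b4b48b9f403e2ef061c4bf4c5c677025adee066d9f90c516ef4dc05fbc1085ff02195fb02296df02ce5b7246adde106add7244a5f73299e371f9d674086ce9f1429ddb0d656db066bfe103405ff82170ff800c7bf0950eef0ac0dfd4228dfd198ccfe82156bf149de6e0421eef069f17d8222f9f27296bd820bb9f02ab69f0a2ccfd249f47e2349fb302499bf808bb5f061e96f11085ff95216df2b5295f0d4e6e70674eee1130eef0a48cdf0c5f6e3065555f061f15f06197bb070e17f4229adf8009dfb0008ffe47193bb1391dfa074cbaf166cd734c3a79b121b9cf1071ddb18a2cdf1ebef2100c1eef0848ddf0618cfe248b4bf221adaf008f0ff6072f4f4d48b5f0c8acef5868ddd0d099fb69c04ff0a2e8df5119beb1419deb025d97b351b0ef22778eb1864cdf0049ff38081e7f083e69f2b4a99f1059ded423497f10195bf0a499fd442a5fb210b5fd4918ffa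
    0x62900d (by decide +kernel)

theorem surveyed_64 : Surveyed 0x262fc09121176c2c9 0x28f0b8fd1943b1991 2348640 57 0 :=
  .of_survey 100 0x223acebc088cff409d27f0d2e6edd1805ff1639f690b116df078c47f383aceb008e5bf12ad8fd229cc3f6060cff451077f041967f0209f9f400e1ffa0834ff8441dfb143cfab226cdbd2b2aa9f022a5df08d4c7f042aff30619dfa0844cff0039eeb830e7b70e3cf3943112ff4088b7f0b10eef062a79f071b3ed18325df0841edf0e3e66d0acaf970360f9f1818fde1699d760cc9ede404d9fb0331aef820e5bf14cd95f8c8b8fb0239f9e123eb8f0292dfe1330fed066d79d001477f0028cff0c5fb4b0c9e6af8009bfb30196ef1274dde830f39f078965f475135f00656df0c5cdfa2940cff05499fb04137eb02196ef6030d7f19a4cfb100cd7f08cad9f589a95f038b0ff1c3ce6b03111ff0c9e57d14a1cef0d08dfb07099fb041e7770300ffe06ce9770c49ecf2b5487f0918dfe06535cf43087bf02b687f02e70df808da7f051e17f06ae8fe0a5aec710d1cef0009bfb8814e7f0211dfe022a8ff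
    0x0 (by decide +kernel)

theorem surveyed_65 : Surveyed 0x28f0b8fd1943b1991 0x2be26d47104930eb9 2362080 72 0 :=
  .of_survey 100 0x41f1fb383acde02085ff8900ffb14195fb0a9cc7b0a48dfd87816bf066daf302195bfa04bded8a51df90c3cefa0318dfe1418f6f0a1f0df0010f7f0c5ceee23099bf01a0cff166d6578a570df83171fb0629df90677b4b03089ff040adef8a51eed0a5b9f32b48cfe4098f7e10195df8314f7e001b79f861f177149d57dc00e1ff34e1c5f2018d7f2249cf7069e97e1819ddb40366ef383ae4f231c47fc008ffec018dfb0f8a9bb0218f3f064b5d70a18ffa247565f401477f1d644df18a0edf07c1aef1ebed70142adcf1a9e4770209dfd8841edf0821edf085cd77223b79d0e5b78b1d8965f021375f62d0d3f5074f4f8421dfb061a777074c9fe8208cff0218dfd1380d7f06a16fb862e67725094ff4049ff3288acbf0754b6f1c71ecb0a3eb9ba51167f0a2e2df001b6f706c9fb3063b7f10a4add70e3cf2d05085ff8a1b6de234bb8f050cf7e241b55f005d55f044d5fd861bb6b065cf76003e4ef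
    0x0 (by decide +kernel)

theorem surveyed_66 : Surveyed 0x2be26d47104930eb9 0x2f069fc973921e119 2422080 58 0 :=
  .of_survey 100 0x365fb103cd7b203b69f3318f2f0f5515f1148def063e9fa0a5d6f5861f0fe0210ffe24e2cef201f4fe0300fbf0c28efb8a8b69f24d34ef0a5bbcd0ece5b31274f570259ded0254faf007deec2439efa0a4a9df820adf70039df98236f730274cef206b8df861f31f8108ffe80116ff840d67f8b40dfd105b5cf12a0dbf1039eeb0019efe143e6e78009edf8a31df92275a5f0618f1f06196fe820d9bf245cf2f0211dfb1819ecf22b38fb0428edf03499fb0c1a75f0ecadab005cd6f0c9baeb045575f842bfda0ece4770a74eed0f18f7a9249df3042eaef12319fb22c1c7f409567f52c8daf021e7af02365fd0719bfa0009aff181ccef06af0fd02ae4bf880adfb8000dff0000dff041b7de383ce1f8a54eaf203b8fb0618d6f041bbeb0d4c5fd002af9f0b1cafe40187bf8844cff871473f0009edf2518f7e010c7bf44cb5f3062e1fb05325ef48cf0df463e1fa129e9af2251cef3839e5b8424d7f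
    0x0 (by decide +kernel)

theorem surveyed_67 : Surveyed 0x2f069fc973921e119 0x329dc6bbf02196ae1 2446416 65 0 :=
  .of_survey 100 0xa5ff063b79ec02e5fd004d8ff0708bfe189cd7d0439f5bc00a9ff023e4f71248df723930ff125db57841b7ed066cfab0b30ff90c48dfb6468e6f149d71fa49347f0a18f770c18f6fc25d5fc2b544bf643a6771160ddf9289f1f449b75e1860ddf271d23f01825ff24ae4bf0029efd0218f5f229f0bf0629eeb0219ffc0218cdf80365fb04097fd8019efe049567f0a2aadf0c756db1818eef8241dfb0618f7e4828edf081e5fd30298ff8251fde074b3d70209bfd305cd772b524ef884ddf913c1df38041ddf181c97fe060cff309b8ef2289e3f0041ddf4c6d0df1351bcf13a0f9f031979f2818f3f4108ffe081eb5f61325fb0049dfd02372df04ae47f603aeee0491f7b0a9e6770482d7f1251de78209dfd1918fed185cdf3070b1df23516f71328ff5129f0f7281b4df0e3aeea0859df9201afaf02a2dfd351d07f8465eeb0c2c6bf048b79f0239ef30729bf902356fd043e66f31c1cef0848cff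
    0x0 (by decide +kernel)

theorem surveyed_68 : Surveyed 0x329dc6bbf02196ae1 0x36173facf89dd4389 2562840 61 0 :=
  .of_survey 100 0x6858cfe4a5e0ef085aee70f29adbe12a79f401a1ff042bb5f289aeaf0061edf40d14ff0822edf024bbcf044e5f7065f34f0d4e1df821e9fe021967f081cefe0b10bfb0040dff0c195fb0689a7f06a30ff06e2d77223af5e18cadd71b18dde20125ff0b50fed6018d7f8a2ccfda331efa0c74d7b0619eed303ccfe227659f3139df80294f3f4c3c67b0b30fbb2948f9fc3112ff3039ede0288cff05495df05296dfa1136ef069f31f802adfd0109bfb303bacf0c196ef8214d7f1239fad021b7de8008f7f06aafab042b9fb03085ff084e9df11196ef2c3b4db0224cff12cddb343105ff4239ff8223e97d258a97f02161ff0265adf165cd6e061f775021f1fb13317dd4848ddf683a65fc28a5bf0d4a7d7062af4f82838ff414c1ff252a6f78032eef031c97f061d57b225afa70420ffb065b7a7001d6bf0854dfb11a0cff3074d5f0208ffe02c4dbf8a4cf1f848af770c5d57d041957f1bd1ee30c6b9db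
    0x0 (by decide +kernel)

theorem surveyed_69 : Surveyed 0x36173facf89dd4389 0x3a1f77eecdc8282b1 2416680 68 0 :=
  .of_survey 100 0x108fbf0e3e95b046d4df356b5d302117bf4b306df1094d7f1699d6d074cb7720364ff87a70fb8409bfb4020eff0a18dfe0ae2ecf0e3aece069257f868b95f84a2f5f07096ef84537cf084cef71249dd722cb4f707087fe081bbdb1d8c47f0428cff821f39fa26bed63029cdf0261ef70cab69f25c14ff108adf70a3cebe0fc1df8143d6ed848bb5f4109bfb1b9165f821b7f512765cf1818f5f3129adf0a8cc7f2049dfd18ae8dfc10c7bf232a79f0310ffe0209eef0064cff020e1ff8061edf07a60ff18b4e5f0239dfc2b4c4bf845575f001cf3fc34c7b7848b6f702366ef242a4ff8822edf06af0fb423c7bd129d677181a5df0e3b6cd023bb8f63e487f07095fb0b925fd0a1c6bf4218f6f123f2cf081b79f1c74d4f1388faf30d1cef0f4c5b70432f6f8211dfb066b5f58109bfb801d6bfc3362ef0d50f6f12b58fb12344ff061e56f1181dfb125bbc7043775b8420ffb069f0fe2009e7f26ad83f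
    0x0 (by decide +kernel)

theorem surveyed_70 : Surveyed 0x3a1f77eecdc8282b1 0x3e9f24e17ca16ddb1 2414580 66 0 :=
  .of_survey 100 0x92d7f0618f772059d7b13197b74299bbb10a1edfc3111ff126d6d716c9d5731195fd0308ffe021b79f0819ff90671eeb145d5770309bfd189adaf004cd7f8262fd7269b477061bfec0c894ff06a9ebe0a768ef9181dfb8300f7f42aa9fd2c5cc6f0e39eda31089ff6238e772859df90cc9f1f0851dfb066f0f70832eefa01b79f13315fd406c8ff1888cff0e39ef8021b9fe880ccff0a1aed702c1dfd0208fbf0a5e5f340191ff82829ff021baef0669ef3603a79f312a9df0a6cdf9009cc7f211b0ff821d7bb1239fb30a39efca551f6b9100dff2318f7e062faed0209dfb04225ff1239fe90f550ef26ae43f1459dee13915fd82356fd0280f7f22e38df02c35df8003fde0003fde021b6f70231fbb9055debc08e5bf0019f772218f3f0219ffa049375f0a55ede0020dff1289cef1918fde0a5bb8f0ba0efd0314b7f8064cff0619ede0b197bd0693fab02df6a7002b6df6058f772919afb8219ffc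
    0x0 (by decide +kernel)

theorem surveyed_71 : Surveyed 0x3e9f24e17ca16ddb1 0x42e2226945ea8dd79 2228520 63 0 :=
  .of_survey 100 0x8808fbf0239df91031f5f0839edb0031dfb303e4ef063af5e8209eef8a1b6d742b32df0509bfbb1c1cef8241df726f745e0018cff072a79f04096ff0008dff062bbf307631df02535df07441ff0862ddf8819fbb2310cff0228cff271b7ad003ef730209bbf042cf3f4239bf91e7dee0804cd7f0a56f57441cf7e45187fe183ccfe0211edf084cdbf1239ede121d0ff205d4bf05825ff0b1e35f001b75f221fb1f007bfcc305d55f0b197f944e16df3039eeb24ae47f1b3cf5c0219efe0210f7fc5297f9185afc7336d697c2199fb822e5fda034e7f208b8ff07c0f6f0209aff14e1d5f08c1edf072b3db0849ef714ab5db8209bfb141ccef03a0cff022af9f0728fbb0bc1df91c71dcb50a8dfd022e9bf0764b5f848b79f0c9da7b06735db0619eeb062c5bf8a2aed703019ff081f2df061e17f0520ffb143af67103d59f878f31f59597cd904ddf30cc9df93960cdf23346bf908d8ff0840fdf703c47f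
    0x0 (by decide +kernel)

theorem surveyed_72 : Surveyed 0x42e2226945ea8dd79 0x48239842b98cde3e1 2409120 71 0 :=
  .of_survey 100 0x88c2ddf1428def8892f5f123af8f601d6bf0300dff041af6f081f0ff0d4a7cf0629adf07212ff0232eef8031dfb0a18dfd42b1afb483e2df305d4ef229d63f066d8fb45887bf025d55f0a48f5f5390faf861e96f6098f3f06ab4fd42e44ff023af4f48599fb26cf8af8209dfb2313b5f48725df06a9e7d07c0dfe19197db022adfd0a5e5b70663fcd4310ffe191979f063e677183aee70a4df9d0864cff501d9fb178b5f5801b75f02c1dfba019efe0108f7f448b6f748a8efd03195fb0889efb10099ff84225ff16d1d4f1248def485a7d706d656f1318faf1034d7f70f1ceb851477f062faeb089cc7f062ab3fa04d8ff821f1fb2272d77427479f0918f5f1a39dd90a5ccfe0cae4fb50885ff0832fdb03161ff0a5adf31249dcf0a55ef38008dff0b90f3f47191fb131b1f70a2c8ff0b60fdb0249dfd60596f70a18f9f8208fbf042d6fba94af57396d4dd2360f9f044d5fb0673bcb0636dfa0908ffd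
    0x0 (by decide +kernel)

theorem surveyed_73 : Surveyed 0x48239842b98cde3e1 0x4d7ac04f044e81739 2402008 69 0 :=
  .of_survey 100 0x2b55a5f0bc0dfb0818cff0a4ccdf449b35f800f9fb0a6aed76568f5e01c1eef0d2a6df025cd6f06ab69f43887bf882aef7063b75d169f7171049fcf0e3f79943342ff4a9dabb041d67f0c59f5b2d5655f46d2dee079317f0019bfb1528dfb062db7d0c2e79f0c9d63f0b19afb4218b7f303f0df062c67f509a5f7000bfde8249fb7c1003ff41003ff01003ff00003ff1839df9030e1ff0748dfe31195fb602badf0910f7f0c9d67b1b91ede1328f9f2231f7d60744ff0c3aeeb201b75f225b5b7229b71f291b2df6518f7e19898ff42c9aef0449f5f0a18cdf0c55eeb403e0ff123cd7d02364ff226b99f8261dfd0c6aecf163ef8e8910ffb03445ff009bfab213af5e0d3467f323de9e0449eef3439e4f065e5af465b1cf31196ef1271ddb4218dfb41485ff0209edf820a9ff1b5afc6021da7f451c37f0252def466cfad065d97b0818edf110c9ff066ccfe022e8ff3918d5f068cc7f0120eff42ca5f7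
    0x0 (by decide +kernel)

theorem surveyed_74 : Surveyed 0x4d7ac04f044e81739 0x52a51319f624687b1 2382660 70 0 :=
  .of_survey 100 0x46ef8f0c3e65f0618f6f12b1cfbc3361fb0669df90c2eef3471935f861bfec881f2df0760dfe06e70df0264cff0f2cfb9216ccfe40346ff02099ff014d9fb821afaf0a5b5dd020a5ff278f0bfc275aeb065f0ef0449dfb046dede2948dbf129ad774090f7f02f78eb2218dbf4719bfa1319b5f051b7f3028b8ff041b75f0019dfb5068df70789a7f050b1ff062c8ff2ad6c776471eeb4858dfe03e70df821af77050c77f401c7bf061f0df351b9eb54cb9cfb029cdfc008dff06a379f0618dfe8a6bfd10864edf0629a7f223acfe065adee021f0ff8211edf146ccef0520f7f861f7750c9ad7b061b33f425cb6f0261edf0029edf0a372df0018ffe231379f1b94cfe1239ef342489ff182cef7383ee57061f3770ad1e5f0781efe001adef0eabedc0acad9f1319aef623b79d0639ff8044cd7f8840dff481f2df0ac5e9f2676e671008dff1031dfb2b32ede1318f77242b9fb349bdab4294f3f002abdf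
    0x0 (by decide +kernel)

theorem surveyed_75 : Surveyed 0x52a51319f624687b1 0x59bdd4285d023e879 2596440 75 0 :=
  .of_survey 100 0x43c05ffc02abdf3111dfb0c5d55f623eaaf42d197f004c5ff0b1ca7f045f7578808eff001b3df0309bbf12c9db7101b5df07516ef061975f048ad7f868f6b70029aff421bbeb030a9ff071c73f043eeee2acbcf52219f7d1c3d6f3129d87f0819efb0a59df30508f7f225ad770e5d7b30e5cd6b241b5fe2a5bf8d90c1ddf0a55eed8019dfb352b5dd061b17f645b5ed224ddbb2928ebf152c4ff061db7e489a5fb4380fbf8049df78209edf3039df92918f3f583dadb941f757310b9df0ccb4df0220dff0518f5f49507df60a8e7f425a5f70a1b7f50231eef181cfaf02934ff06371fb103cd5f81366ef4b362df182dadf1a75ecd4270f5f06195fb27658fb3519dfa0639f6d27335f98509bfb243b677103ccef271bbab0940fdf4018ffe061b7ed0e5deec131a5f71d1d6de1455deb8a55ede4308ffe14a1f5f2b5695f4360bdf022b9df822af9f063e71f9019feb0ad2d5f0120dff683cebb2d5565f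
    0x0 (by decide +kernel)

theorem surveyed_76 : Surveyed 0x59bdd4285d023e879 0x5fcd88af3155977a1 2302020 70 0 :=
  .of_survey 100 0x3339df81984cff1c6cded49187fb0a4bfd5021779f022abf70664cdf003afdea315a7f061bbeb68cccbf40c0dff079b7ad070877f281adfe42c1eefa313b5f0213fde4028ffb2228cff0aab8df0231dfb0c565ef038dabf824d8ff950cf779289cef0210dff8c1eeee40197bf2293f1fc310ffe80065ff00065ff438a1ff053675f2b5659f12939ef70b2cef0a970ff0229bfd1019dfb0e3e4eb026dede5390f77401b3df145d4ef0a62fd7423e1fb183ccfbc090f7f2459e6f0529ff91981edf03356fd0049ddfc454f6f2836cfb52d58ef061a5ef1a3def1a049dfb08c1cff0629ffc841b5fb0d195fb0d085ff8a1edfc882e6df1049df708ded731caeced06ae4bf38df84f121d79f084ccff0229dfd4b4cb9fa140dff0a49ff519a0cff1ccbec7101cd7f868fb1f2a6ed9d1839edb06c1f770e5d55b0e5ccde1291dfe84a2d7f0291e7f3929edd225b59f0b18f770a92f7706296df102addf9034d7f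
    0x0 (by decide +kernel)

theorem surveyed_77 : Surveyed 0x5fcd88af3155977a1 0x6793ff3ccc0ee6d39 2378880 71 0 :=
  .of_survey 100 0x271f31f17a4cfe00ae8ff163f38f02c1cff8261edf021c7bf063675f43117fb1239df9c060fdf07e1eed082aedf0c535fb8c36eeb020bfde046f5dd8213fde242cf3f81007ff0ee2df301007ff990afd70ecfa4f0e5cf7620197bf0818ffe03365fd4299a7fc018ffe166d9f31928edf3039f1f0a1cf7d1c5d9eb121d9fb1d197f3b109f9f42745bf00499ff024cd7f221bb5f0a50cff18a1edf229b87f1251dfe049f71f2832eef066f0df084c9ff443a75f8509b7f44285ff87856bf03003ff00007ff9031dfb1a74ee70b344ff074d0ff841d67f0c5cd6f30335df8252def1d4cf8fe01b79f051e5fe272eb1f003eaef0850fef026ccdf821e97f042cd7f123aee70819dfb17a2f571233bcf502ceef0e5bfcc2819efe005cf770c3e4ef121cdfe423d2bf8c55eeb123f0df4b286df0ecf8eb4898f3f0a5379f2239ebb2039e5f0b28dfd05a2dfb3439fab041d57f33194ef1089dbf0219f7b46abb9b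
    0x0 (by decide +kernel)

theorem surveyed_78 : Surveyed 0x6793ff3ccc0ee6d39 0x700f26c6a38646931 2333520 70 0 :=
  .of_survey 100 0xc4e5f7006afd7848b4ff3099d3f069657f0308f7f0cdf68f1819efe0fa2ef3c0197fb11954ff0234cff062b9fb03c4d7f1239dde1330def683aede06195bf0018f7f4318b7f4099f7d0e5b79e00d1dfb0219dfd0118ffe081b3df0a3ceaf04197fb02327df4a99efa0eadabb981ddf92a71eed848ad7f0bc0cff50595df085df9b821779f60595bf0419f5f2439e7b5838fed8819efb0d097fd8264cff021cb7fc320ffd821cf3f0e76f8b22a2dbf2232f5f222e8ff409adfe4acce778940dff4b88fbb1b90cdf8013feb0632feb2061cff1ab1df90908eff2249f9fa30af77646f0df6859df9c449ff30218ffe0045dfb061b7de47c31df594c9df075cf7640325ff021b75fc3085ff2818cff981f9db0a1dafb1a3eee314a1eef32758ef0218cff1918f5f1988cff2548d7f061f35fc1007ff1aaf8db246b4df828adbf8619eed2864cff1a75acf28554ff41007ff0208dff0a4cf9f031cf7e062e5fd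
    0x0 (by decide +kernel)

theorem surveyed_79 : Surveyed 0x700f26c6a38646931 0x77ecb1a18c326ed69 2380616 74 0 :=
  .of_survey 100 0x22934ff8c53fcb281af5f0a54eef32d1d7707085ff083eede8a92dfe4b4abcf08aaf9f02197bf0a32f5f0718dfe085cdfe00137df0c4cf5fa31379f2910f7f0e3f2de9981edf901cd7f8009ffd1464d7f1a9e9770e3ef690718f771318f6f061967f0274dfe12935df023bbde221f0ff4398fbe0639eed201b4ff623adfa23195bf0188fbf0b5cfb324bf47d8291e7f0009ffd132a5df062bb5f03115ffa031e7f7130dfb0899efe2b5569f1229fdd2a5adf6062b7dd32b3e4f0eaf29f00196ff0b22bdf303b4df1232fcf984ded7902ccff10899ff1269ddb0908dff8c4eee7601b75f1d28fed5180dff0ee39db0f4cbaf118adf70e39df81861edf0e3afec585cdeb4229bfd003f2df062af77061cf7e025bfce0c365fb03099ff044c5ff0a2badf1d8d65f0c7deda02c19ff9984cff2b18fbe54a9b5f125b5cfc311bfb820f9fb02531ff8210dff2d91e7b1251fe71ae4cf7061bfea01c1dfb0a964ff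
    0x0 (by decide +kernel)

theorem surveyed_80 : Surveyed 0x77ecb1a18c326ed69 0x80826e479d4642df9 2316720 72 0 :=
  .of_survey 100 0x508dff06365fb98a1edf166bfc5065b9cf0773bcb427cf750008bff40e1edf4ae0dfd0c6ccdf0a32dfb4673bcb0219dfb1b1cf5e862e7b712aacef209f4bf4218ffe049f17f1a74f57323da770a5f9f38a31ff90639dfa8a1cfbe0662fcf9108dff8001eff0001eff5859bcf0e765f30b147bf4c3e6eb1bc54df8a1f2f7098af9f1c9cf2f0229edf07233df0c2afdb0260fdf271f0fee019efe22f3cde0219eef2d1b2ef2018f7f0919ff90f4c9fe68595fd0fc0f77202acff089bf9b16d35e7086dadf06656bf068cf3f098aef7107bfc31060dff012abdf0230f7f8429dfb041775f129d47f061b777c24d9fb15ae4f7201ad7f6389abf8ac78df263afab066d8df472e2ef646d65f07097fd841d57f06c1dfe8a33fd9a28f87f0a52fcf0275aef94a6cef0a3f0df9019dfb0a49f9f982dadf800bbdf211b79f8aa1efd9049ddf0629efe271c47f6028fbf02e1f9f861f377066d65f1818cff0a2eadf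
    0x0 (by decide +kernel)

theorem surveyed_81 : Surveyed 0x80826e479d4642df9 0x8b870c28bbc746be9 2282280 64 0 :=
  .of_survey 100 0x3007ff024c5ff067bfcc2839e5f089e5bf122d8ff085f1df021b1ff0c3faeb3318f77163db5b02e78df063657f0b10ffb001bfed0a3e8df04296ff02325ff4d8a5fb142b5df1728ff3800e5ff1229dfd0618f5f0039efe02d1eef0331bfb352b1df2a74cfb0272fe700087ffa3156bf08e1edf038bb9f851f35f003afeb0e7bfc80d825ff98a4cff232a4ff263e57d166cdf3165d9eb0a2adfd0e3b7b943103ff071477f026cef7029bbaf4288fbfb141ddf1229ef70009ffb9384d7f20b6c7f029af77165f1e71249fd70816dfb0b18dfd323af8f1231f5f063fbab1088dff043bbeb4818ffe44695df1239f8f083e9fb166bbc70c2aeef1b916f7188ccff0019edf1a9ccfe0227adf0039ff9003b79f24bbf1b52ac9bf18c1ddf0ac2ddf4008bff228b9bf0e3aecb061f33f003e6ef870bbeb1509bef42396fb82a2cff820bff5263b6de83970ff06a36df42649ff4369bdd023afde8231dfb106dddd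
    0x0 (by decide +kernel)

theorem surveyed_82 : Surveyed 0x8b870c28bbc746be9 0x95258c267df2659e9 2356200 75 0 :=
  .of_survey 100 0x32cbbf1269dd71a3e9bb1a9d4fd0718f6f081ccff442c6ff205b5f702c9dfd06196df011b3df2749b77165bfc6325cdaf13229ff061b79f1a74cfe0213bef409cf3f0218fbf307dcde0108bff2940dff07e70df46996fe54ab1df1b18fde8a4bb9f3049ddf03352ff1c3d6db0318ffe2071f5f1c5d5db1239ddd2a5aded40c9eef23198ff133e78f422abdf801f79f9461fcf924ddf38b11bfb07a379f04495ffc018f7f70595f78024effb02ed5f0a75f5d0c6eee7a02acff061d73f423c67f00195ff9834f5f3964cdf88176df02b36df1920fdf0421ffb332a9f70664f5f0249ddf0024eff16ae5b70659deb1234d7f61996bf0e5cf5e8019edf2239e7b0ed655f22f749fc3117fb1429dfb07261ff070cb7f014c5ff0ed54fb1419f6f6898f3f823ef730428f7f1c99f5b4290f7f0329bfd1a9cdbb0664f3f061b9fb061957f0ab6eaf0b51ff3287ee8f0ab3f9b85037df42916ff062da7f0e3e5fc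
    0x0 (by decide +kernel)

theorem surveyed_83 : Surveyed 0x95258c267df2659e9 0xa0bb77ac8fd7933c9 2270520 69 0 :=
  .of_survey 100 0x246bdf3801bfde065cd6f389cc7f3049dbf224adef0e3af6d924d9f7421e1ff43c8dfe922e9df003e5fb4230f7f8022dff0a5fae7a09f4bf383aecf083edf90d34f7b1289eef1ad4d5f6268f9f020e9ff199ccfe50197df0649f9f023f2df04196ff0f327f3c108bff4c58feb072cfbee0197bf0328ffd1cae4df04c9f5f41087ff0021effc12abdf89c1edf489b9fb868bb5f19aaed71231dfb861cf7e52b19fb025b7b71d18feb1099dfe105ddeb6299b3f06b3f7303c1dfb067ddf86bd1a5f02d4d7f0e6e5dd142cd7f0a5ddfc068b97f4a5c79f4a98f7da84d8ff0f4c5fd094c9ff0839ff91019def001bfde0d366ef0b18dfb0209ffd023d6fd8421ffb256cd7d01087ff0e5d6be3349df32039efe1429eef07431ffe018cff212af5f0274f5f466c5fdc82abdf265adee42c19ff0720ffb062e97f33319fb199d69f4108bff078b7b70129aff182ccffc0087ff100ddfb143ccef06c9d5f04265ff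
    0x0 (by decide +kernel)

theorem surveyed_84 : Surveyed 0xa0bb77ac8fd7933c9 0xacdac26a3eb7f2b29 2382240 74 0 :=
  .of_survey 100 0xb93b5f0c89e7f0c6bfd30ccde7704087ffc1087ff9cb74dbc8a0eff0639df91249df74899efe003e5bf063aee72351f77146ddde445d7774298d7f33914ff0528ffb9249fd7061d6bf802eef79b94cfecb362df2320eff0adedb3191cf770349bdf0629efd0236f770218f7f82171ff3b74ced2289e7f0dc1eef1129bdf0e3afab8213feb078b5fd0a50ffea101eff046d6df8310dff0b5cf6d020dbbf1059dfe820cfbf081f5fd1929fdd1d1c5fb040e5ff17925ef6679eec183eee71318def283f69f283bede3159df31a3cdf9221b5bf48abadf223bf9e8215b7f0751fee4ca8efb10195ff42c0dff223bef616a9eed04a9efb2074d7f0a73fd3002fadf0e3af730a3edfc0211ffb0b669df0c1aeef1261ddf16ad69f0fc31df02113ff0b88cff11c1ddf0619efea41b5fb269af2f0319bfb0f4cb7707a65bf64595fb1aa9edd2101eff045cf6f02b5a7f9233fcb063fb5b0b196df864bbcf625a5f7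
    0x0 (by decide +kernel)

theorem surveyed_85 : Surveyed 0xacdac26a3eb7f2b29 0xba446c8b881fd7a01 2208703 72 0 :=
  .of_survey 100 0x4a38efe0118f7fc03e6ef06aedbb1a39fd9081bfde0b125ff061b5fb003aeef0aa2cff103bbcf0271dfb8841fdf1289dbf14aedaf0908bff8661efe0b1cfbb083e6bf4228ffb8a94e7f01165ff149b5fe38e1cdf9b91ede42737d752715df021f5fd988ccff1239ecf03c19ff163d57d0789efe69306ff0b116ff1251ddf44e1dfb0a89ebf129dcfe1919fde1489d7f8c4e5f70269dfd169e96f1d18f6fd01d1ffa232eef42b65bf2b8a8ff14af4f70018dff8009eff443f1fb1e7bfc00a54cff391f0df254b5f70389bbf8001dff0001dff0f1e35fc0195ff4259ff68a366df6bd169f1189dfb02735df0239ff902839ff071bbeb066bbedc218ffe0281fbf820dbbf021a5ff4428f7f0f197f93b72ec70a18cffc21c7bf023af770009eff35296df4aa8efd0e72f4f9449fcf12abf97062cebf0069edf0a51edfc84c9ff820e9ff1d195fb052a7df0e9cf3e1239ddb0618cdf062e5fb861f1fb062e3bf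
    0x0 (by decide +kernel)

theorem surveyed_86 : Surveyed 0xba446c8b881fd7a01 0xc965e569f37d70ba9 2222500 76 0 :=
  .of_survey 100 0xd9d67b078f0ff023e6ef232bb9f0a49edf031e1ff074d9fb02975bf061cf3f1564def1899efe0274d7f0181eff020e5ff0e3e57d50a9f9f021bfde066bfcd061d67f1219f5f06e39fb06633df066bbde6bd0cfe881f9fb0ecad770219edf27625dfc231bfb19a4cff0321ffd0222fdf02087ff0308bff85c1dfb011a5ff2a5b8ef138b9f7126f9d78d0e1ff27630ff10a9edf146dee70dce4ef069337f121adef1a6ccf70a18ffe0c19f5f0675eeb4318ffe18cdcf72219b7fc2545ff0a31edf82839ff183ccdf2160dff02137bf303f8ef203af5f2873ecf071cf7e183ddf906e3dde049b75f0e3b75d862af771019ddf062a7f70428dff16ab59f0ad1fbb3928edf2849cff241b4ff1a3cdbb05087ff08376df840b7df383e4df81137df06d5d7b123df9b869375f8c8adfb1f9f28f287bdd9272b2bfb02addf0619f774788b7f45317fbb01cd7f0629bfb20e1cff6bb269f4918ffe840cf7f0f1e1fe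
    0x0 (by decide +kernel)

theorem surveyed_87 : Surveyed 0xc965e569f37d70ba9 0xd96c20eab157c2801 2403240 70 0 :=
  .of_survey 100 0x1269ff50e39efa138adf7443e75f0669fed0818dff4059bef0439f7b0d1e75f8100fff03197fb1249ddf20aacff0e3aede804bfcf0100fff123bfcd2b758fb0e3e67707a4e7f8841eff0619dfe2349ef702135ff02195ff181ccff083afdb22b787fc42a7df8661dfb022fadf8237aef0f75aeb06aeb3f0ce74df43113ff04375fb165d5af42b36dfe018f7f2352def071b7ded029aff065bfe3226f8df025cf6f1ad1d5f0a1aeef2549f771819edf131e9efe46da5f269b71f129bdf3166b5d706b2f7e50195ff0709aff001d7bf0ae3adf60b2d7f029bb3f1310dff205adef2872dfb103cf5f061b75f0459f6f3139df90918ffb303bdf3b049dbf0a4ccff004ddfb061b3ef062ce7f08c9edf0a3fadb8181eff272ab3f6074d7f8041dff8000fff0000fff0b8e8ff2391f3f0a9bb7d0c19dfb1ab1e5f0c5f2ef1018dffb01b5df4a5b1df8e5fb8b0041dff020b9ff152afe7225bdf3c290f7f0319b7f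
    0x0 (by decide +kernel)

theorem surveyed_88 : Surveyed 0xd96c20eab157c2801 0xec6f2f4772ad66221 2228240 75 0 :=
  .of_survey 100 0x285adfe020bbbf091a5ff0211eff3039cdf09196ff841bfee869bfae008b9ff06ab79f458a5ff1273fc72b5adf606b36ef309dd3f8826edf0a3f6dd4248dff4cbb6ed8266df7881bfde821bfde028f9bf0c9e73f0e3aeed4c6c4ff271b33f1db4d7b123def3185afe73239eeb2d1967f429f0ff0271edf0b54eef0eefa5706c9f778019ffe0826edf1081dff0fb697b2418f7f066d9fb861f17f0ad74df023e97f227bf8b101f5f7a71f31f001f1ff123bfd3421a5ff821fb5f02c9dbf0e5ccfe066cfaf243bf5b8909ffdc03e5fb0c3f6db820e5ff0e5d75b12c9fb70a5cdfe0e39ff86bc9a9f086ccff26ae47f43545ff126dddd0d8ce7f9251def0236eef0f1e1fb3119dfe221b4ff146dddb05265ff474c1ff822fb9f046b5df0522fef52a8dbf0ccecef43107ff0a99fbb8209fbf23934ff03087ff12915ff0031ffb2148dff900cdff870b3df1c9d47f243af7e06517ef303df1f062a7bf12899ff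
    0x0 (by decide +kernel)

theorem surveyed_89 : Surveyed 0xec6f2f4772ad66221 0xfde9093a9a2a7e9e1 2201696 77 0 :=
  .of_survey 100 0x47292ff0b18ffe12499ff0651def06e1eef8629efd9289eef861b7eb2259dfe101db7f0e5b7cb866ddfc0020fff07633df13a29ff8c3bfe922cbdb7c3113ff0c3e6ef50c9df7303adfe0a9b79f16ef8e70dc1dfb820bbbf072abfe8d537cfa46dcfe101bfe7403c7bf0c5cf6f044bfcf862f0ff33758ef0671feb0788cff30ab8ff042f6df06cb9ef19c1ddf03165ff861b79f0e3da7b231f0ff7339aeb30195ff0e7deec1231ddf102aff7064c9ff8009dff17adb1f01195ff0318fbf062cd7f069b5fe2239f7d9ba2ed762c94ff0a3afed6238f3f44ab6df4389aff101ddfe808b9ff1a39edd4aed8fd2269ef7880adff2a3aeaf0c1a77f17b378f08c5cff46ebae7a231e7f023aef70009dff06e4f3f00a1eff167dfa3186cf9f0e5d6eb007dede023e5fb065bfe60618ffe030bbdf40c99ff0629dfbf05d55f041f75f42e4cff189df1f9081dff0c5d75f061d57f4308bff1351bef0674f6f861b5fd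
    0x0 (by decide +kernel)

theorem surveyed_90 : Surveyed 0xfde9093a9a2a7e9e1 0x112824ed71d5088169 2372160 74 0 :=
  .of_survey 100 0x23aeef830bbdf198ccff024dbbf86e5e77072c7bfc020fff269b53f0edf5b3c01f1ff167f7878944dff0008fff183ceef356d8ef43c0dff8211eff101f1ffc8e1edf0a5779f0241dff309bd5f12755dfa332dfe021bbef0ccadef0089eff129d97f0a30eff0a3e5fd0381eff0b30ffb4038ffb485d6df063f1fb223b79f0061eff1039eef06ae97fc848dff84a3eef9251ddf063cf7e108ddbf1019ffe015cf770d4c7bf0a5ccdf225b5f7c2197fb021b7f70e5f79e06cd5bf0663feda32b9fd4020fff3129aff001e5ff06e4d7f0c9d67f246f0ff33195fb6069edf43087ff0a9da7f2218f7f985ddf38a51edf47aa9fe8649dfd0c3afebc45f1ef0218dff023af5f901dfaf223bb5f0ae1edf079375f86abfadf118dfe2065cff890e9ff05196ff267bf650a18fbf5018dff066db5f185dddb1589dfb0c5d5fb8b372df8020fff0039dfb291ce7ff05cd6f001cf7f830cfbf824f9f70209eff171979f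
    0x0 (by decide +kernel)

theorem surveyed_91 : Surveyed 0x112824ed71d5088169 0x12b2fc5fad87bbce11 2194920 77 0 :=
  .of_survey 100 0x62bff38a49edf1718f6f46d9f730a5adfe00c1dff1330fef1728dfb0fe1ede3275d7d061b5df201bb7f9489cff3018dff022e9ff12199ff1b32fed0619dfb1439feb123bbcf191d2ff286addf850e5ff0ef7a4f387de57226cdbf063afde966bfc34dcc5bf707d59f0231ffb8619dfe01e1edf08c2dff06aadfda23f9bbc019ffe14a9dfb189f4df02c9cff0a5e9ef401b7df292aedfc218fbf2274f3f0c5d6ef426abf7472a1ff1a75df94008fff8a73fcd143cf6f1a5adcf0e5f7ad1039dfb4cdcf2f0b346ff189cf3f063bb7b8209eff841f75f06e74df0e3aeeb0b28ffd0720dff087dede081eeef405c5ff125d9ef63b1a7f062fbbb08c1eff908bdf7861d6bf431e1ff0d1a7ef2b50cff063afed0229ffd8061eff8314f7f064c5ff07095ff12b1dfb0d197fb1061fdf40c8dff8008fff189ed5fc308bff2239fbb687e59fc83e79f0d1e5fb0318f7f0232fefc2e1dfd069d73f26dbdae103cd7f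
    0x0 (by decide +kernel)

theorem surveyed_92 : Surveyed 0x12b2fc5fad87bbce11 0x144fb5d9949ee0dd39 2317812 72 0 :=
  .of_survey 100 0x4a71ff90219ffd088adff8789efe0209bff82c1fbf0439dfb14a9eef1269fd742397fd0718ffe0669fdd0c5af6fc85cdfe302bef71818dff0489f7f861d67f27ae4bf1aaacdf243e57f9819edf0120fff44e0f7f0618cff8a2aedf02a1eff2b3ea5f285adef0439f5f042e5ff1b9ccfe0211dff1c5fb4f869bfab078b1ff0e5cd77b03f8ef26f3e4f15297df423cf7b027efa7167ddda082ceff066cf9f063ef6b8236b7f042cf7f122faf7035d7b71469fcf8b55aef007bfcd02555ff067375f06ae8ff1960fdf0359ff6027dede0840fff8300fff46be57d83137df485b3df081cf7f0d4c5ff0669efe2349bbf0249ff70a19edf3939ede123f1df403e1ff8629dfd062faef0039edfc839ff9286ccff423e6ef07a16ff8a31edf146d5df842eeef6279ede6baaa9f59b0eef0b916ff52db9e7028b9ff13197f7066779f33d1d77066b7d7021bfeb02365ffc049ff70a39ff90819ffb9009dff090afdf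
    0x0 (by decide +kernel)

theorem surveyed_93 : Surveyed 0x144fb5d9949ee0dd39 0x15ff402de7cfe1fea1 2197720 79 0 :=
  .of_survey 100 0x69b24ff0232f7f0c2eeef9392def501f1ff4269bdf007deeb8209bff225d8ff4b533df2d5657fc43afeb249b4ff061f7bec3087ff172f1fd8249ff742761ff626afb7033b7dd10c1dff4038f7f9389dfd99c1ddf32f5c5f1d9ce6f19197dfc23cf7d2b5af570649ddf890afdf131d1ff021bb7f0108fff1908bff47397f9c01cf7f6268cff4109bff1253fe71118dff0a9e8ff03c9fb7223af9f041b7df23325ff0209dff15895ff072a7bf47d15fb12195ff26f786f1c75eeb605b1ff50c99ff003ef771039edf165cd6f2c7bf8b263f6bec01e5ff266fa77072cb7f3039eef2259ef7473cb7b0f1c67f394adf7271967f1a6ccdf40c1dff0730ffb0808fff821bbef087ddf9189b5df0fc9dfc861cf3fe03cf3f0eaeebea2b787f2b53b5f2c6f4fd002adff396d8df5039bfb0a1bfed0663fde0cc9dfb0fc379f41193ff123e5f7267bdda8265edf1869edf1639df90a2fadf4674f7e06296ff42997bf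
    0x0 (by decide +kernel)

theorem surveyed_94 : Surveyed 0x15ff402de7cfe1fea1 0x17efd8c38ef3d53659 2152920 79 0 :=
  .of_survey 100 0x82365ff223af5f6368f9f8a5779f47327fe2b39ef90e3f6de1390dff0c2bfdb011bbef06d357f466b7f5503e1ff0f2e6f71d9567f06ace7f0208fff1918f7f021b7df0f2aff317a0cff121ddfe027ddf927670ff8209dff183ce7f821bfeb0faadf9483c6ff224bfb70618f7f27294ff44287ff4a3afde841d77f0119ffe0c3af5f0c59fdb0049dff8c5775f065cf6f8231ffb119d5bf0239dfb021cf7f3065cff8629dfb52abaf70b1e1ff02df5b7069b6ef082eedf201b5ff063b79f821f1ff2b4bb9f323f9bb12aadbf1baccfd06e4cff0671dfbc54c5ff0d18ffb0e3faeb2019f7fc109bff0fcadf38211dffc4a9efb087bfd32cf5c7b828b9ff1d4daef481eb7f003bff30e5bfec0659faf0839edf2c73f5b074c9ff066bfcb2b5379f303adef061bfed869f71f0e3af574838ffb0210fff121f9ef9181dffe071dfb03195ff0291eff8663fed8b1afed1239fdd347dceb1761fde8108fff62be87f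
    0x0 (by decide +kernel)

theorem surveyed_95 : Surveyed 0x17efd8c38ef3d53659 0x1a453a40534c4b0819 2263380 81 0 :=
  .of_survey 100 0x2941eff703adfe0c4bfcf129b5df4aaaf9f8208fff4c3e6ef1c7decb4a3f2df5038fef2d5567f061bfde103bfde4ab36df021b9ff03117ff9865edf821bb7f327bec726e3cfe1239fdb1299dfb0729aff271f33f921fb77990aff78076def163f5f3229ad7f05097ff2049dffd1197df5239fde47297fd0309bff882eedf38bec5f0b18ffb1a9bdde055cf6f0c59dfb0019eff06ab8ff442afef0e5df5e074c5ff229b4ff4a99fbb8210fff06196ff0d18f7f1d8cf3f4498f7f3039dfba3554ff0e3af4f27656bf271957f027bfd34138ffe12b1e7f62b36bf881e5ff266bbed271b7be55645ff1291ffe0e7ddf816af95f848b5ff0c4deef0acccff0b0bbdf061f5fe181ddfb323f8ef803bfde4a59fde998ccff0a5adf7423b3df2942dff31195ff066d6df046defe0849eff842cf7f071c77f02c1dff601b7bf0639ff906299ff028adff1109bff0639efe0cc3dfb425d1ff4858fef4cc9fbb2039e7f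
    0x0 (by decide +kernel)

theorem surveyed_96 : Surveyed 0x1a453a40534c4b0819 0x1c909b888163b30bd1 2333268 80 0 :=
  .of_survey 100 0x199b6f70a1affe8a1bfed063da7f323f59f023bff30659f6f79e0cdf4a5daef862ef779922fdf86c5f3f8309bff2b1cf3f861f777271b7770eb7a7b1259df7023f5fd4ac9f9f001b3ff0d1a5ff163f6e763316ffd064dff101cdff473477f09565ff1789dfe42a2dff1ab72df866779f683b6df01365ff283aedf2d19f7b071e1ff3039edf1439dfb8254dff0951ffb0508fff128bdf7442e5ff8dc1dfb385cdfe062e7bf4659fee8232f7f27a2f3f6269ef750a8dff153f35f172d6f70333bfb481afef187dede1d1e5ef4219ffd18a2fdf51307ff131c5ff263ed7e08776df4d28ffb4c6d6df0239edf062bbfb63c99bf472a7f70149ff78019eff069b75fc29cf3f041b77f023faef06efb1f16af8ef166ddf3083eefe9463fcf193afed26ef49f0f356fb0232dff0e39df90caacff4764b7f070f1ff0277b5f8003fdf0003fdf4231ffb841b7df1239f9f347bdcb069757f46b35fb862f9fb1659de7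
    0x0 (by decide +kernel)

theorem surveyed_97 : Surveyed 0x1c909b888163b30bd1 0x1f5339ba0c485f6879 2420600 81 0 :=
  .of_survey 100 0x6349bbfc01b3ff69196ff26e70ff1289fbf1a9baef1ba4cffc219ffe000f9ff863775f00197ff0189eff2676d6f166cdfe63325ff54ab5df07296ff1164dff4328bff142e5ff061f37f3141dff0760dff1149ff743133ff0a32ffb0275eef861bfee063b75f128b9ff0f49ff3182ceff3529dfb5499f6f0e5dede8a1ccff121bfd7a236f3f032daff0ed3f4f0e39edbe01b7bf1b54def285b4ff0de2dfb031b7f711c9df71859ddf8663fde4b89aff870b7f7064f1ff0275dfb4268fdf0b5cdfe0819eff52ad8ff1669ff30e3bfda07aeb3f0308fff502cdff425c5ff4c5e5ef0449dff53197f7011cf7fa313b7f47197fe1a3bfd31918fdf343dd7b52b54ff45287ff18bbf9b0c4b7df06195ff265bf670f8e97f401b3ff123d8ff0639f7b82c1dff9089dff007bfcb352d4ff71a8cff623bbbb6274d7f0329ffd4238ffb0f4e5f7148bdef0229eff4a39ff9272da7f187eee74a3e5fd30365ff107dee7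
    0x0 (by decide +kernel)

theorem surveyed_98 : Surveyed 0x1f5339ba0c485f6879 0x227f4a8cdfc469ddd1 2068360 77 0 :=
  .of_survey 100 0x1c1dff0e5cf7ea30b9ff0361fdf3139fbb04abf5f982dedf46e35df000bfdf1239dfba3137bf124ddf70a32fdf061f3fe2073f5f922bfd78a54ffea019eff0919ffb8c8ed7f0629ffd54c9def861bfde043f75f471b3fe903bff30adde770619edf02cbdf7070b7df047bfcb166d6f70a1daff1c5b7cf02363ffa463f5f942ddfb284adff0aeed9f44595ff266bf57253b7bb062eeef2789f3f20bec7f13195ff861f79f2f5b7b319e4cff4318bff2764f3f0fc1eef067bfecc34c5ff0019dff6271dfb8b0daff4320fff06ebdf30634f7f00cb9ff16765ef0564f7f40197ffc23e6ef0e3e4df18bef1f266b5fd003bfdb0b48dff06637df181cf7f0e9beed0fc9df9472cb7f219b4ff8c1bfeb0e5f35f0249dff066cd7f296badf223b8ff0a55edf0bcbb9f269f53f061bbef148b5ff1259def8026dff027deeb006bbdf0ecafaf16e3dcf058bb7f183ccff083bff94718ffe246b4ff1249ff7061bfeb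
    0x0 (by decide +kernel)

theorem surveyed_99 : Surveyed 0x227f4a8cdfc469ddd1 0x259cb856be76ba96e9 2015440 75 0 :=
  .of_survey 100 0x965f7a7067ddfa0c39eef0e5afee313cf3fc23e5fb2f5b79e046bfcf089ed7f20c9fbf30b3eef323b9fb1b91edf0c7ef4f0c49fdf1bc1ddfcc5f35f0651fef823ef77283acff141d5ff472e1ff02d71ff066ccff1d197fb0f365fb023eef710197ff883bff912bdd7d32b2d7f8001fff0001fff06bef3e0781eff1f9b7ad271b79f127ddde083bfdb02177bf1019dff107bfc72439e7f2673ecf0f54dfb0018fff0be1edf0843fdf0a1e9ff065adef313adfec940fffc0197ff0589f7f683aeef3239fbb223ad7f990cdff4790f7f2acb8ff909f97f0aede9f46d1dfb272badf53899ff0a7eded0249bff0cdf4ef049f57f303ef77495b3df2ae3cdf2161effa30bbbf0273fcfa48b7bf0669edf271d6bf1381dff2309eff0a36edf8308fff0e5eb6f1c73fcb0219eff025bfe7406cfbf809bf5f83337fd800bfdf8a974ff227fb1f9233fcf06c35ff0e3f2fb471c7bf3859eef0619ffe8019dffc25b7cf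
    0x0 (by decide +kernel)

theorem surveyed_100 : Surveyed 0x259cb856be76ba96e9 0x2992b43d9cf712e1d9 2019416 79 0 :=
  .of_survey 100 0x62e5ff2229eff191d7fd0e3eeeb862edfd0319ffb16a9dfd026e9ff0819dff623a7bf127ddf3944ddef9a73fcd1ab1edf0274f7f0039ffb281adff1219fbf0fc0ffe463f2df0cafafb5259bef07ae8ff265bdebb561dfb0a7bfcd0ce6dfb3918ffe9449fef62725ff062b7df026cfbf3109bff027bfcb0a5fb5f3cbec7e8101fff005d5ffaad3f1f003afef031e9ff820bff70101fff1699dfe924ddf712bedaf040bfef4308fff1699f77b961edf0a2ceff1318dff2639fbb0e5d79f32d1d7f33197bf07e1dfb0271ffb11c1dff8845eff0639dfe0589eff061b7bf96e3f57823bff367e16bf8b81eff067dede3b71df90219bff2f5e5be91a2dffa21f8ff86675df32aadbf2239e7f0629ffb023affe0a5addf303bff3069ad7f9229ffd0e3afde32b1e7fc2a1eff227f95f0f4a7f70aef8df1b94cff3351ddf4018fff242adff0d5d5fb8843fdf942bfcf020f9ff1c3dedb241b77f061f1ff8d09ffb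
    0x0 (by decide +kernel)

theorem surveyed_101 : Surveyed 0x2992b43d9cf712e1d9 0x2dcb556ddc9669f3b1 2123520 82 0 :=
  .of_survey 100 0x619ffb861db7f48d1ffb0859ffb0eae8ff0639eef0b1bbfb0b18dff683aedf15a9dfb0639dfb0f8adfb854d5ff269b97f7879ede30bde3f1251dff8a936ff0676f6f861bfeb0661eff33515ff0b1ebfe1275dfb1b8ccff07227ff43e0dff0219dff1045dff031b7df266b9df103ddfb0acbef7287ecef22cf9bf411b3ff8219eff159d57f0a51effc018fff003e5ffb109dff0f18ffe32c9dbf880edff066fb5f67e0f3f1674def4099f7f2c39efb066defe9019dff589ccff1b89edf49996ff8041fff063f7bb421b3ff0213fdf7039dfb03c1dff206dcff24e74ff07673df103f5dfa311eff1939fdb0041fff0389eff631a5ff864db7f0a5defe1caccff46c9eef82b7a7f97669ef0e3eb5f2671f5f1b545ff0818fff125ddfe4260fff06e3fde4a9b2ff1291dff3918f7fb4e5c7f064d5ff02197ff236cdbf272adfb607b79f0e5deeb123bfde0618dff82cddbf011b3ff2819eff6168fbf166dddb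
    0x0 (by decide +kernel)

theorem surveyed_102 : Surveyed 0x2dcb556ddc9669f3b1 0x325d5e36b5ef922b71 2030280 76 0 :=
  .of_survey 100 0x221adff0063fdf376d4f7820bfdf146df5f0b54f7f4dc07ff063f9fb6679f73185df5f0274dff0fd72ef02b1eff8e3ef6d005cdff0f1abef852cf7f0439ffb0e3aefeb91b79f60737df147dddbd960fdf06c1dff1529ffb0499f7f163f1dfc11b3ff226bef70acdebf271b75f0a49eff003af7fc729bfb06e3f5f16a9f5f8a1bbdf106dddf0762fef03363ff165b9efab1adfe0218fff8213fdf0acbdfd17c15ffb9934ff92c1dff9083dff063ef77801f7bf13c9df71729bdfa21f4ff26d1d7f44197ff0629fbf45c95ff061e5ff38beeaf1189dff3839edf5b68ff54a58ff7483ebfb8a4dedf0a3ef7d1039ffb269bf1f8009fff623aeef07e1edf403e5ff0b10fff0065eff5898f7f0e5b79f200bfbf3439dfbc21e5ff0e9da7f103cf7f86637df1289dff0f197fd8a36edf0cded6f0009fff0d2ebfb2f5d6be0a9fa7f066bfde04c9f7f4b48fdf185ddfb9045dff020bfdf01197ff12ebdd706ef8df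
    0x0 (by decide +kernel)

theorem surveyed_103 : Surveyed 0x325d5e36b5ef922b71 0x378b588aef790d77a1 2026500 83 0 :=
  .of_survey 100 0x225f5bf0239ffb820bbff0a9bef778d9d5f0edef768219dff26c9d7f06775df1c7f7d30719ffec639ffa025d5ff023e9ff0d4d6ff023b7df3918dff747d55f70f1eef1e7fb8b82173ff426bbdf375d577900ddff0f197fb429b7bf1009fff4a5c9ff0e5ccdf50bcd7f085dedf707cfaf2065eff0118fff27e70ff2275e7f0a3eef753307ff065dfaf063edfe0a6bfdd0e9d67f11197ff12adebf203af7f3d9d47f0c5bfeb1a5cdef2273dfb0e39ff90d5cdfb3330dff0731ffb2699f3f0d8af7f0d4e5ff5ba8dfd3769df3069bf7e0cabefb9a3bfcd2b9eb3f8a2eedf069f73f020bbff1249dff0720fff387dede1b90dff399b5fd0349bff276bbde72f1cef801bffe0c7bfcb149f57fc05d5ff075cf6f247bddb3239eef078b7bf8819dff2639f7b073677f16a9dfb311f1ff0b08fff0f327df9ccdcef387ddf9186dedf67aab3f8781eff1699f6f423e7bf100ddff1273fcf12d3def1081fff103e5ff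
    0x0 (by decide +kernel)

theorem surveyed_104 : Surveyed 0x378b588aef790d77a1 0x3ef48bbd6015459b81 2144170 81 0 :=
  .of_survey 100 0x252af7f1abf8fb12b65ff0263fdf165d5bf8ce76df1a71ddf443afef0b51fdf0918fffa85bfde8b10fff173b7f33239dfb9289dff03197ff0a3bfdd485e5ff46f37de246f4ff06cbdf71669dfb823bfdb0209fff862e5ffa3537f7a51b7fe1f9ccfe22b2f7f021bffe808bfbf908f9ff043af7f17e4dfe0b1bbdf611b3ff52a8dff0708fff071f3fe50aadff469977f9009fff023e5ff30197ff4a7dbf900c3dffd89adef376cd770265eff1ebecde0f60fdf223affe58bf2df9d89eef243f67f4a70eff306bddf802edff1abecfe062adff1b3afde6858dff0211fff0c5ddfb08c6dff0d49ffbd0197ff826dedf1e7bfcc0b32fdf0c49dff3139dfb8f2e9fb083eedf085cdffc1197ff396dadf0a7eecf0319bff021f7bf1a6cddf5a7e9cf0899eff12b5e7f9291dff0f2a7df429bb7f0619f7f83c1dff16a9eefc03e5ff001f5ff303bf5f2b18f7fd3899ff97c1dfe23535ff13935ff0675eef861b7bf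
    0x0 (by decide +kernel)

theorem surveyed_105 : Surveyed 0x3ef48bbd6015459b81 0x4628426e0d022a8b11 2113440 82 0 :=
  .of_survey 100 0x66bbdf335b5f78236f7f0b89eff0fccf3f0edf5bb042edff8629fbf203adff1d5b7cf333b5fd1d9d67f0629bff1b6e9df2f5aded3359f772039eff063bfebc72abdf00c1fff007bfde0383bff001bfdf0aabedf129bdf7041f5ff0f1e1ff12b5cff4349bff0669ffd0e9ce7f243ed7f449b77f47287ff861cf7f467d7bb0b1cf7f8a6fadfa063fdf18becdf061b3ff0c5d7fb821bffe1b3cf7d0764dff023afdf0e3e6df4259ff70e7f75d289be7f44aadff2a59edf8209fff6069eff023af7f1daaf5f289af7f804ddff52e9f9f066ddfb92abdfd065bfe7013affe10c5dff824f9ff0718dff4bc9bfd1b5d79f063ef6f0fc6f77865f777b331dfb8661eff06ef4df042ef7fb119ffe8211fff079377f4f3e2ef0fab6fd102bfdf1b5d9fb8a5bff3263af5f062abff223bbfb0109fff8a51eff0059dff4360fff1219dff4439ffbc29f3bf246bf5f0f6bbdb399f0ff1639dfe0a5bfd7066cffe0673fcf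
    0x0 (by decide +kernel)

theorem surveyed_106 : Surveyed 0x4628426e0d022a8b11 0x4da3ada401f3086a59 2012220 83 0 :=
  .of_survey 100 0x185dddf081edff1b9b79f87637df207bfde0859dff0fc3fde38bec7f065f1ff54d9f6f943f5fb4a7eb5f0667fed0cc9eff4239ffb1a39edf38ef8df884deff485cdff0049fff231b5ff0ecfaef0c3e7fb0c59ffb9181fffe06bbdf5568fef33b1e7f267bfaba23fa7f47e0ffe095cffe2d5e57f145ddef022edff8233ffb0f5cdfe872affe46eb79f863bffa129bdef1391dff8d4afef533c7bf223ed7f123cfbf92aedbf04ebfde108bdff189dcff1239ffd1b9cf3f129b9ff327bdf3401f3ff527f1df0341fff867775f842bffb085adff06756ff179b7773039ffb465c5ff86cf97f423e9ff183eddf986dedf0fe2eef0b1e5ff1e7decd9249dff066df5f2f3aeed0a5bbdf019b7bf679b33fc23affe0318fff16bbeee041f77f030bbff06d1f7f26ebcfe801bfdf8c6eeef0e5d67f8ccf9fb1b18fdf066cfbf062a7ff47193ff4330fff3355dfec118fff063affe8676f6fe85adef40e0fffa08bfbf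
    0x0 (by decide +kernel)

theorem surveyed_107 : Surveyed 0x4da3ada401f3086a59 0x58673536736d852fb9 2049600 83 0 :=
  .of_survey 100 0x667fde822edff0019fff627e5bf0a1effe1299f7f267f95f4ce9edf0639ffe4c7ceef02df5bf03765ff081e7ff0ecedfe007ddfb125d5ff0c5d5ff303bddf8ccf4ff8341fff8a19eff0fb64ff8b936ff1cbde7b9b89edf2ccbf5f0a99fbf2769ef7123afef063edfb0629dff0259dff842edff02c1fff0309fff179d5bf1aafadf066dedfc63afeb656a5ff866ddfd3739df9a273dfb26abfbb13347ff062fbfb52bcf3fc469ffb9109fff028bbff223afbf47187ff027bfde1389dff0ef3ddb0eaeefe8619f7f31197ff8c49dff59e0fdf07c1dff633ab7f0e5ffec201bf7f46e9dfd16bdcfe9b8ccff633a7bf1899eff0619eff183afdf219b7bf126dddf2272dff626bff52a5f5fd0a18fff027f9fb0c5d6ff904ddff4738ffe20ef8ff8ccde7f1659def0f5cf770e39efb8ad5e7f841bfef035b7f70509fff14a9eff403a7ff123bfcfe11b3ff063eeefc0c1fff8c5bfeb276e5bf1a7bfd3830bbff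
    0x0 (by decide +kernel)

theorem surveyed_108 : Surveyed 0x58673536736d852fb9 0x64991c6c0cd8934e11 1989400 85 0 :=
  .of_survey 100 0x179577f0c3af7fd039ffb0e5defe1019fff0039dff01c9dff1a5df9f09cadff40f65ff063cf7f271f37f0639ffb0e5bfed267bf8f6859ffb047f6ef32cbdf70edf4ef072a7ff82367ff0e3eefe199defea519f7f0e6eef747e0dff0cc9dff0619dff021b7ff0c1ef7f0e5bfde629b7bf188bfdf0729bffc439ffb8309fff107ddfb163f5fda51b5ff3059dff8b91eff0e7ddf90e7bfd326e74ff4019fff3949fdf8b1e9ff52b65ff0760fff828bbff00cf9ff679967f0a3eedf2acdebf68eacff4cdadef230fbbf8789fbfe03af7f38ebcdf3039eff1918fff9985eff8255dff123e5ff34cdd7f53c99ff2b4bbdf061f7bf0449fff881edff0e5f79f4038fff1b89ffd343f5fb0f5afe71ab76df647d67f267ed77041b7ff22575ff0a9bedf1e7bfc326ef4bfa46f4ff4cd9dfb072abff8d19ffbc01b7ff523e7f73239cff223af7f3119dff1319bff1239ffb021bfdf015d5ff2b3af9f0eef8df0ecf9fb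
    0x0 (by decide +kernel)

theorem surveyed_109 : Surveyed 0x64991c6c0cd8934e11 0x72a85ad3bbe9b6ace9 1916376 85 0 :=
  .of_survey 100 0x821b7ff0e3aedf9983fdf0e3fff84c5afef8fc6f77003ef7f1abde5f0a4bfdf0663fdf387dcdf02d75ff1299dff062bff7011f3ff0219fff5274dff4c6afdf601b7ff027ddfb0728fff07e3fde4c5cf7f023fbfb0b18fff11c9dff1239fdf023f7fd233affec918fff1859dff6bd379f06ef9fb007dedf2a5bf9f047bfeb327dcef8a1f7fd265f97f8449fff1255dff063e5ff619b7bfc019fff0d0e7ff8a37ff91039dff428bbff06eefaf0665eff4a59ffd4ad9dfb4b3c6ff4674f7f8a3eeef2b6ccffa83ecff87a1eff821bfdf943bfcf04bbeef0f1bbfb0819fff0a55eff1a5def767e56bf2163fdf266bef70f8bbfb0618fff4468fff0a53fdf703e5ff1b99eef0a5cdff4ad65ff8a5ddfb1a75edf862fbfb6279f9f1719ffe061bffe0fccd7f1899dff1839fdf0e7deeb17367ef062bffd061f7fe06eff9e027ddfd0a59fdf165f5f79275ddf1c7bfcb15e5dfb066cdff063d6ff0a36ffb848b7ff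
    0x0 (by decide +kernel)

theorem surveyed_110 : Surveyed 0x72a85ad3bbe9b6ace9 0x841c5ef469b8b90989 1805328 86 0 :=
  .of_survey 100 0x15acf7f0fc9dfb0e5cffe5019fff076bbdf1a3def73351dff864bff7865ddfb8c1f6ff128bdff1b19ffb067bfed027bfcf0e75dfb061f5ff1a6dedfc28bbff2b51eff166f5dfb02edff8003fff0003fff06ebef70a5adff0239dff236cfbf2ad3cff046efef391adff4239bff0e3bff9207bdfba163fdf00cbdff167bfc7543d6ff307deef22df5bfb119dff13cd9ff0e9ef3f41c1fff8e5ffec0f64effa41f77f3339dfb861bffe625b9ff087dedf0e3f9fb472e3ff2b52dff061f77f6469eff0ee3edf215b5ff0eded6f33c1dff0bb66ff46b36ff861f7bf0e39eef4232fff166ddfb1f9bfec241bf7f0e39dfb579f37705c9dff006bfdf0f4e9ff525d9ff811f3ff0669eff23737df861f7fe8619eff1b9b5df4858fff32bdc7f06df5fe46aafbf22ef8ffc3197ff271b7bf0fc1ffb67e4f3f591c7ffb563fcf2c3befb1b1daff1673fcf0e3ef7786c3fef027deef46737df0a4deff333adef06ef5fd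
    0x0 (by decide +kernel)

theorem surveyed_111 : Surveyed 0x841c5ef469b8b90989 0x9684fd245da7386c79 1792812 82 0 :=
  .of_survey 100 0x1289fff9b1cffe0351fff4219fffac3f6fb0718fff7059dff0e3f6df031bbff07e1effa21bfbf062bbffaa76dfb005ddff266bbdf862bffb472a7ff0b9afbf79e1edf9aafadf023ef7f466b7df0a59dff0664fff8ecbfde800fbff981deff82777df471b3ff272af7f003bfdf8fc3fde1a75ddf1ebfaeb000fbff147df5f8a55eff1b9ccff1ebef5e2fcafaf2f3bff80273fdf091e7ff027dedf065cdff07cb9ff323ed7f247bfeb127ddfd9255dff8619dffa3137ff079b7bf383afdf023bffd17a2dff3d3e6ef0e3e7fd1291fffc23afdf823fbfb1cabddf4231fff10cddff067bfde266f4ffc11f3ff3039dff272b6ff061f3ff2ccadff623af7fcdc65ff9aaedfd315d5ff046deff8a53fdf0c1e7ff03367ff0a1edff2edbfab0dce5ff0eaaffd025f9ff26bec7f038bbff067defe04cf5ff14ebfcf389bcff4238fff2a3ee7f166bfcf1acbddf1799dfb427e7f7472abff811b7ff0cdf5fbc2c1fff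
    0x0 (by decide +kernel)

theorem surveyed_112 : Surveyed 0x9684fd245da7386c79 0xb03cc61749871003f9 1828400 82 0 :=
  .of_survey 100 0xee2dff47197ff253af7f0275dff3d3e5fb820fbff040f7ff861f5ff3839effab366ff069f7bf0e5bfcf2f5adfe323bddf073e77f0649fffc63affe0639eff1239dff023bff7b01bdff433e3ff2371eff4b18fff513c7ff0c7ddfb603ef7f272adff843bffb1e7dede0d5d5ff0adbf5f0a7bfdda103fff44ee5ff403e7ff076b7df020fbff061b7ff37d1f6f4edf1fb0fef9f9091afff4699f7f187dedf2277f5f16abddf15c9dff0e9ed7ff05d5ff42cf9ff1a3cfbf105ddffb23bff3c21b7ff18becff0e5d7fb0e3edfb2c5b5ff2103fff085edff4cc9dff90cddff9d8e5ff103bfdf029bf7f0f2ceff72dd97f1edef67e23affe838bbff0c49fff31c9dff003e7ffc8efadf0e5ddfb0e3bbfb107dddf861f77f800bffff1c1dff1a71fdf4ebaffa978f1ff803edff8a4deff0f61fdf000bfff4c3e5ff463cf7f487e7df0d3e6ff1359ff7123ffde8663fdf026bfdf862bff73739ffac42afff3349dff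
    0x0 (by decide +kernel)

theorem surveyed_113 : Surveyed 0xb03cc61749871003f9 0xce92232ded4e62f359 1847020 89 0 :=
  .of_survey 100 0x229bfbf0183fff1babfdd7039dff203afff063f7bfd439ffb938f9ff2edbf1f0ecadffb23f8ff0b5cdff246bfdfe07bfdeab52dff293aeff820bfff1d9f6ef1b9bfde1e7ddf90c6efdf227de7f3239eff8213fff1be5edf307dcff0f4c7ff023e7ff067edef3139eff1bb3fdb8709fff403afff539bbef862bbff0c7bfcf823bffb307bddf971d7bf26efcfe3a7bddd0629fff263af7f225dfbf12b6dff0fe76df463e3ff265b5ff1fc9f9fa71b7bf06e3fdf1659fef0c9ef7f020bfff0fcbfdec03e7ff0ccfdfb06ef4ff1e7fbcb9751fef067ddfbb52e5ff22bbebf1a3afdf823ef7f609bf7f438bbff0319fff02d1fff667b9fb4ebbafb2f5b79f840f7ff9291fff003afff0213fff4aeeef78a1bfdf023edff149f5ffc819ffff03e5ff067bfebf1197ff8273fdf069bffe46c9dff8e6eef713c5dff2f3aefe8e5bfed06777df061bfdf3239ffb8e5f79f861f3ffa41b7ff627ef77066eff7851b7ff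
    0x0 (by decide +kernel)

theorem surveyed_114 : Surveyed 0xce92232ded4e62f359 0xf4f9ca52df11cf45d1 1638420 89 0 :=
  .of_survey 100 0xfce9ff0fd37df861bfdf0d49fff0383fff467cffef039eff0639dff1f9d67f869fb7f065f5ff81e3fdf57a99ff167f7d73339ffd4039fff879777f183bfdf1abfadf8e3ef77021fffe0e5d5ff2f5b75f2edf47f1399dff966bfcf0b1e7ff825ddff4718fff423ebff32bbef7c38bbffc2e3fdf185ddff0ededfe0e3b7df347ddfb376d4ff0d1b7ff0e39ffb0e5dedf6079eff446cfff123f9ff275b7f7023afff998deff801f7ff1f3d6fb0ef6dfb26ef8ff17197ffc23fbfb3119fffab51eff273affe647bfeb12cddff0764fff189bfdf0039fff001f7ff066f7df966ddfb16bef774f38ffe1e7bfcd7139ffb0c3bffb01e3fdf1939fdf267bfed1b18fff26dbdfe0619fff305ddffa69bf3f673b2ff067bfcf0e5b7bf73c99ff0d4cfff0c6bfdf071f3ff1cbfeeb473f3fb083afff48d9dff16bfb5f0d1e7ff07937ff189deff123f7df9231fff8183fff0c6edffc66bbdfab32eff1f9d6bf3abecbf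
    0x0 (by decide +kernel)

theorem surveyed_115 : Surveyed 0xf4f9ca52df11cf45d1 0x12d196362b7573ebf49 1812216 87 0 :=
  .of_survey 100 0xedef6fa273fdf2c7bdfb0fce5ff3a7dcdfb03bfdf8293fff081bfff58bafdf0f5d7fb271f7bf0e5ffde8619fff47d17ff0a3edff0c3e7ff1d3cf7f276d6ff2aebedf0edf5fb4259fff3b39edf0fb2f7fc039fff47e0fff8e3edfb86e3fdf821fbffa63beef1d3afef6568fff081efff0c5d7ff007dffb1b74fdf0e5cdff3f7deec62bbaff0239fff627daff021f7ff8237ffb0edf6ef1d39ffb067dedf8d8bffb5b68fdf71c9dff0e7bff3483afff0e7f9fb1639fdf949bfef8a3effd842fffbc63f1ff627aff70b1afff4271fff1669dff072afff0e7ef7746f65ff0e3e5ff801bfff26bef3f042efff0a5deff0a3eeff071b7ff387dedf0f197ff1adedf7395cdff52f1fdf0a5bfdf347edef02f7dfb376cd7f041f7ff001bfff6059fff039bffe066bfdf279bb7f821fffe1bd1fdf866eff71039fff423e7ff27e1eff353cf7f081fffb2b72fdf12b3dff0f9b7fd063bffb066deffb18bdffa71b77f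
    0x0 (by decide +kernel)

theorem surveyed_116 : Surveyed 0x12d196362b7573ebf49 0x17a5a1dab1fdebfa801 1702967 89 0 :=
  .of_survey 100 0x32bbcff1a75fdf8a3eeff16bde7f383bfdf07d3fef0e7bfdb2a7bedf6879eff033e7ff66fbfab1c9bfef273af7f067ffed26ebcff0e3fff9007bfdf0669fff2313fff0e9bffe2769eff1b93fdf1b8deff173d6ffc67dffa821bfff26bbf3f013afff16af9ff389fcff1e7bfc70c1fffb061fffe863bffb8fcfaef4239fff0f3affbe03afff03d1fff2c3ef7f327ddbf82f7dfb0e3effe1b3afdf1b99eff1c5ffcf027dffb0fc3fdf0719fff173cf7f881bfff063bfdf1ab7edf52f1dff0eebedfc23e7ff3039fff33c9dff387bddf985ddff1c7bfcf167ddfba26bfdf0a5cfffa31b7ff11cddff587cfdf0e3aeff07ef79f87c1fff027fbdf2cdbd7f1dc9dff46d75ff066bbff1b95eff04bef7f881efff069b7ff866f9ff021bfff92cddff1e7bfcb3effcecc46cfff821f7ff303bdff8673fef7138fff119bfef543f7df0f765ff276b9ff46be77f4fc8dff0729fff013e7ff3f7bfcc2859fff4d9a7ff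
    0x0 (by decide +kernel)

theorem surveyed_117 : Surveyed 0x17a5a1dab1fdebfa801 0x1e1a40ed98f70c15e29 1432116 83 0 :=
  .of_survey 100 0x8007fff0007fff023fffb4f5f3df0f4cfffac5fdfb67e1eff0c7dffb199deff981ffdf1139fff862fbff3b75edf1a9bfbf0bcedff1f9bfde271b7ff0cdf5ff0e7bfcf3319fffa30bfffa71f7bf37b3f5f009bfff259bf7f067fbef0663fff058bfff66ef8ff4f5ebef266bfdf1f9bfed043fffb1739fef269bf7f66ebdfd027bfdf24efcff8e5ffde166dfdf0f64fffa313fff2a7bddff07bfcf0a1efff2761fff139bff7d039fff007ddff323deff027deff3cffceb5799ffe0f367ff0bd3fdf2f5bfed3affcde169bfef3331fff1a73fdf1f9ccff870fbff1f9defe061f7ff818bfff1ebecdf087bfdf0e7deef063afff1d1d7ff281bfff0adff9f169f5ff087deff1a75eff6279eff0e7ddfb861fffe003fffb207bfdf1b8bfdf07e3fdf0ddef6f3359dff7379ff3095cfff317ddfb1239fff267de7f3275dff067ffde08dbfdf0e39eff0667fdf472e7ff062fffb0a36fff3ddf4ef0ee6dff267bf5f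
    0x0 (by decide +kernel)

theorem surveyed_118 : Surveyed 0x1e1a40ed98f70c15e29 0x27a794f5dffd19c9c59 1374128 88 0 :=
  .of_survey 100 0x82b3fffc66dbff16a9fff0273fff0e39dff862bfff42f1fff667f1ff265bdffc4bef7f8ecdfbf3c7bfcf3139fff203bfff187bfdf6c7b7df0e5deff227bfdf307ddff9b93fdf667f75f165ddffd389fff0e5bfdf233afff8663fff0feedfd96af9ff207bdff885ffdf2f6bbdf187deff227edff6bc9eff838bfff0effede8e9f7bf073e7ff0f49fff8ecfeef3af5cff800ffff3af7cdf8e9bffe97a3fdf0e5f3ff000ffff023efff003bfff8277fdf57ae5ff277bfed868bfff8e3fbfb2959fffd91cfff227dfbf061bfff463b7ff2e7bfde4a59fff3c7deef06eedff18bdeff0275fff027ddff067dffb023fbff607bfdf1ebedfe07e1fff9a9ff9fd391fff287edff861f7ff981dfff843fffb679b7bfc71f3ff863bfdf9b95eff1739fdf8f36ffb1a3bfdfc239fff0e3bffb0d5d7ff409bfff166ddff163f5ff13cddff613afff062bfff1fd3fcf0e7dedf3cdfcef0639fff0e3ef7f7039fff803efff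
    0x0 (by decide +kernel)

theorem surveyed_119 : Surveyed 0x27a794f5dffd19c9c59 0x36dfe7e27cc42ca76c9 1413426 92 0 :=
  .of_survey 100 0x707ddff327f9ff223bfff1b9deff0eefedf067ddff46df5ff46ebfdf1eedcff2f3af7f801ffff04ffdfb8d1f7ff8e3ef7f1c7f7df0e3afff2e7beef001ffff06abfff303bfff275bfef62bbfbf1c7ffcf863fffe0eefaff063f7ff38ffcdf333f9ff823bfff1e7ddfb33b3dff603bffff039fff393bfdf189bfff1dcddff27b3f7f5a7cfdf57997ff227bfbf00ffdfb4af6dff067bfdf4f5b3ff123ffdf073afff06777ffc27dffb066ffdfa71b7ff0fdef6f0e5cfff0e5ddff16bffaf6079fff1daedff2e7bfdb2f9b6ff0fe6dff46bbffe063fffb0e5b7ff397dedf2f5e5ff1339fff1e7ffcb0ef7dfb963dffb0e3bfdf189fdff2f5b7bf183ffdfe83afff1f9cf7f820ffff0d8bfff861bfff0f3fbfb8e5f7df8217fff2edf4ff0ef7eef42d9fff1e7f79f1e7bfde32ffd9f8ecfdfb023bfff8f367ff2edbf5f0e3e7ff0a7bfdf020ffff0c3fffb0abbeffa59bf7f0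effdf9066fff70217fff37e1dff
    0x0 (by decide +kernel)

theorem surveyed_120 : Surveyed 0x36dfe7e27cc42ca76c9 0x58866869a8400768df1 1143936 88 0 :=
  .of_survey 100 0xe27bff71739fff062ffff0f3afff0e7bfdf28ffcff027dfff0ecfdffccdf5ff79b9eff3effceb0667fff267bf7fc73f3ff887ffdf027fbff272bfff26e3fff2efff1f1a3ffdf0e3fffb377df7706ffdfb1d8bfff113dfff46d9fffaa7fef7267bfdf1fbbff33f7deeb2763fff273afff3d7ddfb52b9fff0e7bffb1e7dddf4effaef0cffdfb16dddff007dfff1b3afff1fbdfbb1d4dfff039bfff86abfff07ef9ffb03bfff0e39fff0e5fffe863f7ff3339fff099bfff3effcde093efff0f3e7ff327ddffbaf7cdf063bfff821ffff989bfff2b3afff0f5d7ffb03fdff20ffcff8237fff2abbeff267bfef2f3aeff7bf1edf1adddff866fbfff87dedf866ffdf2f5adff6fdd6bf2edbcff0edf5ff0e7dffbc29bfff019bfff8e5bfdf0eedeff021ffff123bfff1b9bfdf081ffff871f7ff2ebbe7f86e7dff3f7dede1e7bfcf276bbff0f767ffc89bfff069bfffc83efff167ffcf4b9afff02ffdfb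387bfdf
    0x0 (by decide +kernel)

theorem surveyed_121 : Surveyed 0x58866869a8400768df1 0xa1294f4c8980f023e31 1053220 93 0 :=
  .of_survey 100 0x1b5dfff2f59fff3739fff2ebbeff46efbff067bfff367ddffc27dfff123ffff16ffdef393efff38dfdff06e7fff1f3e7ff70fbdff1bdddff1f9bfdf2f5b7ff0e3bfff26fff3f0effdfb8e5ffdf2f3eeff0fdf5ff227bfff1f9deff3a7bfdf067dfff2edbf7f8f8bfff823ffff47f37ff987ffdf8277fff8ecfbff1e7ffcfa72bfff0e5bfff8fc3fff607bfff12bbfff8f2efff1fcddff0e7ddff1afff9f673b7ff1f9bfef8e3fffb376ddff1dbef7fa763fff861ffff079bfff2f5f5ff023ffff2f3ef7f3affcdf1ebfdfb427dfff307dfff1ebeffe0277fff9765fff0e5dfff027bfff862ffff0e3efff307fdff42f3fff3af7cff0b9bfff8667fff803ffff0a7ffdf9a77fdf5dc9fff8fcedff207bfff1f9bffe9b9deff003ffff323bfff317ddff667f7bf07e3fff967ffcf061ffff067fffe3b75efff07ddff863bfff3b73fdf271bfff1f3fbfb1e7ffdec67dffb06effbf237bfdf166dfff007bfff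
    0x0 (by decide +kernel)

theorem surveyed_122 : Surveyed 0xa1294f4c8980f023e31 0x230a4dcccf3da75e3bb1 636090 91 0 :=
  .of_survey 100 0xe7ffff5fbe7ff40fffff3effdfb3f7dffb00fffff0edffff0effdff1e7dfff0fcffff9f9fffe867ffff3f7ffde0effeff8e3ffff86effff2f3bfff1ebefff87e7fff32ffdff337dfff8e5ffff1f9bfff2f5bfff1ebfeff1e7ffdf8ecffff71bbfff067ffff8fc7fff3b3efff2effcff227ffffc67dfff1ebfffbe27bfff8f3efff0e3ffff607ffff827ffff0e7bfff3effcdf06ffdff9b9bfffc6ebfff60fbfff1f9fffe0e5ffff56ff5ff8e7fffb3f7dedf07ebfff1fbbffb1fbef7ff07dfff0ecffff0e7dfff06ffffe027ffffb99bfff07efbff0fc7fff3effcef207ffff267bfff8ef7ffbf27ddff807ffff9ebfeef3cffdfb0edbfff377dffe1e7ddff863ffff007ffff3f7ddfb02ffdff866ffff273bfff327dfff0f9bfff627bfff3efff1f03f3fff0f3efffb03fffff93afff1e7deff1e7bfdf6fdb7bf3f7defe267ff7f52bbfff00ffdff3f7bfde0fcbfffe07bfff1a7ffdf063ffff879bf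ff
    0x0 (by decide +kernel)

theorem surveyed_123 : Surveyed 0x230a4dcccf3da75e3bb1 0x8292f1f269168c3c0a549 100900 43 0 :=
  .of_survey 46 0xfffffff7ffffff3ffffff7ffbfff1ffffff3efffff3f7ffffcefffff7ffbfdf0ffffff1efffff1fbffff3f7bfff07fffff1ffffdf3effdff3f7dfff03fffff9f9ffff6fdbfff01fffff3fffdfb0efffff1e7ffff46fffff0fffffb7ffbfde1ebffff1f9ffff8e7ffff1effdff8edffff06fffff1efffdf377dfff3f7ddff07effff8fcffff07ffffe3effcff1fbfffbaf5bfff3f7bfdf1e7bffff0ffdff02fffff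
    0x0 (by decide +kernel)

theorem surveyed : Surveyed 0 0x8292f1f269168c3c0a549 (2 ^ 28) 7123 366 := by
  have h :=
    surveyed_0 |>.append surveyed_1 |>.append surveyed_2 |>.append surveyed_3 |>.append surveyed_4
      |>.append surveyed_5 |>.append surveyed_6 |>.append surveyed_7 |>.append surveyed_8
      |>.append surveyed_9 |>.append surveyed_10 |>.append surveyed_11 |>.append surveyed_12
      |>.append surveyed_13 |>.append surveyed_14 |>.append surveyed_15 |>.append surveyed_16
      |>.append surveyed_17 |>.append surveyed_18 |>.append surveyed_19 |>.append surveyed_20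
      |>.append surveyed_21 |>.append surveyed_22 |>.append surveyed_23 |>.append surveyed_24
      |>.append surveyed_25 |>.append surveyed_26 |>.append surveyed_27 |>.append surveyed_28
      |>.append surveyed_29 |>.append surveyed_30 |>.append surveyed_31 |>.append surveyed_32
      |>.append surveyed_33 |>.append surveyed_34 |>.append surveyed_35 |>.append surveyed_36
      |>.append surveyed_37 |>.append surveyed_38 |>.append surveyed_39 |>.append surveyed_40
      |>.append surveyed_41 |>.append surveyed_42 |>.append surveyed_43 |>.append surveyed_44
      |>.append surveyed_45 |>.append surveyed_46 |>.append surveyed_47 |>.append surveyed_48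
      |>.append surveyed_49 |>.append surveyed_50 |>.append surveyed_51 |>.append surveyed_52
      |>.append surveyed_53 |>.append surveyed_54 |>.append surveyed_55 |>.append surveyed_56
      |>.append surveyed_57 |>.append surveyed_58 |>.append surveyed_59 |>.append surveyed_60
      |>.append surveyed_61 |>.append surveyed_62 |>.append surveyed_63 |>.append surveyed_64
      |>.append surveyed_65 |>.append surveyed_66 |>.append surveyed_67 |>.append surveyed_68
      |>.append surveyed_69 |>.append surveyed_70 |>.append surveyed_71 |>.append surveyed_72
      |>.append surveyed_73 |>.append surveyed_74 |>.append surveyed_75 |>.append surveyed_76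
      |>.append surveyed_77 |>.append surveyed_78 |>.append surveyed_79 |>.append surveyed_80
      |>.append surveyed_81 |>.append surveyed_82 |>.append surveyed_83 |>.append surveyed_84
      |>.append surveyed_85 |>.append surveyed_86 |>.append surveyed_87 |>.append surveyed_88
      |>.append surveyed_89 |>.append surveyed_90 |>.append surveyed_91 |>.append surveyed_92
      |>.append surveyed_93 |>.append surveyed_94 |>.append surveyed_95 |>.append surveyed_96
      |>.append surveyed_97 |>.append surveyed_98 |>.append surveyed_99 |>.append surveyed_100
      |>.append surveyed_101 |>.append surveyed_102 |>.append surveyed_103 |>.append surveyed_104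
      |>.append surveyed_105 |>.append surveyed_106 |>.append surveyed_107 |>.append surveyed_108
      |>.append surveyed_109 |>.append surveyed_110 |>.append surveyed_111 |>.append surveyed_112
      |>.append surveyed_113 |>.append surveyed_114 |>.append surveyed_115 |>.append surveyed_116
      |>.append surveyed_117 |>.append surveyed_118 |>.append surveyed_119 |>.append surveyed_120
      |>.append surveyed_121 |>.append surveyed_122 |>.append surveyed_123
  exact h

/-! ### The minimal forbidden graphs -/

theorem IsBiconnected.of_iso {V W : Type*} {G : SimpleGraph V} {H : SimpleGraph W} (e : G ≃g H)
    (h : IsBiconnected G) : IsBiconnected H := by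
  refine ⟨e.connected_iff.1 h.1, fun v => ?_⟩
  let f : G.induce ({e.symm v}ᶜ : Set V) →g H.induce ({v}ᶜ : Set W) :=
    { toFun := fun x => ⟨e x, fun hx => x.2 (by
        rw [Set.mem_singleton_iff] at hx ⊢
        exact (e.symm_apply_apply _).symm.trans (congrArg e.symm hx))⟩
      map_rel' := fun {x y} hxy => e.map_adj_iff.2 hxy }
  refine (h.2 (e.symm v)).map f fun ⟨y, hy⟩ => ⟨⟨e.symm y, fun hx => hy ?_⟩, ?_⟩
  · rw [Set.mem_singleton_iff] at hx ⊢
    exact e.symm.injective hx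
  · exact Subtype.ext (e.apply_symm_apply y)

theorem IsFLe8Free.of_iso {V W : Type*} {G : SimpleGraph V} {H : SimpleGraph W} (e : G ≃g H)
    (h : IsFLe8Free G) : IsFLe8Free H := by
  have hf : ∀ {n : ℕ} {F : SimpleGraph (Fin n)}, F.Free G → F.Free H := fun hF hFH =>
    hF (hFH.trans ⟨e.symm.toCopy⟩)
  obtain ⟨h1, h2, h3, h4, h5, h6, h7⟩ := h
  exact ⟨hf h1, hf h2, hf h3, hf h4, hf h5, hf h6, fun i => hf (h7 i)⟩

theorem exists_iso_codeGraph {l : List ℕ} {lo hi : ℕ} (h : IncreasingInvariants l lo hi (2 ^ 28))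
    {V : Type*} [Fintype V] (hV : Fintype.card V = 8) (G : SimpleGraph V) :
    ∃ c ∈ l, Nonempty (codeGraph c ≃g G) := by
  let e : G ≃g G.map (Fintype.equivFinOfCardEq hV).toEmbedding :=
    SimpleGraph.Iso.map (Fintype.equivFinOfCardEq hV) G
  obtain ⟨c, hc, ⟨e'⟩⟩ := h.exists_iso (G.map (Fintype.equivFinOfCardEq hV).toEmbedding)
  exact ⟨c, hc, ⟨e'.trans e.symm⟩⟩

theorem isContained_G27 {V : Type*} [Fintype V] (hV : Fintype.card V = 8) {G : SimpleGraph V}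
    (hb : IsBiconnected G) (hf : IsFLe8Free G) : G.IsContained G27 := by
  obtain ⟨l, h, h'⟩ := surveyed
  obtain ⟨c, hc, ⟨e⟩⟩ := exists_iso_codeGraph h hV G
  exact SimpleGraph.IsContained.trans ⟨e.symm.toCopy⟩
    (h'.isContained c hc (hb.of_iso e.symm) (hf.of_iso e.symm))

theorem numIsoClasses_isBiconnected : numIsoClasses 8 (fun G => IsBiconnected G) = 7123 := by
  obtain ⟨l, h, h'⟩ := surveyed
  rw [h.numIsoClasses_eq fun G H e hG => hG.of_iso e, h'.countP_biconnected]

theorem numIsoClasses_isFLe8Free :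
    numIsoClasses 8 (fun G => IsBiconnected G ∧ IsFLe8Free G) = 366 := by
  obtain ⟨l, h, h'⟩ := surveyed
  rw [h.numIsoClasses_eq fun G H e hG => ⟨hG.1.of_iso e, hG.2.of_iso e⟩]
  convert h'.countP_free

theorem IsMinimalForbidden.nonempty_iso {V W : Type*} {G : SimpleGraph V} {F : SimpleGraph W}
    (hG : IsMinimalForbidden G) (hF : IsForbidden F) (h : F.IsContained G) :
    Nonempty (F ≃g G) := by
  obtain ⟨f⟩ := h
  have htop : f.toSubgraph = ⊤ := by
    by_contra hne
    exact hF ((hG.2 _ hne).of_isContained ⟨f.isoToSubgraph.toCopy⟩)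
  have e := f.isoToSubgraph
  rw [htop] at e
  exact ⟨e.trans SimpleGraph.Subgraph.topIso⟩

theorem isMinimalForbidden_of_deleteEdges {V : Type*} {G : SimpleGraph V} (hG : IsForbidden G)
    (hadj : ∀ v, ∃ w, G.Adj v w)
    (h : ∀ a b, G.Adj a b → IsUnitDistance (G.deleteEdges {s(a, b)})) : IsMinimalForbidden G := by
  refine ⟨hG, fun H hH => ?_⟩
  obtain ⟨a, b, hab, hnot⟩ : ∃ a b, G.Adj a b ∧ ¬ H.Adj a b := by
    by_contra! hall
    refine hH (SimpleGraph.Subgraph.ext ?_ ?_)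
    · ext v
      obtain ⟨w, hw⟩ := hadj v
      exact iff_of_true (H.edge_vert (hall v w hw)) trivial
    · ext v w
      exact ⟨fun hvw => H.adj_sub hvw, fun hvw => hall v w hvw⟩
  refine (h a b hab).of_isContained ⟨⟨⟨Subtype.val, fun {x y} hxy => ?_⟩, Subtype.val_injective⟩⟩
  rw [SimpleGraph.deleteEdges_adj]
  refine ⟨H.adj_sub hxy, fun he => hnot ?_⟩
  rw [Set.mem_singleton_iff, Sym2.eq_iff] at he
  have hxy' : H.Adj x y := hxy
  rcases he with ⟨h1, h2⟩ | ⟨h1, h2⟩ <;> rw [h1, h2] at hxy'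
  · exact hxy'
  · exact hxy'.symm

/-- Removes the edge with ends `a` and `b` from the packed matrix `N`. -/
def deleteEdge (N a b : ℕ) : ℕ :=
  Nat.xor N (Nat.lor (Nat.pow 2 (Nat.add (Nat.mul 8 a) b)) (Nat.pow 2 (Nat.add (Nat.mul 8 b) a)))

theorem Packs.testBit_deleteEdge {N : ℕ} {G : SimpleGraph (Fin 8)} (h : Packs N G)
    {a b i j : Fin 8} (hij : (G.deleteEdges {s(a, b)}).Adj i j) :
    (deleteEdge N a b).testBit (8 * i + j) = true := by
  rw [SimpleGraph.deleteEdges_adj, Set.mem_singleton_iff, Sym2.eq_iff] at hij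
  obtain ⟨h1, h2⟩ := hij
  push Not at h2
  change (N ^^^ (2 ^ (8 * (a : ℕ) + b) ||| 2 ^ (8 * (b : ℕ) + a))).testBit _ = true
  rw [Nat.testBit_xor, Nat.testBit_or, Nat.testBit_two_pow, Nat.testBit_two_pow, (h i j).2 h1,
    decide_eq_false, decide_eq_false]
  · rfl
  · intro e
    exact h2.2 (by omega) (by omega)
  · intro e
    exact h2.1 (by omega) (by omega)

/-- For `a < b`, the entries of `deletionEmbeddings i` from number `8 * (b * (b - 1) / 2 + a)` on
are an embedding in `G27` of the graph `minForbidden8 i` without its edge `ab`. -/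
def deletionEmbeddings : Fin 13 → ℕ :=
  ![0x2044306a3000000000000c00eb08e80000000000000000000000000000000904306a3000000000008040eb08e8000000000000000000000000000000208670352a510164890718447031240000000000000000000000000000000000000000184041423a000000000000000000000000000000284043086b18416139071840a111271841013ac7,
    0x74410b0b48b223a80c4000000000001c410b0b4800000000000000000000000000000000000000008440eb08e800000000000000000000000000000000000000004a1a750c40d0907859c088f428182000000000000000000000000000000000000000002980120963000000000000000000000000000000314040886b1dc04139271dc041292725c0328446,
    0x51da91904071da919040000000000000000000000000000000000000000085b4811c0e0000000000846a75886000000000000000000000b411a389c0000000000086ab158c4012cf58c060000000000000000000000000000000000000000020d2d3b8400000000000000000000020d2d3a840168e875a0000000000000000000000d0907b38106a464100ea,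
    0x22ca6180417aca6180410000000000000000000000000000000000000000000000000000000000000000000000941eb20c02000000000025ca6180410000000000aae06180410000000000c831412c6f000000000000000000000000000000490f50086b0000000000aae1618041b91eb28c02941eb88c020000000000d2216100ee491071880eaae161804e,
    0x2bd6208c060000000000000000000000000000000000000000000000000093d6208c06305632080500000000000000000000ce28b13c600000000000000000000020d61308050000000000943425806f00000000000000000000bbd6228c043a350b080ed42ce380480000000000000000000093d62d0c10bbd6208c046250219c040000000000c804ba0df8,
    0x510a618041590a61804100000000000000000000228a6180410000000000000000000022c62280c100000000000000000000259c6180410000000000238e2280c10000000000000000000000000000002906b3002200000000001c2ce10026710a638041b1062700c10000000000214c118162314830804b80c41b01c6,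
    0x390a6180410000000000000000000000000000000000000000490a61804100000000003b8a61804100000000000000000000849eb20c02000000000000000000003bac618041000000000071eab0880300000000000000000000000000000045a110804300000000003bad018041190a638041190a650041000000000093d6288e00d42ce0804758c8508046,
    0x394833002200000000000000000000590a618041d40c1880620000000000594c178062d49eb80c0200000000000000000000d42c1880620000000000123503d9c000000000000000000000000000000086916888600000000000d42ce88062000000000083d6290c8000000000009804b80e4f442ced00479004b80e2f,
    0x590a61804139062280c10000000000000000000000000000003a8224808300000000003982248083ac9eb80c02000000000000000000004bac4380430000000000a8b50381d6000000000000000000000000000000d42c8880620000000000abad038041000000000039062480c10000000000a804b80e4fabad03805a3906248141,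
    0xaa21658860a9ece58860000000000041ece588600000000000000000000000000000000000000000a9e16588600000000000214604a0e200000000000000000000a9e0e58860000000000000000000000000000000d0907802ce00000000000000000000000000000038aab702d0d22168886041eced0820000000000046ad0389c045840d4223191a91002a,
    0x22c62280c120d62280c100000000007ac62280c100000000000000000000000000000084e4f00c4b25c62280c1000000000000000000000000000000000000000020ee2280c1000000000000000000000000000000000000000000000000008580ed204700000000004a0e2200a64a0e260c804a0e2200c100000000004a0e220ca04a0e22006b4a0e220061,
    0xdb508880300000000000000000000000000000075a30d0c0271d49680430000000000000000000009974788030000000000000000000086848382ce00000000005bf5280860102b092c6f291631180100000000000000000000010e9a886b00000000000000000000000000000000000000000000000000190e94080185b4814403190e940816190e94081a,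
    0x3b52a200623a342802ce00000000000000000000000000000000000000007dc6410026aace2702d03a12a2006200000000000000000000000000000000000000003a136200624a0e2300a4000000000000000000000000000000000000000021406120e90000000000000000000020c02b1d094a0e27006400000000008580e11d758580e11d1a4a0e2702c4]

/-- Tells whether the graph packed in `N` can be embedded in `G27` after the removal of any of its
edges, by the maps packed in `w`. -/
noncomputable def deletionsEmbed (N w : ℕ) : Bool :=
  allBelow 8 fun b => allBelow b fun a =>
    cond (Nat.testBit N (Nat.add (Nat.mul 8 a) b))
      (force (deleteEdge N a b) fun N =>
        force (Nat.shiftRight w (Nat.mul 40 (Nat.add (Nat.div (Nat.mul b (Nat.pred b)) 2) a)))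
          fun w => embeds 8 27 N w g27Adj) true

theorem isContained_deleteEdges {N w : ℕ} {G : SimpleGraph (Fin 8)} (hN : Packs N G)
    (h : deletionsEmbed N w = true) {a b : Fin 8} (hab : G.Adj a b) :
    (G.deleteEdges {s(a, b)}).IsContained G27 := by
  wlog hlt : a < b generalizing a b
  · rw [Sym2.eq_swap]
    exact this hab.symm (lt_of_le_of_ne (not_lt.1 hlt) hab.ne')
  simp only [deletionsEmbed, allBelow_eq_true, force_eq] at h
  have h1 := h b b.2 a hlt
  have h2 : Nat.testBit N (Nat.add (Nat.mul 8 a) b) = true := (hN a b).2 hab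
  rw [h2, cond_true] at h1
  exact isContained_of_embeds (fun i j => hN.testBit_deleteEdge) adj_of_g27Adj h1

theorem deletionsEmbed_minForbidden8 :
    ∀ i, deletionsEmbed (minForbidden8Packed i) (deletionEmbeddings i) = true := by
  decide +kernel

theorem exists_testBit_minForbidden8 :
    ∀ i, ∀ v : Fin 8, ∃ w : Fin 8, (minForbidden8Packed i).testBit (8 * v + w) = true := by
  decide +kernel

theorem isMinimalForbidden_of_iso {V : Type*} {G : SimpleGraph V} {i : Fin 13}
    (e : G ≃g minForbidden8 i) : IsMinimalForbidden G := by
  refine isMinimalForbidden_of_deleteEdges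
    (fun h => isForbidden_minForbidden8 i (h.of_isContained ⟨e.symm.toCopy⟩)) (fun v => ?_)
    fun a b hab => ?_
  · obtain ⟨w, hw⟩ := exists_testBit_minForbidden8 i (e v)
    refine ⟨e.symm w, e.map_adj_iff.1 ?_⟩
    rw [e.apply_symm_apply]
    exact (packs_minForbidden8 i _ _).1 hw
  · have h := isContained_deleteEdges (packs_minForbidden8 i) (deletionsEmbed_minForbidden8 i)
      (e.map_adj_iff.2 hab)
    refine isUnitDistance_G27.of_isContained (SimpleGraph.IsContained.trans
      ⟨⟨⟨e, fun {x y} hxy => ?_⟩, e.injective⟩⟩ h)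
    rw [SimpleGraph.deleteEdges_adj, Set.mem_singleton_iff, Sym2.eq_iff] at hxy ⊢
    refine ⟨e.map_adj_iff.2 hxy.1, fun he => hxy.2 ?_⟩
    exact he.imp (fun h => ⟨e.injective h.1, e.injective h.2⟩)
      fun h => ⟨e.injective h.1, e.injective h.2⟩

theorem IsMinimalForbidden.exists_iso {V : Type*} [Fintype V] (hV : Fintype.card V = 8)
    {G : SimpleGraph V} (hG : IsMinimalForbidden G) : ∃ i, Nonempty (G ≃g minForbidden8 i) := by
  by_contra! hnone
  have hsmall : ∀ {n : ℕ} {F : SimpleGraph (Fin n)}, n ≠ 8 → IsForbidden F → F.Free G :=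
    fun {n F} hn hF hFG => by
      obtain ⟨e⟩ := hG.nonempty_iso hF hFG
      have := Fintype.card_congr e.toEquiv
      rw [Fintype.card_fin] at this
      omega
  refine hG.1 (isUnitDistance_G27.of_isContained (isContained_G27 hV
    (hG.isBiconnected (by omega)) ⟨hsmall (by norm_num) isForbidden_F_4_6_1,
      hsmall (by norm_num) isForbidden_F_5_6_1, hsmall (by norm_num) isForbidden_F_6_9_1,
      hsmall (by norm_num) isForbidden_F_7_10_1, hsmall (by norm_num) isForbidden_F_7_11_1,
      hsmall (by norm_num) isForbidden_F_7_11_2, fun i hi => ?_⟩))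
  obtain ⟨e⟩ := hG.nonempty_iso (isForbidden_minForbidden8 i) hi
  exact (hnone i).false e.symm

theorem graphInvariant_eq_of_packs {N : ℕ} {G : SimpleGraph (Fin 8)} (h : Packs N G) :
    graphInvariant G = invariantPacked (vertexPacked (walkPacked N)) := by
  rw [walkPacked_eq h, vertexPacked_eq, invariantPacked_eq]

theorem eq_of_invariantPacked_eq : ∀ i j : Fin 13,
    invariantPacked (vertexPacked (walkPacked (minForbidden8Packed i))) =
      invariantPacked (vertexPacked (walkPacked (minForbidden8Packed j))) → i = j := by
  decide +kernel

theorem eq_of_iso_minForbidden8 {i j : Fin 13} (e : minForbidden8 i ≃g minForbidden8 j) :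
    i = j := by
  refine eq_of_invariantPacked_eq i j ?_
  rw [← graphInvariant_eq_of_packs (packs_minForbidden8 i),
    ← graphInvariant_eq_of_packs (packs_minForbidden8 j)]
  exact (graphInvariant_iso e).symm

theorem mainTheorem2 :
    -- the minimal forbidden graphs on 8 vertices are, up to isomorphism, the 13 listed graphs
    (∀ (V : Type*) [Fintype V], Fintype.card V = 8 → ∀ G : SimpleGraph V,
      (IsMinimalForbidden G ↔ ∃ i, Nonempty (G ≃g minForbidden8 i))) ∧
    -- the 13 listed graphs are pairwise non-isomorphic, and none of them is unit-distance
    (∀ i j, Nonempty (minForbidden8 i ≃g minForbidden8 j) → i = j) ∧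
    (∀ i, IsForbidden (minForbidden8 i)) ∧
    -- there are 7123 biconnected graphs on 8 vertices, and 366 of them contain no listed graph
    numIsoClasses 8 (fun G => IsBiconnected G) = 7123 ∧
    numIsoClasses 8 (fun G => IsBiconnected G ∧ IsFLe8Free G) = 366 ∧
    -- the given points are a unit-distance embedding of the 27-vertex graph
    Function.Injective g27Point ∧
    (∀ a b, G27.Adj a b → dist (g27Point a) (g27Point b) = 1) ∧
    -- that graph contains every biconnected graph on 8 vertices that contains no listed graph
    (∀ (V : Type*) [Fintype V], Fintype.card V = 8 → ∀ G : SimpleGraph V,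
      IsBiconnected G → IsFLe8Free G → G.IsContained G27) := by
  refine ⟨fun V _ hV G => ⟨fun h => h.exists_iso hV, fun ⟨_, ⟨e⟩⟩ => isMinimalForbidden_of_iso e⟩,
    fun _ _ ⟨e⟩ => eq_of_iso_minForbidden8 e, isForbidden_minForbidden8,
    numIsoClasses_isBiconnected, numIsoClasses_isFLe8Free, g27Point_injective,
    dist_g27Point_eq_one, fun V _ hV G => isContained_G27 hV⟩
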